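/- Let $M>0$, $E\in\mathbb{R}$, $\varepsilon\ge 0$. Let $(U,V)$, $UV<1$, be Kruskal coordinates of the extended $1+1$ Schwarzschild spacetime, with $r>0$ determined by $UV=(1-\tfrac{r}{2M})e^{r/2M}$, metric $g=-\frac{32M^3}{r}e^{-r/2M}\,dU\,dV$ and Killing field $\xi=\frac{1}{4M}(-U\partial_U+V\partial_V)$. Let $\mathsf{x}:J\to\{UV<1\}$, with $J$ an open interval with right end point $\tau_{\rm sing}<\infty$, be a smooth future-directed timelike geodesic parametrised by proper time, with energy $-g(\xi,\dot{\mathsf{x}})=\varepsilon$, which runs into the black hole singularity: $r(\tau)\to 0$ as $\tau\to\tau_{\rm sing}$. Along $\mathsf{x}$ consider the Wightman function of the massless scalar field, either in the Hartle–Hawking–Israel (HHI) vacuum, $\mathcal{W}=-\frac1{4\pi}\ln[(0^++i\Delta U)(0^++i\Delta V)]+c$, or, where $V>0$, in the Unruh vacuum, $\mathcal{W}=-\frac1{4\pi}\ln[(0^++i\Delta U)(0^++i\Delta v)]+c$ with $v=4M\ln V$; here $c\in\mathbb{R}$ is an arbitrary constant (the infrared ambiguity). The response of the derivative-coupling detector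 with energy gap $E$ and switching function $\chi\in C_0^\infty$ is $$\mathcal{F}=\iint \chi(\tau')\chi(\tau'')e^{-iE(\tau'-\tau'')}\,\partial_{\tau'}\partial_{\tau''}\mathcal{W}(\mathsf{x}(\tau'),\mathsf{x}(\tau''))\,d\tau'\,d\tau''$$ with distributional derivatives. Its transition rate $\dot{\mathcal{F}}(E,\tau,\tau_0)$ at $\tau$ after a sharp switch-on at $\tau_0<\tau$ is the limit as $\delta\to0^+$ of $\partial_\tau\mathcal{F}$ for $\chi(u)=h_1(\tfrac{u-\tau_0+\delta}{\delta})\,h_2(\tfrac{-u+\tau+\delta}{\delta})$, where $h_1,h_2\ge 0$ are any smooth functions with $h_i(x)=0$ for $x<0$ and $h_i(x)=1$ for $x>1$. Then, for every $\tau_0\in J$ (with $V(\tau_0)>0$ in the Unruh case), the limit defining $\dot{\mathcal{F}}(E,\tau,\tau_0)$ exists for all $\tau\in(\tau_0,\tau_{\rm sing})$ and is real and independent of $h_1,h_2$, and, for fixed $\tau_0$ and all other data fixed, as $\tau\to\tau_{\rm sing}^-$, $$\dot{\mathcal{F}}=\frac{1}{8\pi M}\left[\left(\frac{2M}{r(\tau)}\right)^{3/2}+\frac{1+\varepsilon^2}{2}\left(\frac{2M}{r(\tau)}\right)^{1/2}\right]+O(1),\qquad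 \dot{\mathcal{F}}\sim\frac{1}{6\pi(\tau_{\rm sing}-\tau)}.$$ If $\varepsilon\ge1$ and $J=(-\infty,\tau_{\rm sing})$ then, in both vacua, every $\tau_0\in J$ is an admissible switch-on time, the limit $\dot{\mathcal{F}}(E,\tau)=\lim_{\tau_0\to-\infty}\dot{\mathcal{F}}(E,\tau,\tau_0)$ exists for every $\tau\in J$, and it satisfies the same two asymptotic relations as $\tau\to\tau_{\rm sing}^-$. -/

import Mathlib

open Set Filter Topology Asymptotics
open scoped ContDiff

namespace SchwarzschildDetector

noncomputable section

/-! ### The Kruskal extension of 1+1 Schwarzschild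

Points are pairs `p = (U, V)` of Kruskal null coordinates with `U * V < 1`. -/

/-- The function of `r` that equals `U * V` on the Kruskal manifold. -/
def kruskalProduct (M r : ℝ) : ℝ := (1 - r / (2 * M)) * Real.exp (r / (2 * M))

/-- The radius `r(U, V)`: the solution `r > 0` of `(1 - r / 2M) exp (r / 2M) = U V`.
For `U V < 1` there is exactly one, see `existsUnique_radius`, so the infimum is this value. -/
def radius (M : ℝ) (p : ℝ × ℝ) : ℝ :=
  sInf {r : ℝ | 0 < r ∧ kruskalProduct M r = p.1 * p.2}

theorem existsUnique_radius {M x : ℝ} (hM : 0 < M) (hx : x < 1) :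
    ∃! r : ℝ, 0 < r ∧ kruskalProduct M r = x := by
  have hanti : StrictAntiOn (fun y : ℝ => (1 - y) * Real.exp y) (Ici 0) := by
    apply strictAntiOn_of_deriv_neg (convex_Ici 0)
    · fun_prop
    · intro y hy
      rw [interior_Ici] at hy
      have hd : HasDerivAt (fun y : ℝ => (1 - y) * Real.exp y)
          ((0 - 1) * Real.exp y + (1 - y) * Real.exp y) y :=
        ((hasDerivAt_const y (1 : ℝ)).sub (hasDerivAt_id y)).mul (Real.hasDerivAt_exp y)
      rw [hd.deriv]
      have hpos : 0 < y * Real.exp y := mul_pos hy (Real.exp_pos y)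
      linarith
  have h2 : 0 < 2 * M := by positivity
  obtain ⟨y, hy, hyx⟩ : ∃ y : ℝ, 0 < y ∧ (1 - y) * Real.exp y = x := by
    have hb : (0 : ℝ) ≤ 1 + |x| := by positivity
    have hle : (1 - (1 + |x|)) * Real.exp (1 + |x|) ≤ x := by
      have h1 : 1 ≤ Real.exp (1 + |x|) := Real.one_le_exp hb
      have h3 : 0 ≤ |x| := abs_nonneg x
      have h4 : -|x| ≤ x := neg_abs_le x
      nlinarith
    have hc : ContinuousOn (fun y : ℝ => (1 - y) * Real.exp y) (Icc 0 (1 + |x|)) := by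
      fun_prop
    obtain ⟨y, hy, hyx⟩ := intermediate_value_Icc' hb hc ⟨hle, by simpa using hx.le⟩
    refine ⟨y, lt_of_le_of_ne hy.1 ?_, hyx⟩
    rintro rfl
    simp only [sub_zero, Real.exp_zero, mul_one] at hyx
    linarith
  refine ⟨2 * M * y, ⟨by positivity, ?_⟩, ?_⟩
  · simp only [kruskalProduct]
    rw [mul_div_cancel_left₀ y h2.ne']
    exact hyx
  · rintro r ⟨hr, hrx⟩
    have := hanti.injOn (mem_Ici.2 (div_pos hr h2).le) (mem_Ici.2 hy.le)
      (show (1 - r / (2 * M)) * Real.exp (r / (2 * M)) = (1 - y) * Real.exp y from hrx.trans hyx.symm)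
    rw [← this]
    field_simp

theorem radius_spec {M : ℝ} {p : ℝ × ℝ} (hM : 0 < M) (hp : p.1 * p.2 < 1) :
    0 < radius M p ∧ kruskalProduct M (radius M p) = p.1 * p.2 := by
  obtain ⟨r, hr, huniq⟩ := existsUnique_radius hM hp
  have hset : {r : ℝ | 0 < r ∧ kruskalProduct M r = p.1 * p.2} = {r} := by
    ext z
    exact ⟨fun hz => huniq z hz, fun hz => by rw [mem_singleton_iff.1 hz]; exact hr⟩
  have hrad : radius M p = r := by
    rw [radius, hset, csInf_singleton]
  rw [hrad]
  exact hr

/-- The positive function `f` with `g = - f dU dV`. It equals `- F(r) / (κ ^ 2 U V)` with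
`F(r) = 1 - 2M/r` and `κ = 1/(4M)`, extended continuously to the horizons `U V = 0`
(see `conformalFactor_eq`). -/
def conformalFactor (M : ℝ) (p : ℝ × ℝ) : ℝ :=
  32 * M ^ 3 / radius M p * Real.exp (-(radius M p / (2 * M)))

theorem conformalFactor_eq {M : ℝ} {p : ℝ × ℝ} (hM : 0 < M) (hp : p.1 * p.2 < 1)
    (h0 : p.1 * p.2 ≠ 0) :
    conformalFactor M p =
      -((1 - 2 * M / radius M p) / ((1 / (4 * M)) ^ 2 * (p.1 * p.2))) := by
  obtain ⟨hr, hk⟩ := radius_spec hM hp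
  rw [← hk] at h0 ⊢
  unfold conformalFactor
  simp only [kruskalProduct] at h0 ⊢
  generalize radius M p = r at *
  have hne : 1 - r / (2 * M) ≠ 0 := left_ne_zero_of_mul h0
  have hne' : 2 * M - r ≠ 0 := by
    intro h
    apply hne
    rw [show 2 * M = r by linarith]
    rw [div_self hr.ne', sub_self]
  have he : Real.exp (r / (2 * M)) ≠ 0 := (Real.exp_pos _).ne'
  have h1 : 1 - r / (2 * M) = (2 * M - r) / (2 * M) := by field_simp
  have h2 : 1 - 2 * M / r = -(2 * M - r) / r := by field_simp; ring
  rw [Real.exp_neg, h1, h2]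
  generalize Real.exp (r / (2 * M)) = e at *
  generalize 2 * M - r = d at *
  field_simp
  norm_num

/-- The metric `g = - f dU dV` (symmetric product) at the point `p`. -/
def metric (M : ℝ) (p a b : ℝ × ℝ) : ℝ :=
  -(conformalFactor M p / 2) * (a.1 * b.2 + a.2 * b.1)

/-- The Killing vector field `κ (-U ∂_U + V ∂_V)`, `κ = 1/(4M)`, which is `∂_t` in the exterior. -/
def killing (M : ℝ) (p : ℝ × ℝ) : ℝ × ℝ := (-(p.1 / (4 * M)), p.2 / (4 * M))

/-- The Christoffel symbol `Γ^U_UU = ∂_U log f`. -/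
def christoffelU (M : ℝ) (p : ℝ × ℝ) : ℝ :=
  deriv (fun u => Real.log (conformalFactor M (u, p.2))) p.1

/-- The Christoffel symbol `Γ^V_VV = ∂_V log f`. For a metric `- f dU dV` all the Christoffel
symbols other than `Γ^U_UU` and `Γ^V_VV` vanish. -/
def christoffelV (M : ℝ) (p : ℝ × ℝ) : ℝ :=
  deriv (fun v => Real.log (conformalFactor M (p.1, v))) p.2

/-- `γ`, restricted to the open interval `J` with right end point `τs`, is a future-directed
timelike geodesic of the Kruskal extension, parametrised by proper time and of Killing energy `ε`,
which hits the curvature singularity `r = 0` as the proper time tends to `τs`. (Along a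
future-directed curve `r → 0` in the future is possible only at the black hole singularity.) -/
structure IsInfallingGeodesic (M ε : ℝ) (J : Set ℝ) (τs : ℝ) (γ : ℝ → ℝ × ℝ) : Prop where
  isOpen : IsOpen J
  ordConnected : J.OrdConnected
  isLUB : IsLUB J τs
  smooth : ContDiffOn ℝ ∞ γ J
  mem_kruskal : ∀ τ ∈ J, (γ τ).1 * (γ τ).2 < 1
  future : ∀ τ ∈ J, 0 < (deriv γ τ).1 ∧ 0 < (deriv γ τ).2
  unit_speed : ∀ τ ∈ J, metric M (γ τ) (deriv γ τ) (deriv γ τ) = -1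
  geodesic_U : ∀ τ ∈ J,
    (deriv (deriv γ) τ).1 + christoffelU M (γ τ) * (deriv γ τ).1 ^ 2 = 0
  geodesic_V : ∀ τ ∈ J,
    (deriv (deriv γ) τ).2 + christoffelV M (γ τ) * (deriv γ τ).2 ^ 2 = 0
  energy : ∀ τ ∈ J, -metric M (γ τ) (killing M (γ τ)) (deriv γ τ) = ε
  hits_singularity : Tendsto (fun τ => radius M (γ τ)) (𝓝[<] τs) (𝓝 0)

/-! ### The vacua of the massless scalar field -/

/-- The two vacua: Hartle-Hawking-Israel and Unruh. -/
inductive Vacuum where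
  | hhi : Vacuum
  | unruh : Vacuum

/-- The part of the Kruskal manifold on which the state is defined: all of it for the
Hartle-Hawking-Israel state; the exterior, the black hole and the future event horizon between
them, that is `V > 0`, for the Unruh state. -/
def Vacuum.region : Vacuum → Set (ℝ × ℝ)
  | .hhi => {p | p.1 * p.2 < 1}
  | .unruh => {p | p.1 * p.2 < 1 ∧ 0 < p.2}

/-- The null coordinate whose plane waves are the left-moving positive frequency modes: `V` for the
Hartle-Hawking-Israel state, `v = (1/κ) log V = 4 M log V` for the Unruh state. The
coordinate for the right-moving modes is `U` in both states. -/
def Vacuum.leftCoord (M : ℝ) : Vacuum → ℝ × ℝ → ℝ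
  | .hhi, p => p.2
  | .unruh, p => 4 * M * Real.log p.2

/-- The `iη`-regularised Wightman function
`-(1/4π) log [(η + i ΔU) (η + i ΔV)] + c` (with `v` in place of `V` for the Unruh state), where
the constant `c` is the infrared ambiguity of the massless field. -/
def wightmanReg (M : ℝ) (s : Vacuum) (c η : ℝ) (p q : ℝ × ℝ) : ℂ :=
  -(1 / (4 * (Real.pi : ℂ))) *
    Complex.log (((η : ℂ) + Complex.I * ((p.1 - q.1 : ℝ) : ℂ)) *
      ((η : ℂ) + Complex.I * ((s.leftCoord M p - s.leftCoord M q : ℝ) : ℂ))) + (c : ℂ)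

/-- The Wightman function, the limit `η → 0⁺` of `wightmanReg` (see `tendsto_wightmanReg`), as a
locally integrable function. -/
def wightman (M : ℝ) (s : Vacuum) (c : ℝ) (p q : ℝ × ℝ) : ℂ :=
  -(1 / (4 * (Real.pi : ℂ))) *
    (Complex.log (Complex.I * ((p.1 - q.1 : ℝ) : ℂ)) +
      Complex.log (Complex.I * ((s.leftCoord M p - s.leftCoord M q : ℝ) : ℂ))) + (c : ℂ)

theorem tendsto_wightmanReg (M : ℝ) (s : Vacuum) (c : ℝ) {p q : ℝ × ℝ} (hU : p.1 ≠ q.1)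
    (hV : s.leftCoord M p ≠ s.leftCoord M q) :
    Tendsto (fun η => wightmanReg M s c η p q) (𝓝[>] 0) (𝓝 (wightman M s c p q)) := by
  have key : ∀ x : ℝ, x ≠ 0 → Tendsto (fun η : ℝ => Complex.log ((η : ℂ) + Complex.I * (x : ℂ)))
      (𝓝[>] 0) (𝓝 (Complex.log (Complex.I * (x : ℂ)))) := by
    intro x hx
    have hc : ContinuousAt (fun η : ℝ => (η : ℂ) + Complex.I * (x : ℂ)) 0 := by fun_prop
    have hs : ((0 : ℝ) : ℂ) + Complex.I * (x : ℂ) ∈ Complex.slitPlane := by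
      right
      simpa using hx
    have := (hc.clog hs).tendsto
    simp only [Complex.ofReal_zero, zero_add] at this
    exact this.mono_left nhdsWithin_le_nhds
  have hsum := (key _ (sub_ne_zero.2 hU)).add (key _ (sub_ne_zero.2 hV))
  refine Tendsto.congr' ?_ ((hsum.const_mul (-(1 / (4 * (Real.pi : ℂ))))).add_const (c : ℂ))
  filter_upwards [self_mem_nhdsWithin] with η hη
  have hη' : (0 : ℝ) < η := hη
  have hre : ∀ x : ℝ, 0 < ((η : ℂ) + Complex.I * (x : ℂ)).re := by
    intro x
    simpa using hη'
  have harg : ∀ x : ℝ, |((η : ℂ) + Complex.I * (x : ℂ)).arg| < Real.pi / 2 := fun x =>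
    Complex.abs_arg_lt_pi_div_two_iff.2 (Or.inl (hre x))
  have hne : ∀ x : ℝ, (η : ℂ) + Complex.I * (x : ℂ) ≠ 0 := fun x h => by
    have := hre x
    rw [h] at this
    simp at this
  unfold wightmanReg
  rw [Complex.log_mul (hne _) (hne _)]
  have h1 := abs_lt.1 (harg (p.1 - q.1))
  have h2 := abs_lt.1 (harg (s.leftCoord M p - s.leftCoord M q))
  constructor <;> linarith [h1.1, h1.2, h2.1, h2.2]

/-! ### The derivative-coupling detector -/

/-- The response function
`∬ χ(τ') χ(τ'') exp (-i E (τ' - τ'')) ∂_τ' ∂_τ'' W(τ', τ'') dτ' dτ''`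
of a derivative-coupling detector with energy gap `E` and switching function `χ`, where `W` is
the pullback of the Wightman function to the worldline and its derivatives are distributional,
that is, they act on the test function `χ(τ') χ(τ'') exp (-i E (τ' - τ''))`. -/
def response (W : ℝ → ℝ → ℂ) (E : ℝ) (χ : ℝ → ℝ) : ℂ :=
  ∫ τ' : ℝ, ∫ τ'' : ℝ, W τ' τ'' *
    deriv (fun a : ℝ => deriv (fun b : ℝ =>
      (χ a : ℂ) * (χ b : ℂ) * Complex.exp (-Complex.I * (E : ℂ) * ((a : ℂ) - (b : ℂ)))) τ'') τ'

/-- Smooth switching profiles: `0` on `x < 0`, `1` on `x > 1`, and non-negative. -/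
structure IsSwitchProfile (h : ℝ → ℝ) : Prop where
  smooth : ContDiff ℝ ∞ h
  nonneg : ∀ x, 0 ≤ h x
  eq_zero : ∀ x, x < 0 → h x = 0
  eq_one : ∀ x, 1 < x → h x = 1

/-- The switching function that rises from `0` to `1` on `[τ₀ - δ, τ₀]` and falls back to `0`
on `[τ, τ + δ]`. -/
def switching (h₁ h₂ : ℝ → ℝ) (δ τ₀ τ : ℝ) (u : ℝ) : ℝ :=
  h₁ ((u - τ₀ + δ) / δ) * h₂ ((-u + τ + δ) / δ)

/-- `R` is the instantaneous transition rate at proper time `τ` of the detector that is sharply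
switched on at `τ₀`: whatever the switching profiles, the derivative of the response with respect
to the switch-off time `τ` exists for small `δ > 0` and tends to `R` in the sharp-switching limit
`δ → 0⁺`. -/
def IsTransitionRate (W : ℝ → ℝ → ℂ) (E τ₀ τ R : ℝ) : Prop :=
  ∀ h₁ h₂ : ℝ → ℝ, IsSwitchProfile h₁ → IsSwitchProfile h₂ →
    ∃ D : ℝ → ℂ,
      (∀ᶠ δ in 𝓝[>] (0 : ℝ),
        HasDerivAt (fun t : ℝ => response W E (switching h₁ h₂ δ τ₀ t)) (D δ) τ) ∧
      Tendsto D (𝓝[>] (0 : ℝ)) (𝓝 (R : ℂ))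

/-- The near-singularity law for a transition rate `R` as `τ → τs` from below, where `r` is the
radius along the trajectory. -/
def NearSingularityLaw (M ε τs : ℝ) (r R : ℝ → ℝ) : Prop :=
  (fun τ => R τ - 1 / (8 * Real.pi * M) *
      ((2 * M / r τ) ^ (3 / 2 : ℝ) + (1 + ε ^ 2) / 2 * (2 * M / r τ) ^ (1 / 2 : ℝ)))
    =O[𝓝[<] τs] (fun _ => (1 : ℝ)) ∧
  R ~[𝓝[<] τs] (fun τ => 1 / (6 * Real.pi * (τs - τ)))

end

end SchwarzschildDetector

/-! Up to a constant, the Wightman function is `-1/(4π)` times a sum of two kernels `log (i (f a - f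
b))`, where `f` is a null coordinate along the trajectory: `U`, and `V` or `v`. The two are treated
separately and added at the end.

For one `f`, split `log (i x) = log |x| + (iπ/2) sign x`. Against the mixed derivative of the test
function the jump gives `πE ∫ χ²`. In the `log |x|` part the term `χ'(a) χ'(b)` is kept; the rest is
the mixed derivative of `χ(a) χ(b) (cos E(a-b) - 1)`, which vanishes to second order at `a = b`, so
two integrations by parts leave the bounded `regularKernel` (`integral_log_mul_second`,
`integral_clog_mul`). The infrared constant integrates to zero.

The derivative `χ'` is a switch-on bump minus a switch-off bump that moves with `τ`. Differentiating
in `τ` and shrinking the bumps gives `coordRate`: `πE`, then `f''/f'` from the switch-off bump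
paired with itself, `-2 f'(τ)/(f τ - f τ₀)` from the two bumps paired with each other, and twice the
integral of `regularKernel` over `[τ₀, τ]` (`exists_hasDerivAt_logResponse`). Only a compact stretch
of the trajectory is seen, so `f` may be taken globally bi-Lipschitz
(`exists_isTameCoord_extension`).

Near the singularity `U, V > 0`, and the geodesic equation makes both velocities decrease. Then
every term of `coordRate` except `f''/f'` is bounded, uniformly in `τ₀` (`exists_coordRate_bound`).
For `U` and `V` the terms `f''/f'` add up to minus the logarithmic derivative of the conformal
factor, `-(1/r + 1/(2M)) √(ε² - 1 + 2M/r)` (`acceleration_sum`); replacing `V` by `v` costs only the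
bounded `V'/V`. Expansion in `2M/r` gives the first law, and `r^(3/2) ~ (3/2) √(2M) (τs - τ)` the
second.

For `ε ≥ 1` the radial velocity never vanishes, so `U V` always increases and `V > 0` (`V_pos`). The
terms that depend on `τ₀` are monotone and bounded as `τ₀ → -∞`, so the limit exists, and the
uniform bound passes to it. -/

namespace SchwarzschildDetector

open MeasureTheory

/-! ### Tame coordinates -/

/-- A global coordinate on the line that is bi-Lipschitz, with two derivatives, the second one
continuous and bounded. -/
structure IsTameCoord (f f' f'' : ℝ → ℝ) (m C L : ℝ) : Prop where
  pos : 0 < m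
  hasDeriv : ∀ x, HasDerivAt f (f' x) x
  hasDeriv' : ∀ x, HasDerivAt f' (f'' x) x
  le_deriv : ∀ x, m ≤ f' x
  deriv_le : ∀ x, f' x ≤ C
  abs_deriv2_le : ∀ x, |f'' x| ≤ L
  cont_deriv2 : Continuous f''

namespace IsTameCoord

variable {f f' f'' : ℝ → ℝ} {m C L : ℝ}

theorem continuous (h : IsTameCoord f f' f'' m C L) : Continuous f :=
  continuous_iff_continuousAt.2 fun x => (h.hasDeriv x).continuousAt

theorem continuous_deriv (h : IsTameCoord f f' f'' m C L) : Continuous f' :=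
  continuous_iff_continuousAt.2 fun x => (h.hasDeriv' x).continuousAt

theorem deriv_pos (h : IsTameCoord f f' f'' m C L) (x : ℝ) : 0 < f' x :=
  h.pos.trans_le (h.le_deriv x)

theorem bound_pos (h : IsTameCoord f f' f'' m C L) : 0 < C :=
  (h.deriv_pos 0).trans_le (h.deriv_le 0)

theorem bound2_nonneg (h : IsTameCoord f f' f'' m C L) : 0 ≤ L :=
  (abs_nonneg _).trans (h.abs_deriv2_le 0)

theorem strictMono (h : IsTameCoord f f' f'' m C L) : StrictMono f :=
  strictMono_of_hasDerivAt_pos h.hasDeriv h.deriv_pos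

theorem sub_ne_zero (h : IsTameCoord f f' f'' m C L) {a b : ℝ} (hab : a ≠ b) : f a - f b ≠ 0 :=
  _root_.sub_ne_zero.2 (h.strictMono.injective.ne hab)

theorem mul_abs_sub_le (h : IsTameCoord f f' f'' m C L) (a b : ℝ) :
    m * |a - b| ≤ |f a - f b| := by
  wlog hab : b ≤ a generalizing a b
  · rw [abs_sub_comm a, abs_sub_comm (f a)]
    exact this b a (le_of_not_ge hab)
  have := mul_sub_le_image_sub_of_le_deriv (f := f)
    (fun x => (h.hasDeriv x).differentiableAt) (C := m)
    (fun x => by rw [(h.hasDeriv x).deriv]; exact h.le_deriv x) hab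
  rw [abs_of_nonneg (sub_nonneg.2 hab)]
  exact this.trans (le_abs_self _)

theorem abs_sub_le (h : IsTameCoord f f' f'' m C L) (a b : ℝ) :
    |f a - f b| ≤ C * |a - b| := by
  have := Convex.norm_image_sub_le_of_norm_hasDerivWithin_le (f := f) (f' := f') (s := univ)
    (C := C) (fun x _ => (h.hasDeriv x).hasDerivWithinAt)
    (fun x _ => by
      rw [Real.norm_eq_abs, abs_of_pos (h.deriv_pos x)]; exact h.deriv_le x)
    convex_univ (mem_univ b) (mem_univ a)
  simpa [Real.norm_eq_abs] using this

theorem abs_deriv_sub_le (h : IsTameCoord f f' f'' m C L) (a b : ℝ) :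
    |f' a - f' b| ≤ L * |a - b| := by
  have := Convex.norm_image_sub_le_of_norm_hasDerivWithin_le (f := f') (f' := f'') (s := univ)
    (C := L) (fun x _ => (h.hasDeriv' x).hasDerivWithinAt)
    (fun x _ => by
      rw [Real.norm_eq_abs]; exact h.abs_deriv2_le x)
    convex_univ (mem_univ b) (mem_univ a)
  simpa [Real.norm_eq_abs] using this

theorem sign_sub (h : IsTameCoord f f' f'' m C L) (a b : ℝ) :
    Real.sign (f a - f b) = Real.sign (a - b) := by
  rcases lt_trichotomy a b with hab | hab | hab
  · rw [Real.sign_of_neg (sub_neg.2 hab), Real.sign_of_neg (sub_neg.2 (h.strictMono hab))]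
  · simp [hab]
  · rw [Real.sign_of_pos (sub_pos.2 hab), Real.sign_of_pos (sub_pos.2 (h.strictMono hab))]

/-- The bi-Lipschitz bounds put `|f a - f b| / |a - b|` between `m` and `C`, so the two logarithms
differ by a bounded amount. On the diagonal `Real.log 0 = 0` is harmless. -/
theorem abs_log_sub_le (h : IsTameCoord f f' f'' m C L) (a b : ℝ) :
    |Real.log (f a - f b)| ≤ |Real.log (a - b)| + (|Real.log m| + |Real.log C|) := by
  rcases eq_or_ne a b with rfl | hab
  · simp only [sub_self, Real.log_zero, abs_zero, zero_add]; positivity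
  have h0 : 0 < |a - b| := abs_pos.2 (_root_.sub_ne_zero.2 hab)
  have h1 : Real.log m + Real.log (a - b) ≤ Real.log (f a - f b) := by
    rw [← Real.log_abs (a - b), ← Real.log_abs (f a - f b), ← Real.log_mul h.pos.ne' h0.ne']
    exact Real.log_le_log (mul_pos h.pos h0) (h.mul_abs_sub_le a b)
  have h2 : Real.log (f a - f b) ≤ Real.log C + Real.log (a - b) := by
    rw [← Real.log_abs (a - b), ← Real.log_abs (f a - f b),
      ← Real.log_mul h.bound_pos.ne' h0.ne']
    exact Real.log_le_log (abs_pos.2 (h.sub_ne_zero hab)) (h.abs_sub_le a b)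
  rw [abs_le]
  constructor <;>
  linarith [neg_abs_le (Real.log m), le_abs_self (Real.log C), abs_nonneg (Real.log m),
    abs_nonneg (Real.log C), neg_abs_le (Real.log (a - b)), le_abs_self (Real.log (a - b))]

end IsTameCoord

/-! ### Integrability of logarithmic and bounded kernels -/

theorem exists_abs_le_of_hasCompactSupport {F : Type*} [NormedAddCommGroup F] {g : ℝ × ℝ → F}
    (hc : HasCompactSupport g) :
    ∃ N : ℝ, 0 ≤ N ∧ ∀ z, g z ≠ 0 → |z.1| ≤ N ∧ |z.2| ≤ N := by
  obtain ⟨N, hN⟩ := hc.isCompact.isBounded.subset_closedBall 0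
  refine ⟨|N|, abs_nonneg N, fun z hz => ?_⟩
  have := hN (subset_tsupport g hz)
  rw [mem_closedBall_zero_iff, Prod.norm_def, max_le_iff] at this
  exact ⟨this.1.trans (le_abs_self N), this.2.trans (le_abs_self N)⟩

/-- A kernel dominated by `|log (a - b)| + D` is integrable against a continuous function of compact
support. -/
theorem integrable_smul_of_le_log {F : Type*} [NormedAddCommGroup F] [NormedSpace ℝ F]
    {k : ℝ × ℝ → ℝ} (hk : Measurable k) {D : ℝ}
    (hD : ∀ z, |k z| ≤ |Real.log (z.1 - z.2)| + D) {g : ℝ × ℝ → F}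
    (hg : Continuous g) (hc : HasCompactSupport g) :
    Integrable (fun z => k z • g z) (volume.prod volume) := by
  obtain ⟨N, hN0, hN⟩ := exists_abs_le_of_hasCompactSupport hc
  obtain ⟨B, hB⟩ := hg.bounded_above_of_compact_support hc
  have hB0 : 0 ≤ B := (norm_nonneg _).trans (hB 0)
  have h1 : Integrable (indicator (Icc (-N) N) (fun _ : ℝ => B)) volume :=
    (integrable_indicator_iff measurableSet_Icc).2 (integrableOn_const (by simp))
  have h2 : Integrable (indicator (Icc (-(2 * N)) (2 * N)) (fun x => |Real.log x| + D))
      volume := by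
    rw [integrable_indicator_iff measurableSet_Icc]
    refine Integrable.add ?_ (integrableOn_const (by simp))
    exact ((intervalIntegrable_iff_integrableOn_Icc_of_le (by linarith)).1
      intervalIntegral.intervalIntegrable_log').abs
  -- The dominating function is a convolution integrand: a constant in `b` times `|log| + D` in `a -
  -- b`, each cut off to a compact interval and integrable on the line.
  have h3 := h1.convolution_integrand (ContinuousLinearMap.mul ℝ ℝ) h2
  refine h3.mono' (hk.aestronglyMeasurable.smul hg.aestronglyMeasurable) (ae_of_all _ ?_)
  rintro ⟨a, b⟩
  rw [norm_smul, ContinuousLinearMap.mul_apply', Real.norm_eq_abs]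
  by_cases hz : g (a, b) = 0
  · rw [hz, norm_zero, mul_zero]
    refine mul_nonneg (indicator_nonneg (fun _ _ => hB0) _) (indicator_nonneg (fun x _ => ?_) _)
    have := (abs_nonneg _).trans (hD (x, 0))
    simpa using this
  · obtain ⟨ha, hb⟩ := hN _ hz
    simp only at ha hb
    rw [indicator_of_mem (show b ∈ Icc (-N) N from abs_le.1 hb), indicator_of_mem, mul_comm]
    · exact mul_le_mul (hB _) (hD _) (abs_nonneg _) hB0
    · rw [abs_le] at ha hb
      constructor <;> simp only <;> linarith [ha.1, ha.2, hb.1, hb.2]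

theorem IsTameCoord.integrable_log_smul {F : Type*} [NormedAddCommGroup F] [NormedSpace ℝ F]
    {f f' f'' : ℝ → ℝ} {m C L : ℝ} (h : IsTameCoord f f' f'' m C L) {g : ℝ × ℝ → F}
    (hg : Continuous g) (hc : HasCompactSupport g) :
    Integrable (fun z : ℝ × ℝ => Real.log (f z.1 - f z.2) • g z) (volume.prod volume) := by
  refine integrable_smul_of_le_log ?_ (fun z => h.abs_log_sub_le z.1 z.2) hg hc
  have := h.continuous
  exact Real.measurable_log.comp (by fun_prop)

/-- A bounded measurable kernel is integrable against a continuous function of compact support. -/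
theorem integrable_smul_of_bounded {F : Type*} [NormedAddCommGroup F] [NormedSpace ℝ F]
    {k : ℝ × ℝ → ℝ} (hk : Measurable k) {D : ℝ} (hD : ∀ z, |k z| ≤ D) {g : ℝ × ℝ → F}
    (hg : Continuous g) (hc : HasCompactSupport g) :
    Integrable (fun z => k z • g z) (volume.prod volume) :=
  integrable_smul_of_le_log hk (fun z => (hD z).trans (le_add_of_nonneg_left (abs_nonneg _))) hg hc

/-- A compactly supported `C¹` function together with its derivative. -/
structure IsWindow (χ χ' : ℝ → ℝ) : Prop where
  hasDeriv : ∀ x, HasDerivAt χ (χ' x) x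
  cont_deriv : Continuous χ'
  compact : HasCompactSupport χ

namespace IsWindow

variable {χ χ' : ℝ → ℝ}

theorem continuous (h : IsWindow χ χ') : Continuous χ :=
  continuous_iff_continuousAt.2 fun x => (h.hasDeriv x).continuousAt

theorem apply_eq_zero (_ : IsWindow χ χ') {x : ℝ} (hx : x ∉ tsupport χ) : χ x = 0 :=
  image_eq_zero_of_notMem_tsupport hx

theorem deriv_eq_zero (h : IsWindow χ χ') {x : ℝ} (hx : x ∉ tsupport χ) : χ' x = 0 := by
  rw [← (h.hasDeriv x).deriv]
  by_contra h0
  exact hx (support_deriv_subset h0)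

theorem hasCompactSupport_prod {F : Type*} [Zero F] (h : IsWindow χ χ') {g : ℝ × ℝ → F}
    (hg : ∀ z : ℝ × ℝ, (χ z.1 = 0 ∧ χ' z.1 = 0) ∨ (χ z.2 = 0 ∧ χ' z.2 = 0) → g z = 0) :
    HasCompactSupport g := by
  refine HasCompactSupport.intro (h.compact.isCompact.prod h.compact.isCompact) fun z hz => hg z ?_
  by_contra! hcon
  refine hz ⟨?_, ?_⟩
  · by_contra h1
    exact hcon.1 (h.apply_eq_zero h1) (h.deriv_eq_zero h1)
  · by_contra h1
    exact hcon.2 (h.apply_eq_zero h1) (h.deriv_eq_zero h1)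

end IsWindow

/-- A continuous function of compact support, differentiable away from one point, with an integrable
derivative: the integral of the derivative vanishes. -/
theorem integral_eq_zero_of_hasDerivAt_off_point {P P' : ℝ → ℝ} {a : ℝ} (hP : ContinuousAt P a)
    (hd : ∀ x, x ≠ a → HasDerivAt P (P' x) x) (hi : Integrable P')
    (hs : HasCompactSupport P) : ∫ x, P' x = 0 := by
  have h0 : P =ᶠ[cocompact ℝ] 0 := by
    rw [← coclosedCompact_eq_cocompact]
    exact hasCompactSupport_iff_eventuallyEq.1 hs
  have hbot : Tendsto P atBot (𝓝 0) :=
    (tendsto_congr' (h0.filter_mono atBot_le_cocompact)).2 tendsto_const_nhds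
  have htop : Tendsto P atTop (𝓝 0) :=
    (tendsto_congr' (h0.filter_mono atTop_le_cocompact)).2 tendsto_const_nhds
  have h1 := integral_Iic_of_hasDerivAt_of_tendsto hP.continuousWithinAt
    (fun x hx => hd x (ne_of_lt hx)) hi.integrableOn hbot
  have h2 := integral_Ioi_of_hasDerivAt_of_tendsto hP.continuousWithinAt
    (fun x hx => hd x (ne_of_gt hx)) hi.integrableOn htop
  have h3 := integral_add_compl (s := Iic a) measurableSet_Iic hi
  rw [compl_Iic, h1, h2] at h3
  linarith

/-! ### Integration by parts in the logarithmic kernel -/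

/-- In `cos x - 1 = -2 sin² (x/2)` one sine is bounded by `1` and the other by `|x/2|`. This linear
bound cancels a simple pole; the quadratic bound `abs_cos_sub_one_le_sq` cancels a double one. -/
theorem abs_cos_sub_one_le_abs (x : ℝ) : |Real.cos x - 1| ≤ |x| := by
  have h := Real.abs_sin_le_abs (x := x / 2)
  have h1 : Real.cos x - 1 = -(2 * Real.sin (x / 2) ^ 2) := by
    rw [Real.sin_sq_eq_half_sub]; ring_nf
  have h2 : |Real.sin (x / 2)| ≤ 1 := Real.abs_sin_le_one _
  rw [h1, abs_neg, abs_mul, abs_two, abs_pow]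
  have h3 : |x / 2| = |x| / 2 := by rw [abs_div, abs_two]
  nlinarith [abs_nonneg (Real.sin (x / 2))]

theorem abs_cos_sub_one_le_sq (x : ℝ) : |Real.cos x - 1| ≤ x ^ 2 / 2 := by
  rw [abs_le]
  constructor <;> linarith [Real.one_sub_sq_div_two_le_cos (x := x), Real.cos_le_one x, sq_nonneg x]

/-- The regular part `f'(a) f'(b) (cos E(a-b) - 1) / (f a - f b)²` of the transition kernel. -/
noncomputable def regularKernel (E : ℝ) (f f' : ℝ → ℝ) (a b : ℝ) : ℝ :=
  f' a * f' b * (Real.cos (E * (a - b)) - 1) / (f a - f b) ^ 2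

theorem regularKernel_comm (E : ℝ) (f f' : ℝ → ℝ) (a b : ℝ) :
    regularKernel E f f' a b = regularKernel E f f' b a := by
  unfold regularKernel
  rw [show E * (a - b) = -(E * (b - a)) by ring, Real.cos_neg, mul_comm (f' a),
    show (f a - f b) ^ 2 = (f b - f a) ^ 2 by ring]

namespace IsTameCoord

variable {f f' f'' : ℝ → ℝ} {m C L : ℝ}

theorem abs_deriv (h : IsTameCoord f f' f'' m C L) (x : ℝ) : |f' x| ≤ C := by
  rw [abs_of_pos (h.deriv_pos x)]; exact h.deriv_le x

/-- A numerator that vanishes linearly on the diagonal pays for one factor `f a - f b`. On the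
diagonal itself the quotient is `0` by convention. -/
theorem abs_div_sub_le (h : IsTameCoord f f' f'' m C L) {a b y D : ℝ} (hD : 0 ≤ D)
    (hy : |y| ≤ D * |a - b|) : |y / (f a - f b)| ≤ D / m := by
  rcases eq_or_ne a b with rfl | hab
  · simp only [sub_self, div_zero, abs_zero]
    exact div_nonneg hD h.pos.le
  · rw [abs_div, div_le_div_iff₀ (abs_pos.2 (h.sub_ne_zero hab)) h.pos]
    nlinarith [h.mul_abs_sub_le a b, h.pos]

theorem abs_cosKernel_le (h : IsTameCoord f f' f'' m C L) (E a b : ℝ) :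
    |f' b * (Real.cos (E * (a - b)) - 1) / (f a - f b)| ≤ C * |E| / m := by
  refine h.abs_div_sub_le (mul_nonneg h.bound_pos.le (abs_nonneg E)) ?_
  rw [abs_mul, mul_assoc, ← abs_mul E]
  exact mul_le_mul (h.abs_deriv b) (abs_cos_sub_one_le_abs _) (abs_nonneg _) h.bound_pos.le

theorem abs_cosKernel_le_mul (h : IsTameCoord f f' f'' m C L) (E a b : ℝ) :
    |f' b * (Real.cos (E * (a - b)) - 1) / (f a - f b)| ≤ C * E ^ 2 / 2 / m * |a - b| := by
  have := h.abs_div_sub_le (a := a) (b := b) (y := f' b * (Real.cos (E * (a - b)) - 1))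
    (D := C * E ^ 2 / 2 * |a - b|)
    (mul_nonneg (div_nonneg (mul_nonneg h.bound_pos.le (sq_nonneg E)) two_pos.le) (abs_nonneg _))
    (by
      rw [abs_mul]
      calc _ ≤ C * ((E * (a - b)) ^ 2 / 2) := mul_le_mul (h.abs_deriv b)
            (abs_cos_sub_one_le_sq _) (abs_nonneg _) h.bound_pos.le
        _ = _ := by rw [mul_pow, ← sq_abs (a - b)]; ring)
  exact this.trans_eq (by ring)

theorem abs_sinKernel_le (h : IsTameCoord f f' f'' m C L) (E a b : ℝ) :
    |f' b * (E * Real.sin (E * (a - b))) / (f a - f b)| ≤ C * E ^ 2 / m := by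
  refine h.abs_div_sub_le (mul_nonneg h.bound_pos.le (sq_nonneg E)) ?_
  rw [abs_mul, abs_mul, mul_assoc]
  refine mul_le_mul (h.abs_deriv b) ?_ (by positivity) h.bound_pos.le
  calc |E| * |Real.sin (E * (a - b))| ≤ |E| * |E * (a - b)| :=
        mul_le_mul_of_nonneg_left Real.abs_sin_le_abs (abs_nonneg E)
    _ = _ := by rw [abs_mul, ← sq_abs E]; ring

/-- The quadratic zero of `cos - 1` pays for both factors of the double pole, one `abs_div_sub_le`
at a time. -/
theorem abs_regularKernel_le (h : IsTameCoord f f' f'' m C L) (E a b : ℝ) :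
    |regularKernel E f f' a b| ≤ C * (C * E ^ 2 / 2 / m) / m := by
  have h1 : regularKernel E f f' a b =
      f' a * (f' b * (Real.cos (E * (a - b)) - 1) / (f a - f b)) / (f a - f b) := by
    rw [regularKernel, ← mul_div_assoc, div_div, ← sq, mul_assoc]
  have h2 := h.bound_pos
  have h3 := h.pos
  rw [h1]
  refine h.abs_div_sub_le (by positivity) ?_
  rw [abs_mul, mul_assoc]
  exact mul_le_mul (h.abs_deriv a) (h.abs_cosKernel_le_mul E a b) (abs_nonneg _) h2.le

theorem measurable_regularKernel (h : IsTameCoord f f' f'' m C L) (E : ℝ) :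
    Measurable fun z : ℝ × ℝ => regularKernel E f f' z.1 z.2 := by
  have h1 := h.continuous.measurable
  have h2 := h.continuous_deriv.measurable
  unfold regularKernel
  fun_prop

variable {χ χ' : ℝ → ℝ}

/-- Second integration by parts, in `a`: the derivative is the once-integrated kernel minus the
regular one, so a vanishing integral equates the two. -/
theorem hasDerivAt_cosKernel_mul (h : IsTameCoord f f' f'' m C L) (hχ : IsWindow χ χ') (E b : ℝ)
    {a : ℝ} (hab : a ≠ b) :
    HasDerivAt (fun a => χ a * χ b * (f' b * (Real.cos (E * (a - b)) - 1) / (f a - f b)))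
      ((χ' a * χ b * (f' b * (Real.cos (E * (a - b)) - 1) / (f a - f b)) -
        χ a * χ b * (f' b * (E * Real.sin (E * (a - b))) / (f a - f b))) -
        regularKernel E f f' a b * (χ a * χ b)) a := by
  have h1 : HasDerivAt (fun a => Real.cos (E * (a - b))) (-Real.sin (E * (a - b)) * (E * 1)) a :=
    (((hasDerivAt_id a).sub_const b).const_mul E).cos
  have h2 := (((hχ.hasDeriv a).mul_const (χ b)).mul
    (((h1.sub_const 1).const_mul (f' b)).div ((h.hasDeriv a).sub_const (f b)) (h.sub_ne_zero hab)))
  refine h2.congr_deriv ?_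
  have h3 := h.sub_ne_zero hab
  simp only [Pi.div_apply, regularKernel]
  field_simp
  ring

/-- First integration by parts, in `b`. The factor next to the logarithm is the `a`-derivative of
`χ(a) χ(b) (cos E(a-b) - 1)`. -/
theorem hasDerivAt_log_mul (h : IsTameCoord f f' f'' m C L) (hχ : IsWindow χ χ') (E a : ℝ)
    {b : ℝ} (hab : b ≠ a) :
    HasDerivAt (fun b => Real.log (f a - f b) * (χ' a * χ b * (Real.cos (E * (a - b)) - 1) -
        χ a * χ b * (E * Real.sin (E * (a - b)))))
      (Real.log (f a - f b) * (χ' a * χ' b * (Real.cos (E * (a - b)) - 1) +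
          E ^ 2 * (χ a * χ b) * Real.cos (E * (a - b)) +
          E * (χ' a * χ b - χ a * χ' b) * Real.sin (E * (a - b))) -
        (χ' a * χ b * (f' b * (Real.cos (E * (a - b)) - 1) / (f a - f b)) -
        χ a * χ b * (f' b * (E * Real.sin (E * (a - b))) / (f a - f b)))) b := by
  have h0 : HasDerivAt (fun b => E * (a - b)) (E * -1) b :=
    ((hasDerivAt_id b).const_sub a).const_mul E
  have h1 := (((hχ.hasDeriv b).const_mul (χ' a)).mul (h0.cos.sub_const 1)).sub
    (((hχ.hasDeriv b).const_mul (χ a)).mul (h0.sin.const_mul E))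
  have h2 := (((h.hasDeriv b).const_sub (f a)).log (h.sub_ne_zero hab.symm)).mul h1
  refine h2.congr_deriv ?_
  have h3 := h.sub_ne_zero hab.symm
  simp only [Pi.mul_apply, Pi.sub_apply]
  field_simp
  ring

/-- The pole at the diagonal is removable because `cos - 1` has a double zero there, so the
integration by parts has no boundary term. -/
theorem continuousAt_cosKernel_mul (h : IsTameCoord f f' f'' m C L) (hχ : IsWindow χ χ')
    (E b : ℝ) :
    ContinuousAt (fun a => χ a * χ b * (f' b * (Real.cos (E * (a - b)) - 1) / (f a - f b))) b := by
  have h1 : Tendsto (fun a => f' b * (Real.cos (E * (a - b)) - 1) / (f a - f b)) (𝓝 b) (𝓝 0) := by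
    refine squeeze_zero_norm (fun a => h.abs_cosKernel_le_mul E a b) ?_
    have : Continuous fun a : ℝ => C * E ^ 2 / 2 / m * |a - b| := by fun_prop
    simpa using this.tendsto b
  have h2 := ((hχ.continuous.tendsto b).mul_const (χ b)).mul h1
  rw [ContinuousAt]
  simpa using h2

/-- The factor next to the logarithm is `O(|a - b|)`, hence `O(|f a - f b|)`, and `x log x → 0`. -/
theorem continuousAt_log_mul (h : IsTameCoord f f' f'' m C L) (hχ : IsWindow χ χ') (E a : ℝ) :
    ContinuousAt (fun b => Real.log (f a - f b) * (χ' a * χ b * (Real.cos (E * (a - b)) - 1) -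
        χ a * χ b * (E * Real.sin (E * (a - b))))) a := by
  obtain ⟨B, hB⟩ := hχ.continuous.bounded_above_of_compact_support hχ.compact
  have hm := h.pos
  have hB0 : 0 ≤ B := (norm_nonneg _).trans (hB 0)
  have key : ∀ b, |Real.log (f a - f b) * (χ' a * χ b * (Real.cos (E * (a - b)) - 1) -
        χ a * χ b * (E * Real.sin (E * (a - b))))| ≤
      (B * (|χ' a| * |E| + |χ a| * E ^ 2) / m) * |(f a - f b) * Real.log (f a - f b)| := by
    intro b
    have h1 : |χ' a * χ b * (Real.cos (E * (a - b)) - 1) -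
        χ a * χ b * (E * Real.sin (E * (a - b)))| ≤
        B * (|χ' a| * |E| + |χ a| * E ^ 2) * |a - b| := by
      refine (abs_sub _ _).trans ?_
      simp only [abs_mul]
      have e1 := abs_cos_sub_one_le_abs (E * (a - b))
      have e2 := Real.abs_sin_le_abs (x := E * (a - b))
      rw [abs_mul] at e1 e2
      have e3 : |χ b| ≤ B := hB b
      calc _ ≤ |χ' a| * B * (|E| * |a - b|) + |χ a| * B * (|E| * (|E| * |a - b|)) := by gcongr
        _ = _ := by rw [← sq_abs E]; ring
    have h2 : |a - b| ≤ |f a - f b| / m := by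
      rw [le_div_iff₀ hm, mul_comm]; exact h.mul_abs_sub_le a b
    rw [abs_mul, abs_mul]
    calc _ ≤ |Real.log (f a - f b)| *
          (B * (|χ' a| * |E| + |χ a| * E ^ 2) * (|f a - f b| / m)) := by
            refine mul_le_mul_of_nonneg_left (h1.trans ?_) (abs_nonneg _)
            exact mul_le_mul_of_nonneg_left h2 (by positivity)
      _ = _ := by ring
  have hlim : Tendsto (fun b => (B * (|χ' a| * |E| + |χ a| * E ^ 2) / m) *
      |(f a - f b) * Real.log (f a - f b)|) (𝓝 a) (𝓝 0) := by
    have hc : Continuous fun b => (B * (|χ' a| * |E| + |χ a| * E ^ 2) / m) *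
      |(f a - f b) * Real.log (f a - f b)| := by
      have hcf := h.continuous
      refine continuous_const.mul (continuous_abs.comp ?_)
      exact Real.continuous_mul_log.comp (by fun_prop)
    simpa using hc.tendsto a
  have := squeeze_zero_norm (fun b => (Real.norm_eq_abs _).trans_le (key b)) hlim
  rw [ContinuousAt]
  simpa using this


theorem integrable_regularKernel_mul (h : IsTameCoord f f' f'' m C L) (hχ : IsWindow χ χ')
    (E : ℝ) : Integrable (fun z : ℝ × ℝ => regularKernel E f f' z.1 z.2 * (χ z.1 * χ z.2))
      (volume.prod volume) := by
  have hc := hχ.continuous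
  refine integrable_smul_of_bounded (h.measurable_regularKernel E)
    (fun z => h.abs_regularKernel_le E z.1 z.2) (by fun_prop) (hχ.hasCompactSupport_prod ?_)
  rintro z (hz | hz) <;> simp [hz.1]

theorem integrable_firstKernel (h : IsTameCoord f f' f'' m C L) (hχ : IsWindow χ χ') (E : ℝ) :
    Integrable (fun z : ℝ × ℝ =>
      χ' z.1 * χ z.2 * (f' z.2 * (Real.cos (E * (z.1 - z.2)) - 1) / (f z.1 - f z.2)) -
        χ z.1 * χ z.2 * (f' z.2 * (E * Real.sin (E * (z.1 - z.2))) / (f z.1 - f z.2)))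
      (volume.prod volume) := by
  have hc := hχ.continuous
  have hc' := hχ.cont_deriv
  have h1 := h.continuous.measurable
  have h2 := h.continuous_deriv.measurable
  refine Integrable.sub ?_ ?_
  · have := integrable_smul_of_bounded (g := fun z : ℝ × ℝ => χ' z.1 * χ z.2)
      (by fun_prop : Measurable fun z : ℝ × ℝ =>
        f' z.2 * (Real.cos (E * (z.1 - z.2)) - 1) / (f z.1 - f z.2))
      (fun z => h.abs_cosKernel_le E z.1 z.2) (by fun_prop) (hχ.hasCompactSupport_prod (by
        rintro z (hz | hz) <;> simp [hz.1, hz.2]))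
    exact this.congr (ae_of_all _ fun z => mul_comm _ _)
  · have := integrable_smul_of_bounded (g := fun z : ℝ × ℝ => χ z.1 * χ z.2)
      (by fun_prop : Measurable fun z : ℝ × ℝ =>
        f' z.2 * (E * Real.sin (E * (z.1 - z.2))) / (f z.1 - f z.2))
      (fun z => h.abs_sinKernel_le E z.1 z.2) (by fun_prop) (hχ.hasCompactSupport_prod (by
        rintro z (hz | hz) <;> simp [hz.1]))
    exact this.congr (ae_of_all _ fun z => mul_comm _ _)

theorem integrable_log_mul_second (h : IsTameCoord f f' f'' m C L) (hχ : IsWindow χ χ') (E : ℝ) :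
    Integrable (fun z : ℝ × ℝ => Real.log (f z.1 - f z.2) *
      (χ' z.1 * χ' z.2 * (Real.cos (E * (z.1 - z.2)) - 1) +
          E ^ 2 * (χ z.1 * χ z.2) * Real.cos (E * (z.1 - z.2)) +
          E * (χ' z.1 * χ z.2 - χ z.1 * χ' z.2) * Real.sin (E * (z.1 - z.2))))
      (volume.prod volume) := by
  have hc := hχ.continuous
  have hc' := hχ.cont_deriv
  refine h.integrable_log_smul (by fun_prop) (hχ.hasCompactSupport_prod ?_)
  rintro z (hz | hz) <;> simp [hz.1, hz.2]

theorem integrable_log_mul_deriv (h : IsTameCoord f f' f'' m C L) (hχ : IsWindow χ χ') :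
    Integrable (fun z : ℝ × ℝ => Real.log (f z.1 - f z.2) * (χ' z.1 * χ' z.2))
      (volume.prod volume) := by
  have hc' := hχ.cont_deriv
  refine h.integrable_log_smul (by fun_prop) (hχ.hasCompactSupport_prod ?_)
  rintro z (hz | hz) <;> simp [hz.2]

/-- Two integrations by parts in the logarithmic kernel, against a function that vanishes to second
order on the diagonal. -/
theorem integral_log_mul_second (h : IsTameCoord f f' f'' m C L) (hχ : IsWindow χ χ') (E : ℝ) :
    ∫ z : ℝ × ℝ, Real.log (f z.1 - f z.2) *
      (χ' z.1 * χ' z.2 * (Real.cos (E * (z.1 - z.2)) - 1) +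
          E ^ 2 * (χ z.1 * χ z.2) * Real.cos (E * (z.1 - z.2)) +
          E * (χ' z.1 * χ z.2 - χ z.1 * χ' z.2) * Real.sin (E * (z.1 - z.2)))
      ∂(volume.prod volume) =
    ∫ z : ℝ × ℝ, regularKernel E f f' z.1 z.2 * (χ z.1 * χ z.2) ∂(volume.prod volume) := by
  have i1 := h.integrable_log_mul_second hχ E
  have i2 := h.integrable_firstKernel hχ E
  have i3 := h.integrable_regularKernel_mul hχ E
  have e1 := integral_sub' i1 i2
  have e2 := integral_sub' i2 i3
  have d1 := i1.sub i2
  have d2 := i2.sub i3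
  -- By Fubini with `b` inside, the difference of the first two integrands is a total derivative on
  -- almost every slice. The same is done below with `a` inside for the other pair.
  rw [integral_prod _ d1, integral_eq_zero_of_ae] at e1
  swap
  · filter_upwards [d1.prod_right_ae] with a ha
    refine integral_eq_zero_of_hasDerivAt_off_point (h.continuousAt_log_mul hχ E a)
      (fun b hb => h.hasDerivAt_log_mul hχ E a hb) ha ?_
    refine HasCompactSupport.intro hχ.compact.isCompact fun b hb => ?_
    simp [hχ.apply_eq_zero hb]
  rw [integral_prod_symm _ d2, integral_eq_zero_of_ae] at e2
  swap
  · filter_upwards [d2.prod_left_ae] with b hb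
    refine integral_eq_zero_of_hasDerivAt_off_point (h.continuousAt_cosKernel_mul hχ E b)
      (fun a ha => h.hasDerivAt_cosKernel_mul hχ E b ha) hb ?_
    refine HasCompactSupport.intro hχ.compact.isCompact fun a ha => ?_
    simp [hχ.apply_eq_zero ha]
  linarith

end IsTameCoord

/-! ### Test functions with a phase -/

/-- The derivative of `χ(b) exp (i E b)`. -/
noncomputable def phaseDeriv (E : ℝ) (χ χ' : ℝ → ℝ) (b : ℝ) : ℂ :=
  ((χ' b : ℂ) + Complex.I * E * χ b) * Complex.exp (Complex.I * E * b)

/-- Under exchange of `a` and `b` the real part is symmetric and the imaginary part antisymmetric,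
so the even kernel `log |f a - f b|` sees only the real part. -/
theorem phaseDeriv_mul (E : ℝ) (χ χ' : ℝ → ℝ) (a b : ℝ) :
    phaseDeriv (-E) χ χ' a * phaseDeriv E χ χ' b =
      ((χ' a * χ' b * Real.cos (E * (a - b)) + E ^ 2 * (χ a * χ b) * Real.cos (E * (a - b)) +
          E * (χ' a * χ b - χ a * χ' b) * Real.sin (E * (a - b)) : ℝ) : ℂ) +
      ((E * (χ' a * χ b - χ a * χ' b) * Real.cos (E * (a - b)) -
        (χ' a * χ' b + E ^ 2 * (χ a * χ b)) * Real.sin (E * (a - b)) : ℝ) : ℂ) * Complex.I := by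
  have h : Complex.exp (Complex.I * (-E : ℝ) * a) * Complex.exp (Complex.I * E * b) =
      (Real.cos (E * (a - b)) : ℂ) - Real.sin (E * (a - b)) * Complex.I := by
    rw [← Complex.exp_add, show Complex.I * ((-E : ℝ) : ℂ) * (a : ℂ) + Complex.I * E * b =
      ((-(E * (a - b)) : ℝ) : ℂ) * Complex.I by push_cast; ring, Complex.exp_mul_I,
      ← Complex.ofReal_cos, ← Complex.ofReal_sin, Real.cos_neg, Real.sin_neg]
    push_cast; ring
  have h2 := Complex.I_sq
  calc _ = (((χ' a : ℂ) + Complex.I * (-E : ℝ) * χ a) * ((χ' b : ℂ) + Complex.I * E * χ b)) *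
        (Complex.exp (Complex.I * (-E : ℝ) * a) * Complex.exp (Complex.I * E * b)) := by
          unfold phaseDeriv; ring
    _ = _ := by
      rw [h]
      push_cast
      generalize Complex.cos (E * (a - b)) = cc
      generalize Complex.sin (E * (a - b)) = ss
      linear_combination (-(E:ℂ)^2 * χ a * χ b * cc - E * χ' a * χ b * ss + E * χ a * χ' b * ss
        + E ^ 2 * χ a * χ b * ss * Complex.I) * h2

namespace IsWindow

variable {χ χ' : ℝ → ℝ}

theorem hasDerivAt_phase (hχ : IsWindow χ χ') (E b : ℝ) :
    HasDerivAt (fun b : ℝ => (χ b : ℂ) * Complex.exp (Complex.I * E * b)) (phaseDeriv E χ χ' b)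
      b := by
  have h1 : HasDerivAt (fun b : ℝ => Complex.exp (Complex.I * E * b))
      (Complex.exp (Complex.I * E * b) * (Complex.I * E * 1)) b :=
    (((hasDerivAt_id b).ofReal_comp).const_mul (Complex.I * E)).cexp
  refine ((hχ.hasDeriv b).ofReal_comp.mul h1).congr_deriv ?_
  unfold phaseDeriv; ring

theorem continuous_phaseDeriv (hχ : IsWindow χ χ') (E : ℝ) : Continuous (phaseDeriv E χ χ') := by
  have := hχ.continuous
  have := hχ.cont_deriv
  unfold phaseDeriv
  fun_prop

theorem phaseDeriv_eq_zero (E : ℝ) {b : ℝ} (h : χ b = 0 ∧ χ' b = 0) :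
    phaseDeriv E χ χ' b = 0 := by
  simp [phaseDeriv, h.1, h.2]

theorem contDiff_phase (hχ : IsWindow χ χ') (E : ℝ) :
    ContDiff ℝ 1 (fun b : ℝ => (χ b : ℂ) * Complex.exp (Complex.I * E * b)) := by
  rw [contDiff_one_iff_deriv]
  refine ⟨fun b => (hχ.hasDerivAt_phase E b).differentiableAt, ?_⟩
  rw [show deriv _ = phaseDeriv E χ χ' from funext fun b => (hχ.hasDerivAt_phase E b).deriv]
  exact hχ.continuous_phaseDeriv E

theorem hasCompactSupport_phase (hχ : IsWindow χ χ') (E : ℝ) :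
    HasCompactSupport (fun b : ℝ => (χ b : ℂ) * Complex.exp (Complex.I * E * b)) :=
  HasCompactSupport.intro hχ.compact.isCompact fun b hb => by simp [hχ.apply_eq_zero hb]

theorem hasCompactSupport_phaseDeriv (hχ : IsWindow χ χ') (E : ℝ) :
    HasCompactSupport (phaseDeriv E χ χ') :=
  HasCompactSupport.intro hχ.compact.isCompact fun _ hb =>
    phaseDeriv_eq_zero E ⟨hχ.apply_eq_zero hb, hχ.deriv_eq_zero hb⟩

theorem integrable_phaseDeriv (hχ : IsWindow χ χ') (E : ℝ) : Integrable (phaseDeriv E χ χ') :=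
  (hχ.continuous_phaseDeriv E).integrable_of_hasCompactSupport (hχ.hasCompactSupport_phaseDeriv E)

theorem integral_Iic_phaseDeriv (hχ : IsWindow χ χ') (E a : ℝ) :
    ∫ b in Iic a, phaseDeriv E χ χ' b = χ a * Complex.exp (Complex.I * E * a) := by
  have := (hχ.hasCompactSupport_phase E).integral_Iic_deriv_eq (hχ.contDiff_phase E) a
  rwa [show deriv _ = phaseDeriv E χ χ' from
    funext fun b => (hχ.hasDerivAt_phase E b).deriv] at this

theorem integral_Ioi_phaseDeriv (hχ : IsWindow χ χ') (E a : ℝ) :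
    ∫ b in Ioi a, phaseDeriv E χ χ' b = -(χ a * Complex.exp (Complex.I * E * a)) := by
  have := (hχ.hasCompactSupport_phase E).integral_Ioi_deriv_eq (hχ.contDiff_phase E) a
  rwa [show deriv _ = phaseDeriv E χ χ' from
    funext fun b => (hχ.hasDerivAt_phase E b).deriv] at this

theorem integral_phaseDeriv (hχ : IsWindow χ χ') (E : ℝ) : ∫ b, phaseDeriv E χ χ' b = 0 := by
  have h := integral_add_compl (s := Iic 0) measurableSet_Iic (hχ.integrable_phaseDeriv E)
  rw [compl_Iic, hχ.integral_Iic_phaseDeriv, hχ.integral_Ioi_phaseDeriv] at h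
  rw [← h, add_neg_cancel]

/-- Fundamental theorem of calculus on each side of the jump: both half-lines contribute the value
at `a`. -/
theorem integral_sign_mul_phaseDeriv (hχ : IsWindow χ χ') (E a : ℝ) :
    ∫ b, (Real.sign (a - b) : ℂ) * phaseDeriv E χ χ' b =
      2 * (χ a * Complex.exp (Complex.I * E * a)) := by
  have hi := hχ.integrable_phaseDeriv E
  have h : (fun b => (Real.sign (a - b) : ℂ) * phaseDeriv E χ χ' b) =ᵐ[volume]
      fun b => (Iic a).indicator (phaseDeriv E χ χ') b - (Ioi a).indicator (phaseDeriv E χ χ') b := by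
    filter_upwards [compl_mem_ae_iff.2 (measure_singleton a)] with b hb
    rcases lt_or_gt_of_ne (show b ≠ a from hb) with hlt | hgt
    · rw [Real.sign_of_pos (sub_pos.2 hlt), indicator_of_mem (show b ∈ Iic a from hlt.le),
        indicator_of_notMem (by simpa using hlt.le)]
      simp
    · rw [Real.sign_of_neg (sub_neg.2 hgt), indicator_of_notMem (by simpa using hgt),
        indicator_of_mem (show b ∈ Ioi a from hgt)]
      simp
  rw [integral_congr_ae h, integral_sub (hi.indicator measurableSet_Iic)
    (hi.indicator measurableSet_Ioi), integral_indicator measurableSet_Iic,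
    integral_indicator measurableSet_Ioi, hχ.integral_Iic_phaseDeriv, hχ.integral_Ioi_phaseDeriv]
  ring

theorem integral_mul_deriv (hχ : IsWindow χ χ') : ∫ x, χ x * χ' x = 0 := by
  have hc := hχ.continuous
  have hc' := hχ.cont_deriv
  have h := integral_eq_zero_of_hasDerivAt_of_integrable (f := fun x => χ x * χ x)
    (fun x => (hχ.hasDeriv x).mul (hχ.hasDeriv x))
    (Continuous.integrable_of_hasCompactSupport (by fun_prop)
      (HasCompactSupport.intro hχ.compact.isCompact fun x hx => by simp [hχ.apply_eq_zero hx]))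
    (Continuous.integrable_of_hasCompactSupport (by fun_prop)
      (HasCompactSupport.intro hχ.compact.isCompact fun x hx => by simp [hχ.apply_eq_zero hx]))
  have h2 : ∀ x, χ' x * χ x + χ x * χ' x = 2 * (χ x * χ' x) := fun x => by ring
  simp only [h2] at h
  rw [integral_const_mul] at h
  linarith

/-- The phases cancel, `χ χ'` is a total derivative, and only `-iE χ²` survives. -/
theorem integral_phaseDeriv_mul_phase (hχ : IsWindow χ χ') (E : ℝ) :
    ∫ a, phaseDeriv (-E) χ χ' a * (2 * (χ a * Complex.exp (Complex.I * E * a))) =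
      -(2 * Complex.I * E) * ((∫ a, χ a ^ 2 : ℝ) : ℂ) := by
  have hc := hχ.continuous
  have hc' := hχ.cont_deriv
  have h : ∀ a, phaseDeriv (-E) χ χ' a * (2 * (χ a * Complex.exp (Complex.I * E * a))) =
      2 * ((χ a * χ' a : ℝ) : ℂ) + -(2 * Complex.I * E) * ((χ a ^ 2 : ℝ) : ℂ) := by
    intro a
    have : Complex.exp (Complex.I * (-E : ℝ) * a) * Complex.exp (Complex.I * E * a) = 1 := by
      rw [← Complex.exp_add]; push_cast
      rw [show Complex.I * -(E : ℂ) * a + Complex.I * E * a = 0 by ring, Complex.exp_zero]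
    unfold phaseDeriv
    push_cast at this ⊢
    linear_combination (((χ' a : ℂ) + Complex.I * (-E) * χ a) * 2 * χ a) * this
  have i1 : Integrable (fun a => χ a * χ' a) :=
    Continuous.integrable_of_hasCompactSupport (by fun_prop)
      (HasCompactSupport.intro hχ.compact.isCompact fun x hx => by simp [hχ.apply_eq_zero hx])
  have i2 : Integrable (fun a => χ a ^ 2) :=
    Continuous.integrable_of_hasCompactSupport (by fun_prop)
      (HasCompactSupport.intro hχ.compact.isCompact fun x hx => by simp [hχ.apply_eq_zero hx])
  simp only [h]
  rw [integral_add (i1.ofReal.const_mul _) (i2.ofReal.const_mul _), integral_const_mul,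
    integral_const_mul, integral_complex_ofReal, integral_complex_ofReal, hχ.integral_mul_deriv]
  simp

/-- The factor `exp (-iE(a - b))` splits, so the mixed derivative is a product of one-variable
derivatives with opposite energies. -/
theorem deriv_deriv_test (hχ : IsWindow χ χ') (E a b : ℝ) :
    deriv (fun a : ℝ => deriv (fun b : ℝ =>
      (χ a : ℂ) * (χ b : ℂ) * Complex.exp (-Complex.I * (E : ℂ) * ((a : ℂ) - (b : ℂ)))) b) a =
      phaseDeriv (-E) χ χ' a * phaseDeriv E χ χ' b := by
  have h : ∀ a b : ℝ,
      (χ a : ℂ) * (χ b : ℂ) * Complex.exp (-Complex.I * (E : ℂ) * ((a : ℂ) - (b : ℂ))) =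
      ((χ a : ℂ) * Complex.exp (Complex.I * (-E : ℝ) * a)) *
        ((χ b : ℂ) * Complex.exp (Complex.I * E * b)) := by
    intro a b
    rw [show -Complex.I * (E : ℂ) * ((a : ℂ) - (b : ℂ)) =
      Complex.I * (-E : ℝ) * a + Complex.I * E * b by push_cast; ring, Complex.exp_add]
    ring
  simp only [h]
  have h2 : ∀ a : ℝ, deriv (fun b : ℝ => ((χ a : ℂ) * Complex.exp (Complex.I * (-E : ℝ) * a)) *
        ((χ b : ℂ) * Complex.exp (Complex.I * E * b))) b =
      ((χ a : ℂ) * Complex.exp (Complex.I * (-E : ℝ) * a)) * phaseDeriv E χ χ' b := fun a =>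
    ((hχ.hasDerivAt_phase E b).const_mul _).deriv
  simp only [h2]
  exact ((hχ.hasDerivAt_phase (-E) a).mul_const _).deriv

end IsWindow

/-! ### The response for a logarithmic kernel -/

/-- On the principal branch the argument of `i x` is `±π/2`. At `x = 0` both sides vanish by the
conventions for `log 0` and `sign 0`. -/
theorem clog_I_mul_ofReal (x : ℝ) :
    Complex.log (Complex.I * (x : ℂ)) =
      (Real.log x : ℂ) + Complex.I * (Real.pi / 2) * (Real.sign x : ℂ) := by
  rcases lt_trichotomy x 0 with hx | rfl | hx
  · have : Complex.I * (x : ℂ) = ((-x : ℝ) : ℂ) * (-Complex.I) := by push_cast; ring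
    rw [this, Complex.log_ofReal_mul (neg_pos.2 hx) (by simp), Complex.log_neg_I, Real.log_neg_eq_log,
      Real.sign_of_neg hx]
    push_cast; ring
  · simp
  · rw [mul_comm, Complex.log_ofReal_mul hx Complex.I_ne_zero, Complex.log_I, Real.sign_of_pos hx]
    push_cast; ring

theorem measurable_realSign : Measurable Real.sign := by
  have : Real.sign = fun r : ℝ => if r < 0 then -1 else if 0 < r then 1 else 0 := rfl
  rw [this]
  exact Measurable.ite measurableSet_Iio measurable_const
    (Measurable.ite measurableSet_Ioi measurable_const measurable_const)

theorem abs_realSign_le (x : ℝ) : |Real.sign x| ≤ 1 := by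
  rcases Real.sign_apply_eq x with h | h | h <;> rw [h] <;> simp

/-- The value of the response for a logarithmic kernel, see `IsTameCoord.integral_clog_mul`. -/
noncomputable def logResponse (E : ℝ) (f f' χ χ' : ℝ → ℝ) : ℝ :=
  Real.pi * E * (∫ x, χ x ^ 2) +
    (∫ z : ℝ × ℝ, Real.log (f z.1 - f z.2) * (χ' z.1 * χ' z.2) ∂(volume.prod volume)) +
    ∫ z : ℝ × ℝ, regularKernel E f f' z.1 z.2 * (χ z.1 * χ z.2) ∂(volume.prod volume)

namespace IsWindow

variable {χ χ' : ℝ → ℝ}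

theorem continuous_phaseDeriv_mul (hχ : IsWindow χ χ') (E : ℝ) :
    Continuous fun z : ℝ × ℝ => phaseDeriv (-E) χ χ' z.1 * phaseDeriv E χ χ' z.2 :=
  ((hχ.continuous_phaseDeriv (-E)).comp continuous_fst).mul
    ((hχ.continuous_phaseDeriv E).comp continuous_snd)

theorem hasCompactSupport_phaseDeriv_mul (hχ : IsWindow χ χ') (E : ℝ) :
    HasCompactSupport fun z : ℝ × ℝ => phaseDeriv (-E) χ χ' z.1 * phaseDeriv E χ χ' z.2 := by
  refine hχ.hasCompactSupport_prod ?_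
  rintro z (hz | hz)
  · rw [phaseDeriv_eq_zero _ hz, zero_mul]
  · rw [phaseDeriv_eq_zero _ hz, mul_zero]

theorem integrable_phaseDeriv_mul (hχ : IsWindow χ χ') (E : ℝ) :
    Integrable (fun z : ℝ × ℝ => phaseDeriv (-E) χ χ' z.1 * phaseDeriv E χ χ' z.2)
      (volume.prod volume) :=
  (hχ.integrable_phaseDeriv (-E)).mul_prod (hχ.integrable_phaseDeriv E)

theorem integral_phaseDeriv_mul (hχ : IsWindow χ χ') (E : ℝ) :
    ∫ z : ℝ × ℝ, phaseDeriv (-E) χ χ' z.1 * phaseDeriv E χ χ' z.2 ∂(volume.prod volume) = 0 := by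
  rw [integral_prod_mul, hχ.integral_phaseDeriv, zero_mul]

theorem integrable_sign_mul (hχ : IsWindow χ χ') (E : ℝ) :
    Integrable (fun z : ℝ × ℝ => (Real.sign (z.1 - z.2) : ℂ) *
      (phaseDeriv (-E) χ χ' z.1 * phaseDeriv E χ χ' z.2)) (volume.prod volume) := by
  have hm : Measurable fun z : ℝ × ℝ => Real.sign (z.1 - z.2) :=
    measurable_realSign.comp (by fun_prop)
  exact (integrable_smul_of_bounded hm (fun z => abs_realSign_le _)
    (hχ.continuous_phaseDeriv_mul E) (hχ.hasCompactSupport_phaseDeriv_mul E)).congr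
      (ae_of_all _ fun z => Complex.real_smul)

theorem integral_sign_mul (hχ : IsWindow χ χ') (E : ℝ) :
    ∫ z : ℝ × ℝ, (Real.sign (z.1 - z.2) : ℂ) *
      (phaseDeriv (-E) χ χ' z.1 * phaseDeriv E χ χ' z.2) ∂(volume.prod volume) =
      -(2 * Complex.I * E) * ((∫ a, χ a ^ 2 : ℝ) : ℂ) := by
  rw [integral_prod _ (hχ.integrable_sign_mul E), ← hχ.integral_phaseDeriv_mul_phase E]
  congr 1 with a
  rw [← hχ.integral_sign_mul_phaseDeriv E a, ← integral_const_mul]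
  congr 1 with b
  ring

end IsWindow

namespace IsTameCoord

variable {f f' f'' χ χ' : ℝ → ℝ} {m C L : ℝ}

theorem integrable_clog_mul (h : IsTameCoord f f' f'' m C L) (hχ : IsWindow χ χ') (E : ℝ) :
    Integrable (fun z : ℝ × ℝ => Complex.log (Complex.I * ((f z.1 - f z.2 : ℝ) : ℂ)) *
      (phaseDeriv (-E) χ χ' z.1 * phaseDeriv E χ χ' z.2)) (volume.prod volume) := by
  have h1 := h.integrable_log_smul (hχ.continuous_phaseDeriv_mul E)
    (hχ.hasCompactSupport_phaseDeriv_mul E)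
  have h2 := (hχ.integrable_sign_mul E).const_mul (Complex.I * (Real.pi / 2))
  refine (h1.add h2).congr (ae_of_all _ fun z => ?_)
  simp only [Pi.add_apply]
  rw [clog_I_mul_ofReal, h.sign_sub, Complex.real_smul]
  ring

/-- The antisymmetric imaginary part drops out (`e3`). The real part is `χ'(a) χ'(b)` plus the mixed
derivative of `χ(a) χ(b) (cos E(a-b) - 1)`, to which `integral_log_mul_second` applies. -/
theorem integral_log_smul (h : IsTameCoord f f' f'' m C L) (hχ : IsWindow χ χ') (E : ℝ) :
    ∫ z : ℝ × ℝ, Real.log (f z.1 - f z.2) •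
      (phaseDeriv (-E) χ χ' z.1 * phaseDeriv E χ χ' z.2) ∂(volume.prod volume) =
    (((∫ z : ℝ × ℝ, Real.log (f z.1 - f z.2) * (χ' z.1 * χ' z.2) ∂(volume.prod volume)) +
      ∫ z : ℝ × ℝ, regularKernel E f f' z.1 z.2 * (χ z.1 * χ z.2) ∂(volume.prod volume) : ℝ) :
      ℂ) := by
  have hc := hχ.continuous
  have hc' := hχ.cont_deriv
  have i1 := h.integrable_log_mul_deriv hχ
  have i2 := h.integrable_log_mul_second hχ E
  have i3 : Integrable (fun z : ℝ × ℝ => Real.log (f z.1 - f z.2) *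
      (E * (χ' z.1 * χ z.2 - χ z.1 * χ' z.2) * Real.cos (E * (z.1 - z.2)) -
        (χ' z.1 * χ' z.2 + E ^ 2 * (χ z.1 * χ z.2)) * Real.sin (E * (z.1 - z.2))))
      (volume.prod volume) := by
    refine h.integrable_log_smul (by fun_prop) (hχ.hasCompactSupport_prod ?_)
    rintro z (hz | hz) <;> simp [hz.1, hz.2]
  have e3 : ∫ z : ℝ × ℝ, Real.log (f z.1 - f z.2) *
      (E * (χ' z.1 * χ z.2 - χ z.1 * χ' z.2) * Real.cos (E * (z.1 - z.2)) -
        (χ' z.1 * χ' z.2 + E ^ 2 * (χ z.1 * χ z.2)) * Real.sin (E * (z.1 - z.2)))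
      ∂(volume.prod volume) = 0 := by
    have hs := integral_prod_swap (μ := (volume : Measure ℝ)) (ν := (volume : Measure ℝ))
      (fun z : ℝ × ℝ => Real.log (f z.1 - f z.2) *
      (E * (χ' z.1 * χ z.2 - χ z.1 * χ' z.2) * Real.cos (E * (z.1 - z.2)) -
        (χ' z.1 * χ' z.2 + E ^ 2 * (χ z.1 * χ z.2)) * Real.sin (E * (z.1 - z.2))))
    have hn : ∀ z : ℝ × ℝ, Real.log (f z.swap.1 - f z.swap.2) *
      (E * (χ' z.swap.1 * χ z.swap.2 - χ z.swap.1 * χ' z.swap.2) *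
        Real.cos (E * (z.swap.1 - z.swap.2)) -
        (χ' z.swap.1 * χ' z.swap.2 + E ^ 2 * (χ z.swap.1 * χ z.swap.2)) *
        Real.sin (E * (z.swap.1 - z.swap.2))) =
      -(Real.log (f z.1 - f z.2) *
      (E * (χ' z.1 * χ z.2 - χ z.1 * χ' z.2) * Real.cos (E * (z.1 - z.2)) -
        (χ' z.1 * χ' z.2 + E ^ 2 * (χ z.1 * χ z.2)) * Real.sin (E * (z.1 - z.2)))) := by
      intro z
      rw [Prod.fst_swap, Prod.snd_swap, ← Real.log_neg_eq_log, neg_sub,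
        show E * (z.2 - z.1) = -(E * (z.1 - z.2)) by ring, Real.cos_neg, Real.sin_neg]
      ring
    simp only [hn] at hs
    rw [integral_neg] at hs
    linarith
  rw [← h.integral_log_mul_second hχ E, ← integral_add i1 i2]
  have hz : ∀ z : ℝ × ℝ, Real.log (f z.1 - f z.2) •
      (phaseDeriv (-E) χ χ' z.1 * phaseDeriv E χ χ' z.2) =
      ((Real.log (f z.1 - f z.2) * (χ' z.1 * χ' z.2) + Real.log (f z.1 - f z.2) *
        (χ' z.1 * χ' z.2 * (Real.cos (E * (z.1 - z.2)) - 1) +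
          E ^ 2 * (χ z.1 * χ z.2) * Real.cos (E * (z.1 - z.2)) +
          E * (χ' z.1 * χ z.2 - χ z.1 * χ' z.2) * Real.sin (E * (z.1 - z.2))) : ℝ) : ℂ) +
      ((Real.log (f z.1 - f z.2) *
      (E * (χ' z.1 * χ z.2 - χ z.1 * χ' z.2) * Real.cos (E * (z.1 - z.2)) -
        (χ' z.1 * χ' z.2 + E ^ 2 * (χ z.1 * χ z.2)) * Real.sin (E * (z.1 - z.2))) : ℝ) : ℂ) *
        Complex.I := by
    intro z
    rw [phaseDeriv_mul, Complex.real_smul]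
    push_cast
    ring
  simp only [hz]
  rw [integral_add (i1.add i2).ofReal (i3.ofReal.mul_const _), integral_mul_const,
    integral_complex_ofReal, integral_complex_ofReal, e3]
  simp

/-- Since `f` is increasing, the jump does not depend on the coordinate; it contributes `(iπ/2)(-2iE
∫ χ²) = πE ∫ χ²`. -/
theorem integral_clog_mul (h : IsTameCoord f f' f'' m C L) (hχ : IsWindow χ χ') (E : ℝ) :
    ∫ z : ℝ × ℝ, Complex.log (Complex.I * ((f z.1 - f z.2 : ℝ) : ℂ)) *
      (phaseDeriv (-E) χ χ' z.1 * phaseDeriv E χ χ' z.2) ∂(volume.prod volume) =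
      (logResponse E f f' χ χ' : ℂ) := by
  have h1 := h.integrable_log_smul (hχ.continuous_phaseDeriv_mul E)
    (hχ.hasCompactSupport_phaseDeriv_mul E)
  have h2 := (hχ.integrable_sign_mul E).const_mul (Complex.I * (Real.pi / 2))
  have hz : ∀ z : ℝ × ℝ, Complex.log (Complex.I * ((f z.1 - f z.2 : ℝ) : ℂ)) *
      (phaseDeriv (-E) χ χ' z.1 * phaseDeriv E χ χ' z.2) =
      Real.log (f z.1 - f z.2) • (phaseDeriv (-E) χ χ' z.1 * phaseDeriv E χ χ' z.2) +
      Complex.I * (Real.pi / 2) * ((Real.sign (z.1 - z.2) : ℂ) *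
      (phaseDeriv (-E) χ χ' z.1 * phaseDeriv E χ χ' z.2)) := by
    intro z
    rw [clog_I_mul_ofReal, h.sign_sub, Complex.real_smul]
    ring
  simp only [hz]
  rw [integral_add h1 h2, integral_const_mul, hχ.integral_sign_mul, h.integral_log_smul hχ,
    logResponse]
  push_cast
  linear_combination (-(Real.pi : ℂ) * E * ((∫ a, χ a ^ 2 : ℝ) : ℂ)) * Complex.I_sq

/-- The response of the detector for the sum of two logarithmic kernels and a constant. -/
theorem response_eq {g g' g'' : ℝ → ℝ} {m' C' L' : ℝ} (h : IsTameCoord f f' f'' m C L)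
    (hg : IsTameCoord g g' g'' m' C' L') (hχ : IsWindow χ χ') (E c : ℝ) :
    response (fun a b => -(1 / (4 * (Real.pi : ℂ))) *
      (Complex.log (Complex.I * ((f a - f b : ℝ) : ℂ)) +
        Complex.log (Complex.I * ((g a - g b : ℝ) : ℂ))) + (c : ℂ)) E χ =
      ((-(1 / (4 * Real.pi)) * (logResponse E f f' χ χ' + logResponse E g g' χ χ') : ℝ) : ℂ) := by
  unfold response
  simp only [hχ.deriv_deriv_test]
  have hz : ∀ z : ℝ × ℝ, (-(1 / (4 * (Real.pi : ℂ))) *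
      (Complex.log (Complex.I * ((f z.1 - f z.2 : ℝ) : ℂ)) +
        Complex.log (Complex.I * ((g z.1 - g z.2 : ℝ) : ℂ))) + (c : ℂ)) *
      (phaseDeriv (-E) χ χ' z.1 * phaseDeriv E χ χ' z.2) =
      -(1 / (4 * (Real.pi : ℂ))) * (Complex.log (Complex.I * ((f z.1 - f z.2 : ℝ) : ℂ)) *
        (phaseDeriv (-E) χ χ' z.1 * phaseDeriv E χ χ' z.2)) +
      -(1 / (4 * (Real.pi : ℂ))) * (Complex.log (Complex.I * ((g z.1 - g z.2 : ℝ) : ℂ)) *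
        (phaseDeriv (-E) χ χ' z.1 * phaseDeriv E χ χ' z.2)) +
      c * (phaseDeriv (-E) χ χ' z.1 * phaseDeriv E χ χ' z.2) := fun z => by ring
  have i1 := (h.integrable_clog_mul hχ E).const_mul (-(1 / (4 * (Real.pi : ℂ))))
  have i2 := (hg.integrable_clog_mul hχ E).const_mul (-(1 / (4 * (Real.pi : ℂ))))
  have i3 := (hχ.integrable_phaseDeriv_mul E).const_mul (c : ℂ)
  have i := ((i1.add i2).add i3).congr (ae_of_all _ fun z => (hz z).symm)
  refine (integral_prod _ i).symm.trans ?_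
  simp only [hz]
  refine (integral_add (i1.add i2) i3).trans ?_
  rw [integral_add' i1 i2, integral_const_mul, integral_const_mul, integral_const_mul, h.integral_clog_mul hχ, hg.integral_clog_mul hχ,
    hχ.integral_phaseDeriv_mul]
  push_cast
  ring

end IsTameCoord

/-! ### Bumps as approximate identities -/

/-- A continuous weight of total mass one and of `L¹` norm at most `K`, supported in
`[lo, hi]`. -/
structure IsBump (u : ℝ → ℝ) (lo hi K : ℝ) : Prop where
  continuous : Continuous u
  eq_zero : ∀ x, x ∉ Icc lo hi → u x = 0
  integral_eq_one : ∫ x, u x = 1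
  integral_abs_le : ∫ x, |u x| ≤ K

namespace IsBump

variable {u w : ℝ → ℝ} {lo hi K lo' hi' K' : ℝ}

theorem hasCompactSupport (h : IsBump u lo hi K) : HasCompactSupport u :=
  HasCompactSupport.intro isCompact_Icc h.eq_zero

theorem integrable (h : IsBump u lo hi K) : Integrable u :=
  h.continuous.integrable_of_hasCompactSupport h.hasCompactSupport

theorem hasCompactSupport_prod (hu : IsBump u lo hi K) (hw : IsBump w lo' hi' K') :
    HasCompactSupport fun z : ℝ × ℝ => u z.1 * w z.2 := by
  refine HasCompactSupport.intro (isCompact_Icc.prod isCompact_Icc) (K := Icc lo hi ×ˢ Icc lo' hi')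
    fun z hz => ?_
  by_cases h1 : z.1 ∈ Icc lo hi
  · rw [hw.eq_zero _ fun h2 => hz ⟨h1, h2⟩, mul_zero]
  · rw [hu.eq_zero _ h1, zero_mul]

theorem continuous_prod (hu : IsBump u lo hi K) (hw : IsBump w lo' hi' K') :
    Continuous fun z : ℝ × ℝ => u z.1 * w z.2 :=
  (hu.continuous.comp continuous_fst).mul (hw.continuous.comp continuous_snd)

theorem comp_sub_right (h : IsBump u lo hi K) (t : ℝ) :
    IsBump (fun x => u (x - t)) (lo + t) (hi + t) K where
  continuous := h.continuous.comp (by fun_prop)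
  eq_zero x hx := h.eq_zero _ fun hx' => hx ⟨by linarith [hx'.1], by linarith [hx'.2]⟩
  integral_eq_one := by rw [integral_sub_right_eq_self (fun x => u x) t, h.integral_eq_one]
  integral_abs_le := by
    rw [integral_sub_right_eq_self (fun x => |u x|) t]; exact h.integral_abs_le

/-- Averages against a bump are close to the values on its support. -/
theorem abs_integral_sub_le (h : IsBump u lo hi K) {g : ℝ → ℝ} {l e : ℝ}
    (hg : AEStronglyMeasurable g) (he : 0 ≤ e) (hl : ∀ x ∈ Icc lo hi, |g x - l| ≤ e) :
    |(∫ x, g x * u x) - l| ≤ e * K := by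
  have hb : ∀ x, ‖(g x - l) * u x‖ ≤ e * |u x| := by
    intro x
    rw [norm_mul, Real.norm_eq_abs, Real.norm_eq_abs]
    by_cases hx : x ∈ Icc lo hi
    · exact mul_le_mul_of_nonneg_right (hl x hx) (abs_nonneg _)
    · simp [h.eq_zero x hx]
  have i0 := h.integrable.abs.const_mul e
  have i1 : Integrable fun x => (g x - l) * u x :=
    i0.mono' ((hg.sub aestronglyMeasurable_const).mul h.continuous.aestronglyMeasurable)
      (ae_of_all _ hb)
  have e1 : ∫ x, g x * u x = (∫ x, (g x - l) * u x) + l := by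
    have : ∀ x, g x * u x = (g x - l) * u x + l * u x := fun x => by ring
    simp only [this]
    rw [integral_add i1 (h.integrable.const_mul l), integral_const_mul, h.integral_eq_one, mul_one]
  rw [e1, add_sub_cancel_right, ← Real.norm_eq_abs]
  refine (norm_integral_le_of_norm_le i0 (ae_of_all _ hb)).trans ?_
  rw [integral_const_mul]
  exact mul_le_mul_of_nonneg_left h.integral_abs_le he

theorem mono (h : IsBump u lo hi K) (h1 : lo' ≤ lo) (h2 : hi ≤ hi') : IsBump u lo' hi' K where
  continuous := h.continuous
  eq_zero x hx := h.eq_zero x fun hx' => hx ⟨h1.trans hx'.1, hx'.2.trans h2⟩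
  integral_eq_one := h.integral_eq_one
  integral_abs_le := h.integral_abs_le

theorem ae_fst_ne_snd : ∀ᵐ z : ℝ × ℝ ∂(volume.prod volume), z.1 ≠ z.2 := by
  have hm : MeasurableSet {z : ℝ × ℝ | z.1 = z.2} :=
    measurableSet_eq_fun measurable_fst measurable_snd
  rw [ae_iff]
  simp only [not_not]
  refine (Measure.measure_prod_null hm).2 (ae_of_all _ fun x => ?_)
  have : Prod.mk x ⁻¹' {z : ℝ × ℝ | z.1 = z.2} = {x} := by
    ext y; simp [eq_comm]
  show volume (Prod.mk x ⁻¹' {z : ℝ × ℝ | z.1 = z.2}) = 0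
  rw [this, measure_singleton]

theorem abs_integral_prod_sub_le (hu : IsBump u lo hi K) (hw : IsBump w lo' hi' K')
    {G : ℝ × ℝ → ℝ} {l e : ℝ} (hG : Measurable G) (he : 0 ≤ e)
    (hl : ∀ x ∈ Icc lo hi, ∀ y ∈ Icc lo' hi', x ≠ y → |G (x, y) - l| ≤ e) :
    |(∫ z : ℝ × ℝ, G z * (u z.1 * w z.2) ∂(volume.prod volume)) - l| ≤ e * (K * K') := by
  have hb : ∀ᵐ z : ℝ × ℝ ∂(volume.prod volume),
      ‖(G z - l) * (u z.1 * w z.2)‖ ≤ e * (|u z.1| * |w z.2|) := by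
    filter_upwards [ae_fst_ne_snd]
    rintro ⟨x, y⟩ hxy
    rw [norm_mul, norm_mul, Real.norm_eq_abs, Real.norm_eq_abs, Real.norm_eq_abs]
    by_cases hx : x ∈ Icc lo hi
    · by_cases hy : y ∈ Icc lo' hi'
      · exact mul_le_mul_of_nonneg_right (hl x hx y hy hxy) (by positivity)
      · simp [hw.eq_zero y hy]
    · simp [hu.eq_zero x hx]
  have i0 := (hu.integrable.abs.mul_prod hw.integrable.abs).const_mul e
  have i1 : Integrable (fun z : ℝ × ℝ => (G z - l) * (u z.1 * w z.2)) (volume.prod volume) :=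
    i0.mono' ((hG.sub measurable_const).aestronglyMeasurable.mul
      (hu.continuous_prod hw).aestronglyMeasurable) hb
  have e1 : ∫ z : ℝ × ℝ, G z * (u z.1 * w z.2) ∂(volume.prod volume) =
      (∫ z : ℝ × ℝ, (G z - l) * (u z.1 * w z.2) ∂(volume.prod volume)) + l := by
    have : ∀ z : ℝ × ℝ, G z * (u z.1 * w z.2) =
      (G z - l) * (u z.1 * w z.2) + l * (u z.1 * w z.2) := fun x => by ring
    simp only [this]
    rw [integral_add i1 ((hu.integrable.mul_prod hw.integrable).const_mul l), integral_const_mul,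
      integral_prod_mul, hu.integral_eq_one, hw.integral_eq_one, mul_one, mul_one]
  rw [e1, add_sub_cancel_right, ← Real.norm_eq_abs]
  refine (norm_integral_le_of_norm_le i0 hb).trans ?_
  rw [integral_const_mul, integral_prod_mul (fun x => |u x|) (fun y => |w y|)]
  refine mul_le_mul_of_nonneg_left (mul_le_mul hu.integral_abs_le hw.integral_abs_le
    (integral_nonneg fun _ => abs_nonneg _)
    ((integral_nonneg fun _ => abs_nonneg _).trans hu.integral_abs_le)) he

/-- The limit of `G` is required only off the diagonal, a null set, because the quotient `(f' a - f'
b) / (f a - f b)` has a meaningless value on it. -/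
theorem tendsto_integral_prod {u w : ℝ → ℝ → ℝ} {a b K K' : ℝ}
    (hu : ∀ δ, 0 < δ → IsBump (u δ) (a - δ) (a + δ) K)
    (hw : ∀ δ, 0 < δ → IsBump (w δ) (b - δ) (b + δ) K')
    {G : ℝ × ℝ → ℝ} {l : ℝ} (hG : Measurable G)
    (hl : Tendsto G (𝓝 (a, b) ⊓ 𝓟 {z | z.1 ≠ z.2}) (𝓝 l)) :
    Tendsto (fun δ => ∫ z : ℝ × ℝ, G z * (u δ z.1 * w δ z.2) ∂(volume.prod volume))
      (𝓝[>] 0) (𝓝 l) := by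
  rw [Metric.tendsto_nhds]
  intro e he
  have hK : 0 ≤ K := (integral_nonneg fun _ => abs_nonneg _).trans (hu 1 one_pos).integral_abs_le
  have hK' : 0 ≤ K' := (integral_nonneg fun _ => abs_nonneg _).trans (hw 1 one_pos).integral_abs_le
  have he' : 0 < e / (K * K' + 1) := by positivity
  have h1 := hl (Metric.ball_mem_nhds l he')
  rw [Filter.mem_map, mem_inf_principal, Metric.mem_nhds_iff] at h1
  obtain ⟨d, hd, hball⟩ := h1
  filter_upwards [Ioo_mem_nhdsGT hd] with δ hδ
  have := (hu δ hδ.1).abs_integral_prod_sub_le (hw δ hδ.1) hG (l := l) he'.le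
    (fun x hx y hy hxy => by
      have hmem : (x, y) ∈ Metric.ball (a, b) d := by
        rw [Metric.mem_ball, Prod.dist_eq, max_lt_iff, Real.dist_eq, Real.dist_eq, abs_lt, abs_lt]
        have := hδ.2
        exact ⟨⟨by linarith [hx.1], by linarith [hx.2]⟩, ⟨by linarith [hy.1], by linarith [hy.2]⟩⟩
      have h2 := hball hmem hxy
      rw [mem_preimage, Metric.mem_ball, Real.dist_eq] at h2
      exact h2.le)
  rw [Real.dist_eq]
  refine this.trans_lt ?_
  rw [div_mul_eq_mul_div, div_lt_iff₀ (by positivity)]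
  nlinarith

end IsBump

/-! ### Switching profiles -/

theorem integral_comp_sub_div {F : ℝ → ℝ} {δ : ℝ} (hδ : 0 < δ) (c : ℝ) :
    ∫ u, F ((u - c) / δ) / δ = ∫ x, F x := by
  rw [integral_div, integral_sub_right_eq_self (fun u => F (u / δ)) c,
    Measure.integral_comp_div F δ, abs_of_pos hδ, smul_eq_mul, mul_div_cancel_left₀ _ hδ.ne']

theorem integral_comp_sub_div' {F : ℝ → ℝ} {δ : ℝ} (hδ : 0 < δ) (c : ℝ) :
    ∫ u, F ((c - u) / δ) / δ = ∫ x, F x := by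
  rw [integral_div, integral_sub_left_eq_self (fun u => F (u / δ)) volume c,
    Measure.integral_comp_div F δ, abs_of_pos hδ, smul_eq_mul, mul_div_cancel_left₀ _ hδ.ne']

namespace IsSwitchProfile

variable {h : ℝ → ℝ}

theorem continuous (hh : IsSwitchProfile h) : Continuous h := hh.smooth.continuous

theorem hasDerivAt (hh : IsSwitchProfile h) (x : ℝ) : HasDerivAt h (deriv h x) x :=
  (hh.smooth.differentiable (by simp) x).hasDerivAt

theorem continuous_deriv (hh : IsSwitchProfile h) : Continuous (deriv h) :=
  hh.smooth.continuous_deriv (by simp)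

theorem eq_zero_of_le (hh : IsSwitchProfile h) {x : ℝ} (hx : x ≤ 0) : h x = 0 := by
  have : EqOn h (fun _ => 0) (closure (Iio 0)) :=
    EqOn.closure (fun y hy => hh.eq_zero y hy) hh.continuous continuous_const
  rw [closure_Iio] at this
  exact this hx

theorem eq_one_of_le (hh : IsSwitchProfile h) {x : ℝ} (hx : 1 ≤ x) : h x = 1 := by
  have : EqOn h (fun _ => 1) (closure (Ioi 1)) :=
    EqOn.closure (fun y hy => hh.eq_one y hy) hh.continuous continuous_const
  rw [closure_Ioi] at this
  exact this hx

theorem deriv_eq_zero_of_le (hh : IsSwitchProfile h) {x : ℝ} (hx : x ≤ 0) : deriv h x = 0 := by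
  have : EqOn (deriv h) (fun _ => 0) (closure (Iio 0)) := by
    refine EqOn.closure (fun y hy => ?_) hh.continuous_deriv continuous_const
    have : h =ᶠ[𝓝 y] fun _ => 0 := by
      filter_upwards [isOpen_Iio.mem_nhds hy] with z hz using hh.eq_zero z hz
    rw [this.deriv_eq, deriv_const]
  rw [closure_Iio] at this
  exact this hx

theorem deriv_eq_zero_of_ge (hh : IsSwitchProfile h) {x : ℝ} (hx : 1 ≤ x) : deriv h x = 0 := by
  have : EqOn (deriv h) (fun _ => 0) (closure (Ioi 1)) := by
    refine EqOn.closure (fun y hy => ?_) hh.continuous_deriv continuous_const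
    have : h =ᶠ[𝓝 y] fun _ => 1 := by
      filter_upwards [isOpen_Ioi.mem_nhds hy] with z hz using hh.eq_one z hz
    rw [this.deriv_eq, deriv_const]
  rw [closure_Ioi] at this
  exact this hx

theorem hasCompactSupport_deriv (hh : IsSwitchProfile h) : HasCompactSupport (deriv h) := by
  refine HasCompactSupport.intro (isCompact_Icc (a := (0 : ℝ)) (b := 1)) fun x hx => ?_
  rcases lt_or_ge x 0 with h0 | h0
  · exact hh.deriv_eq_zero_of_le h0.le
  · exact hh.deriv_eq_zero_of_ge (by by_contra! h1; exact hx ⟨h0, h1.le⟩)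

theorem tendsto_atBot (hh : IsSwitchProfile h) : Tendsto h atBot (𝓝 0) := by
  refine (tendsto_congr' ?_).2 tendsto_const_nhds
  filter_upwards [Iic_mem_atBot 0] with x hx using hh.eq_zero_of_le hx

theorem tendsto_atTop (hh : IsSwitchProfile h) : Tendsto h atTop (𝓝 1) := by
  refine (tendsto_congr' ?_).2 tendsto_const_nhds
  filter_upwards [Ici_mem_atTop 1] with x hx using hh.eq_one_of_le hx

theorem integral_deriv (hh : IsSwitchProfile h) : ∫ x, deriv h x = 1 := by
  rw [integral_of_hasDerivAt_of_tendsto hh.hasDerivAt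
    (hh.continuous_deriv.integrable_of_hasCompactSupport hh.hasCompactSupport_deriv)
    hh.tendsto_atBot hh.tendsto_atTop, sub_zero]

/-- The integrand is the derivative of `h²`, which rises from `0` to `1`. It makes the switch-off
derivative of `∫ χ²` equal to `1` for every `δ`. -/
theorem integral_mul_deriv (hh : IsSwitchProfile h) : ∫ x, 2 * h x * deriv h x = 1 := by
  have hc := hh.continuous
  have hc' := hh.continuous_deriv
  rw [integral_of_hasDerivAt_of_tendsto (f := fun x => h x ^ 2) (m := 0) (n := 1)
    (fun x => ((hh.hasDerivAt x).pow 2).congr_deriv (by ring)) ?_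
    (by simpa using hh.tendsto_atBot.pow 2) (by simpa using hh.tendsto_atTop.pow 2), sub_zero]
  exact Continuous.integrable_of_hasCompactSupport (by fun_prop)
    (hh.hasCompactSupport_deriv.mul_left)

theorem exists_bound (hh : IsSwitchProfile h) : ∃ B, 0 ≤ B ∧ ∀ x, |h x| ≤ B := by
  obtain ⟨B, hB⟩ := (isCompact_Icc (a := (0 : ℝ)) (b := 1)).exists_bound_of_continuousOn
    hh.continuous.continuousOn
  refine ⟨max B 1, le_max_of_le_right zero_le_one, fun x => ?_⟩
  rcases le_total x 0 with h0 | h0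
  · simp [hh.eq_zero_of_le h0]
  · rcases le_total x 1 with h1 | h1
    · exact (hB x ⟨h0, h1⟩).trans (le_max_left _ _)
    · simp [hh.eq_one_of_le h1]

theorem isBump_on (hh : IsSwitchProfile h) {δ : ℝ} (hδ : 0 < δ) (c : ℝ) :
    IsBump (fun u => deriv h ((u - c) / δ) / δ) c (c + δ) (∫ x, |deriv h x|) where
  continuous := by have := hh.continuous_deriv; fun_prop
  eq_zero x hx := by
    rcases le_or_gt x c with h0 | h0
    · rw [hh.deriv_eq_zero_of_le (div_nonpos_of_nonpos_of_nonneg (by linarith) hδ.le), zero_div]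
    · have : c + δ ≤ x := by by_contra! h1; exact hx ⟨h0.le, h1.le⟩
      rw [hh.deriv_eq_zero_of_ge ((one_le_div hδ).2 (by linarith)), zero_div]
  integral_eq_one := by rw [integral_comp_sub_div hδ, hh.integral_deriv]
  integral_abs_le := by
    simp only [abs_div, abs_of_pos hδ]
    exact (integral_comp_sub_div (F := fun x => |deriv h x|) hδ c).le

theorem isBump_off (hh : IsSwitchProfile h) {δ : ℝ} (hδ : 0 < δ) (c : ℝ) :
    IsBump (fun u => deriv h ((c - u) / δ) / δ) (c - δ) c (∫ x, |deriv h x|) where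
  continuous := by have := hh.continuous_deriv; fun_prop
  eq_zero x hx := by
    rcases le_or_gt c x with h0 | h0
    · rw [hh.deriv_eq_zero_of_le (div_nonpos_of_nonpos_of_nonneg (by linarith) hδ.le), zero_div]
    · have : x ≤ c - δ := by by_contra! h1; exact hx ⟨h1.le, h0.le⟩
      rw [hh.deriv_eq_zero_of_ge ((one_le_div hδ).2 (by linarith)), zero_div]
  integral_eq_one := by rw [integral_comp_sub_div' hδ, hh.integral_deriv]
  integral_abs_le := by
    simp only [abs_div, abs_of_pos hδ]
    exact (integral_comp_sub_div' (F := fun x => |deriv h x|) hδ c).le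

end IsSwitchProfile

/-! ### The switching function and its switch-off derivative -/

/-- The switch-on bump, minus the derivative of the switching function near `τ₀`. -/
noncomputable def onBump (h : ℝ → ℝ) (δ τ₀ : ℝ) (u : ℝ) : ℝ := deriv h ((u - (τ₀ - δ)) / δ) / δ

/-- The switch-off bump, translated to the origin. -/
noncomputable def offBump (h : ℝ → ℝ) (δ : ℝ) (u : ℝ) : ℝ := deriv h ((δ - u) / δ) / δ

variable {h₁ h₂ : ℝ → ℝ}

theorem isBump_onBump (H : IsSwitchProfile h₁) {δ : ℝ} (hδ : 0 < δ) (τ₀ : ℝ) :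
    IsBump (onBump h₁ δ τ₀) (τ₀ - δ) τ₀ (∫ x, |deriv h₁ x|) := by
  have := H.isBump_on hδ (τ₀ - δ)
  rwa [sub_add_cancel] at this

theorem isBump_offBump (H : IsSwitchProfile h₂) {δ : ℝ} (hδ : 0 < δ) :
    IsBump (offBump h₂ δ) 0 δ (∫ x, |deriv h₂ x|) := by
  have := H.isBump_off hδ δ
  rwa [sub_self] at this

theorem isBump_offBump_sub (H : IsSwitchProfile h₂) {δ : ℝ} (hδ : 0 < δ) (t : ℝ) :
    IsBump (fun u => offBump h₂ δ (u - t)) t (t + δ) (∫ x, |deriv h₂ x|) := by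
  have := (isBump_offBump H hδ).comp_sub_right t
  rwa [zero_add, add_comm] at this

theorem switching_eq (h₁ h₂ : ℝ → ℝ) (δ τ₀ t u : ℝ) :
    switching h₁ h₂ δ τ₀ t u = h₁ ((u - (τ₀ - δ)) / δ) * h₂ ((t + δ - u) / δ) := by
  unfold switching
  rw [show u - τ₀ + δ = u - (τ₀ - δ) by ring, show -u + t + δ = t + δ - u by ring]

theorem switching_eq_zero (H₁ : IsSwitchProfile h₁) (H₂ : IsSwitchProfile h₂) {δ τ₀ t u : ℝ}
    (hδ : 0 < δ) (hu : u ∉ Icc (τ₀ - δ) (t + δ)) : switching h₁ h₂ δ τ₀ t u = 0 := by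
  rw [switching_eq]
  rcases le_or_gt u (τ₀ - δ) with h | h
  · rw [H₁.eq_zero_of_le (div_nonpos_of_nonpos_of_nonneg (by linarith) hδ.le), zero_mul]
  · have : t + δ ≤ u := by by_contra! h'; exact hu ⟨h.le, h'.le⟩
    rw [H₂.eq_zero_of_le (div_nonpos_of_nonpos_of_nonneg (by linarith) hδ.le), mul_zero]

theorem switching_eq_one (H₁ : IsSwitchProfile h₁) (H₂ : IsSwitchProfile h₂) {δ τ₀ t u : ℝ}
    (hδ : 0 < δ) (hu : u ∈ Icc τ₀ t) : switching h₁ h₂ δ τ₀ t u = 1 := by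
  rw [switching_eq, H₁.eq_one_of_le ((one_le_div hδ).2 (by linarith [hu.1])),
    H₂.eq_one_of_le ((one_le_div hδ).2 (by linarith [hu.2])), mul_one]

theorem exists_switching_bound (H₁ : IsSwitchProfile h₁) (H₂ : IsSwitchProfile h₂) :
    ∃ B, 0 ≤ B ∧ ∀ δ τ₀ t u, |switching h₁ h₂ δ τ₀ t u| ≤ B := by
  obtain ⟨B₁, h1, hB₁⟩ := H₁.exists_bound
  obtain ⟨B₂, h2, hB₂⟩ := H₂.exists_bound
  refine ⟨B₁ * B₂, mul_nonneg h1 h2, fun δ τ₀ t u => ?_⟩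
  rw [switching_eq, abs_mul]
  exact mul_le_mul (hB₁ _) (hB₂ _) (abs_nonneg _) h1

/-- For `τ₀ ≤ t` the switch-on profile has already reached `1` where the switch-off bump lives, so
the two edges of the window do not interact. -/
theorem switchOn_mul_offBump (H₁ : IsSwitchProfile h₁) (H₂ : IsSwitchProfile h₂) {δ τ₀ t : ℝ}
    (hδ : 0 < δ) (ht : τ₀ ≤ t) (u : ℝ) :
    h₁ ((u - (τ₀ - δ)) / δ) * offBump h₂ δ (u - t) = offBump h₂ δ (u - t) := by
  rcases le_total τ₀ u with h | h
  · rw [H₁.eq_one_of_le ((one_le_div hδ).2 (by linarith)), one_mul]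
  · unfold offBump
    rw [H₂.deriv_eq_zero_of_ge ((one_le_div hδ).2 (by linarith)), zero_div, mul_zero]

theorem switchOff_mul_onBump (H₁ : IsSwitchProfile h₁) (H₂ : IsSwitchProfile h₂) {δ τ₀ t : ℝ}
    (hδ : 0 < δ) (ht : τ₀ ≤ t) (u : ℝ) :
    onBump h₁ δ τ₀ u * h₂ ((t + δ - u) / δ) = onBump h₁ δ τ₀ u := by
  rcases le_total u τ₀ with h | h
  · rw [H₂.eq_one_of_le ((one_le_div hδ).2 (by linarith)), mul_one]
  · unfold onBump
    rw [H₁.deriv_eq_zero_of_ge ((one_le_div hδ).2 (by linarith)), zero_div, zero_mul]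

theorem isWindow_switching (H₁ : IsSwitchProfile h₁) (H₂ : IsSwitchProfile h₂) {δ τ₀ t : ℝ}
    (hδ : 0 < δ) (ht : τ₀ ≤ t) :
    IsWindow (switching h₁ h₂ δ τ₀ t) (fun u => onBump h₁ δ τ₀ u - offBump h₂ δ (u - t)) where
  hasDeriv u := by
    have e : switching h₁ h₂ δ τ₀ t =
        fun u => h₁ ((u - (τ₀ - δ)) / δ) * h₂ ((t + δ - u) / δ) :=
      funext fun u => switching_eq h₁ h₂ δ τ₀ t u
    have d1 : HasDerivAt (fun u => h₁ ((u - (τ₀ - δ)) / δ)) (onBump h₁ δ τ₀ u) u := by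
      refine ((H₁.hasDerivAt ((u - (τ₀ - δ)) / δ)).comp u
        (((hasDerivAt_id u).sub_const (τ₀ - δ)).div_const δ)).congr_deriv ?_
      unfold onBump; ring
    have d2 : HasDerivAt (fun u => h₂ ((t + δ - u) / δ)) (-offBump h₂ δ (u - t)) u := by
      refine ((H₂.hasDerivAt ((t + δ - u) / δ)).comp u
        (((hasDerivAt_id u).const_sub (t + δ)).div_const δ)).congr_deriv ?_
      unfold offBump
      rw [show δ - (u - t) = t + δ - u by ring]; ring
    rw [e]
    refine (d1.mul d2).congr_deriv ?_
    rw [switchOff_mul_onBump H₁ H₂ hδ ht, mul_neg, switchOn_mul_offBump H₁ H₂ hδ ht]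
    exact (sub_eq_add_neg _ _).symm
  cont_deriv := (isBump_onBump H₁ hδ τ₀).continuous.sub (isBump_offBump_sub H₂ hδ t).continuous
  compact := HasCompactSupport.intro isCompact_Icc fun _ hu => switching_eq_zero H₁ H₂ hδ hu

theorem hasDerivAt_switching (H₁ : IsSwitchProfile h₁) (H₂ : IsSwitchProfile h₂) {δ τ₀ t : ℝ}
    (hδ : 0 < δ) (ht : τ₀ ≤ t) (u : ℝ) :
    HasDerivAt (fun t => switching h₁ h₂ δ τ₀ t u) (offBump h₂ δ (u - t)) t := by
  have d2 : HasDerivAt (fun t => h₂ ((t + δ - u) / δ)) (offBump h₂ δ (u - t)) t := by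
    refine ((H₂.hasDerivAt ((t + δ - u) / δ)).comp t
      ((((hasDerivAt_id t).add_const δ).sub_const u).div_const δ)).congr_deriv ?_
    unfold offBump
    rw [show δ - (u - t) = t + δ - u by ring]; ring
  simp only [switching_eq]
  refine (d2.const_mul _).congr_deriv ?_
  rw [switchOn_mul_offBump H₁ H₂ hδ ht]

theorem exists_offBump_bound (H₂ : IsSwitchProfile h₂) {δ : ℝ} (hδ : 0 < δ) :
    ∃ B, 0 ≤ B ∧ ∀ u, |offBump h₂ δ u| ≤ B := by
  have hb := isBump_offBump H₂ hδ
  obtain ⟨B, hB⟩ := hb.continuous.bounded_above_of_compact_support hb.hasCompactSupport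
  exact ⟨B, (norm_nonneg _).trans (hB 0), hB⟩

theorem hasDerivAt_integral_switching_sq (H₁ : IsSwitchProfile h₁) (H₂ : IsSwitchProfile h₂)
    {δ τ₀ τ : ℝ} (hδ : 0 < δ) (hτ : τ₀ < τ) :
    HasDerivAt (fun t => ∫ u, switching h₁ h₂ δ τ₀ t u ^ 2) 1 τ := by
  obtain ⟨B, hB0, hB⟩ := exists_switching_bound H₁ H₂
  obtain ⟨R, hR0, hR⟩ := exists_offBump_bound H₂ hδ
  have hw := fun t (ht : τ₀ ≤ t) => isWindow_switching H₁ H₂ hδ ht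
  -- The lower end keeps the two edges separate; the upper end confines all the windows to one
  -- compact interval, on which a constant dominates.
  have hmem : Ioo τ₀ (τ + 1) ∈ 𝓝 τ := Ioo_mem_nhds hτ (by linarith)
  have key := hasDerivAt_integral_of_dominated_loc_of_deriv_le (μ := volume)
    (F := fun t u => switching h₁ h₂ δ τ₀ t u ^ 2)
    (F' := fun t u => 2 * switching h₁ h₂ δ τ₀ t u * offBump h₂ δ (u - t))
    (bound := (Icc (τ₀ - δ) (τ + 1 + δ)).indicator fun _ => 2 * B * R) hmem
    (by
      filter_upwards [hmem] with t ht
      exact ((hw t ht.1.le).continuous.pow 2).aestronglyMeasurable)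
    ?_ ?_ ?_ ?_ ?_
  · have e : ∫ u, 2 * switching h₁ h₂ δ τ₀ τ u * offBump h₂ δ (u - τ) = 1 := by
      rw [← H₂.integral_mul_deriv,
        ← integral_comp_sub_div' (F := fun x => 2 * h₂ x * deriv h₂ x) hδ (τ + δ)]
      congr 1 with u
      rw [switching_eq, mul_assoc, mul_comm (h₁ _), mul_assoc, switchOn_mul_offBump H₁ H₂ hδ hτ.le]
      unfold offBump
      rw [show δ - (u - τ) = τ + δ - u by ring]
      ring
    rw [← e]
    exact key.2
  · exact ((hw τ hτ.le).continuous.pow 2).integrable_of_hasCompactSupport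
      (HasCompactSupport.intro isCompact_Icc fun u hu => by
        show switching h₁ h₂ δ τ₀ τ u ^ 2 = 0
        rw [switching_eq_zero H₁ H₂ hδ hu, zero_pow two_ne_zero])
  · exact ((continuous_const.mul (hw τ hτ.le).continuous).mul
      (isBump_offBump_sub H₂ hδ τ).continuous).aestronglyMeasurable
  · refine ae_of_all _ fun u t ht => ?_
    by_cases hu : u ∈ Icc (τ₀ - δ) (τ + 1 + δ)
    · rw [indicator_of_mem hu, norm_mul, norm_mul, Real.norm_eq_abs, Real.norm_eq_abs,
        Real.norm_eq_abs, abs_two]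
      exact mul_le_mul (mul_le_mul_of_nonneg_left (hB _ _ _ _) two_pos.le) (hR _) (abs_nonneg _)
        (by positivity)
    · rw [switching_eq_zero H₁ H₂ hδ fun hu' => hu ⟨hu'.1, hu'.2.trans (by linarith [ht.2])⟩]
      simp [indicator_of_notMem hu]
  · exact (integrable_indicator_iff measurableSet_Icc).2 (integrableOn_const (by simp))
  · refine ae_of_all _ fun u t ht => ?_
    exact ((hasDerivAt_switching H₁ H₂ hδ ht.1.le u).pow 2).congr_deriv (by ring)

theorem hasDerivAt_integral_switching_mul (H₁ : IsSwitchProfile h₁) (H₂ : IsSwitchProfile h₂)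
    {δ τ₀ τ : ℝ} (hδ : 0 < δ) (hτ : τ₀ < τ) {G : ℝ × ℝ → ℝ} (hG : Measurable G) {D : ℝ}
    (hD : ∀ z, |G z| ≤ D) :
    HasDerivAt (fun t => ∫ z : ℝ × ℝ, G z *
        (switching h₁ h₂ δ τ₀ t z.1 * switching h₁ h₂ δ τ₀ t z.2) ∂(volume.prod volume))
      (∫ z : ℝ × ℝ, G z * (offBump h₂ δ (z.1 - τ) * switching h₁ h₂ δ τ₀ τ z.2 +
        switching h₁ h₂ δ τ₀ τ z.1 * offBump h₂ δ (z.2 - τ)) ∂(volume.prod volume)) τ := by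
  obtain ⟨B, hB0, hB⟩ := exists_switching_bound H₁ H₂
  obtain ⟨R, hR0, hR⟩ := exists_offBump_bound H₂ hδ
  have hD0 : 0 ≤ D := (abs_nonneg _).trans (hD 0)
  have hw := fun t (ht : τ₀ ≤ t) => isWindow_switching H₁ H₂ hδ ht
  have hmem : Ioo τ₀ (τ + 1) ∈ 𝓝 τ := Ioo_mem_nhds hτ (by linarith)
  set S : Set (ℝ × ℝ) := Icc (τ₀ - δ) (τ + 1 + δ) ×ˢ Icc (τ₀ - δ) (τ + 1 + δ)
  have hS : MeasurableSet S := measurableSet_Icc.prod measurableSet_Icc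
  have key := hasDerivAt_integral_of_dominated_loc_of_deriv_le (μ := volume.prod volume)
    (F := fun t z => G z * (switching h₁ h₂ δ τ₀ t z.1 * switching h₁ h₂ δ τ₀ t z.2))
    (F' := fun t z => G z * (offBump h₂ δ (z.1 - t) * switching h₁ h₂ δ τ₀ t z.2 +
        switching h₁ h₂ δ τ₀ t z.1 * offBump h₂ δ (z.2 - t)))
    (bound := S.indicator fun _ => D * (R * B + B * R)) hmem
    (by
      filter_upwards [hmem] with t ht
      have := (hw t ht.1.le).continuous
      exact hG.aestronglyMeasurable.mul (Continuous.aestronglyMeasurable (by fun_prop)))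
    ?_ ?_ ?_ ?_ ?_
  · exact key.2
  · have := (hw τ hτ.le).continuous
    refine integrable_smul_of_bounded hG hD (by fun_prop) ((hw τ hτ.le).hasCompactSupport_prod ?_)
    rintro z (hz | hz) <;> simp [hz.1]
  · have h1 := (hw τ hτ.le).continuous
    have h2 := (isBump_offBump H₂ hδ).continuous
    exact hG.aestronglyMeasurable.mul (Continuous.aestronglyMeasurable (by fun_prop))
  · refine ae_of_all _ fun z t ht => ?_
    have hz : ∀ x, x ∉ Icc (τ₀ - δ) (τ + 1 + δ) →
        switching h₁ h₂ δ τ₀ t x = 0 ∧ offBump h₂ δ (x - t) = 0 := fun x hx =>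
      ⟨switching_eq_zero H₁ H₂ hδ fun hu' => hx ⟨hu'.1, hu'.2.trans (by linarith [ht.2])⟩,
        (isBump_offBump_sub H₂ hδ t).eq_zero x fun hu' =>
          hx ⟨by linarith [hu'.1, ht.1], hu'.2.trans (by linarith [ht.2])⟩⟩
    by_cases hzS : z ∈ S
    · rw [indicator_of_mem hzS, norm_mul]
      refine mul_le_mul (hD z) ((norm_add_le _ _).trans ?_) (norm_nonneg _) hD0
      rw [norm_mul, norm_mul]
      exact add_le_add (mul_le_mul (hR _) (hB _ _ _ _) (norm_nonneg _) hR0)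
        (mul_le_mul (hB _ _ _ _) (hR _) (norm_nonneg _) hB0)
    · rw [indicator_of_notMem hzS]
      by_cases h1 : z.1 ∈ Icc (τ₀ - δ) (τ + 1 + δ)
      · have := hz z.2 fun h2 => hzS ⟨h1, h2⟩
        simp [this.1, this.2]
      · have := hz z.1 h1
        simp [this.1, this.2]
  · exact (integrable_indicator_iff hS).2 (integrableOn_const (by
      rw [Measure.prod_prod]; exact ENNReal.mul_ne_top (by simp) (by simp)))
  · refine ae_of_all _ fun z t ht => ?_
    exact ((hasDerivAt_switching H₁ H₂ hδ ht.1.le z.1).mul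
      (hasDerivAt_switching H₁ H₂ hδ ht.1.le z.2)).const_mul (G z)

/-! ### Logarithmic energy of the two bumps -/

namespace IsTameCoord

variable {f f' f'' : ℝ → ℝ} {m C L : ℝ}

theorem comp_add_right (h : IsTameCoord f f' f'' m C L) (t : ℝ) :
    IsTameCoord (fun x => f (x + t)) (fun x => f' (x + t)) (fun x => f'' (x + t)) m C L where
  pos := h.pos
  hasDeriv x := (h.hasDeriv (x + t)).comp_add_const x t
  hasDeriv' x := (h.hasDeriv' (x + t)).comp_add_const x t
  le_deriv x := h.le_deriv _
  deriv_le x := h.deriv_le _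
  abs_deriv2_le x := h.abs_deriv2_le _
  cont_deriv2 := h.cont_deriv2.comp (by fun_prop)

theorem integrable_log_mul_bump (h : IsTameCoord f f' f'' m C L) {u w : ℝ → ℝ}
    {lo hi K lo' hi' K' : ℝ} (hu : IsBump u lo hi K) (hw : IsBump w lo' hi' K') :
    Integrable (fun z : ℝ × ℝ => Real.log (f z.1 - f z.2) * (u z.1 * w z.2))
      (volume.prod volume) :=
  h.integrable_log_smul (hu.continuous_prod hw) (hu.hasCompactSupport_prod hw)

/-- Translation moves `t` from the bump into the kernel, so that differentiation in `t` falls on the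
coordinate and gives expressions with a limit as the bump shrinks. -/
theorem integral_log_mul_bump_shift_snd (α ρ : ℝ → ℝ) (f : ℝ → ℝ) (t : ℝ) :
    ∫ z : ℝ × ℝ, Real.log (f z.1 - f z.2) * (α z.1 * ρ (z.2 - t)) ∂(volume.prod volume) =
    ∫ z : ℝ × ℝ, Real.log (f z.1 - f (z.2 + t)) * (α z.1 * ρ z.2) ∂(volume.prod volume) := by
  rw [← integral_add_right_eq_self (μ := (volume : Measure ℝ).prod (volume : Measure ℝ)) _
    ((0, t) : ℝ × ℝ)]
  simp

theorem integral_log_mul_bump_shift (ρ : ℝ → ℝ) (f : ℝ → ℝ) (t : ℝ) :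
    ∫ z : ℝ × ℝ, Real.log (f z.1 - f z.2) * (ρ (z.1 - t) * ρ (z.2 - t)) ∂(volume.prod volume) =
    ∫ z : ℝ × ℝ, Real.log (f (z.1 + t) - f (z.2 + t)) * (ρ z.1 * ρ z.2) ∂(volume.prod volume) := by
  rw [← integral_add_right_eq_self (μ := (volume : Measure ℝ).prod (volume : Measure ℝ)) _
    ((t, t) : ℝ × ℝ)]
  simp

theorem integrable_log_mul_bump_shift_snd (h : IsTameCoord f f' f'' m C L) {α ρ : ℝ → ℝ}
    {lo hi K lo' hi' K' : ℝ} (hα : IsBump α lo hi K) (hρ : IsBump ρ lo' hi' K') (t : ℝ) :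
    Integrable (fun z : ℝ × ℝ => Real.log (f z.1 - f (z.2 + t)) * (α z.1 * ρ z.2))
      (volume.prod volume) := by
  have := (h.integrable_log_mul_bump hα (hρ.comp_sub_right t)).comp_add_right ((0, t) : ℝ × ℝ)
  simpa using this

/-- Bilinear expansion of the logarithmic energy of the difference of two bumps. -/
theorem integral_log_mul_sub (h : IsTameCoord f f' f'' m C L) {α ρ : ℝ → ℝ}
    {lo hi K lo' hi' K' : ℝ} (hα : IsBump α lo hi K) (hρ : IsBump ρ lo' hi' K') (t : ℝ) :
    ∫ z : ℝ × ℝ, Real.log (f z.1 - f z.2) * ((α z.1 - ρ (z.1 - t)) * (α z.2 - ρ (z.2 - t)))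
      ∂(volume.prod volume) =
    (∫ z : ℝ × ℝ, Real.log (f z.1 - f z.2) * (α z.1 * α z.2) ∂(volume.prod volume)) -
    2 * (∫ z : ℝ × ℝ, Real.log (f z.1 - f (z.2 + t)) * (α z.1 * ρ z.2) ∂(volume.prod volume)) +
    ∫ z : ℝ × ℝ, Real.log (f (z.1 + t) - f (z.2 + t)) * (ρ z.1 * ρ z.2)
      ∂(volume.prod volume) := by
  have i1 := h.integrable_log_mul_bump hα hα
  have i2 := h.integrable_log_mul_bump hα (hρ.comp_sub_right t)
  have i3 := h.integrable_log_mul_bump (hρ.comp_sub_right t) hα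
  have i4 := h.integrable_log_mul_bump (hρ.comp_sub_right t) (hρ.comp_sub_right t)
  have e : ∀ z : ℝ × ℝ, Real.log (f z.1 - f z.2) * ((α z.1 - ρ (z.1 - t)) * (α z.2 - ρ (z.2 - t))) =
      Real.log (f z.1 - f z.2) * (α z.1 * α z.2) -
      Real.log (f z.1 - f z.2) * (α z.1 * ρ (z.2 - t)) -
      Real.log (f z.1 - f z.2) * (ρ (z.1 - t) * α z.2) +
      Real.log (f z.1 - f z.2) * (ρ (z.1 - t) * ρ (z.2 - t)) := fun z => by ring
  -- `log |f a - f b|` is symmetric, so the two cross terms coincide.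
  have hs : ∫ z : ℝ × ℝ, Real.log (f z.1 - f z.2) * (ρ (z.1 - t) * α z.2) ∂(volume.prod volume) =
      ∫ z : ℝ × ℝ, Real.log (f z.1 - f z.2) * (α z.1 * ρ (z.2 - t)) ∂(volume.prod volume) := by
    rw [← integral_prod_swap]
    congr 1 with z
    rw [Prod.fst_swap, Prod.snd_swap, ← Real.log_neg_eq_log, neg_sub]
    ring
  simp only [e]
  have s1 := integral_add ((i1.sub i2).sub i3) i4
  have s2 := integral_sub (i1.sub i2) i3
  have s3 := integral_sub i1 i2
  simp only [Pi.sub_apply] at s1 s2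
  rw [s1, s2, s3, hs, integral_log_mul_bump_shift_snd, integral_log_mul_bump_shift]
  ring

/-- The two bumps sit at separated times, so the logarithm stays away from its singularity. The
margin `d`, half of the gap, keeps the separation uniform for `t` near `τ`. -/
theorem hasDerivAt_integral_log_cross (h : IsTameCoord f f' f'' m C L) {α ρ : ℝ → ℝ}
    {lo τ₀ K hi K' τ : ℝ} (hα : IsBump α lo τ₀ K) (hρ : IsBump ρ 0 hi K') (hτ : τ₀ < τ) :
    HasDerivAt (fun t => ∫ z : ℝ × ℝ, Real.log (f z.1 - f (z.2 + t)) * (α z.1 * ρ z.2)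
      ∂(volume.prod volume))
      (∫ z : ℝ × ℝ, f' (z.2 + τ) / (f (z.2 + τ) - f z.1) * (α z.1 * ρ z.2)
        ∂(volume.prod volume)) τ := by
  have hm := h.pos
  have hf := h.continuous.measurable
  have hf' := h.continuous_deriv.measurable
  have hbc := (hα.continuous_prod hρ).aestronglyMeasurable (μ := volume.prod volume)
  set d := (τ - τ₀) / 2 with hd
  have hd0 : 0 < d := by rw [hd]; linarith
  have hlow : ∀ z : ℝ × ℝ, z.1 ∈ Icc lo τ₀ → z.2 ∈ Icc 0 hi → ∀ t ∈ Ioi (τ₀ + d),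
      m * d ≤ f (z.2 + t) - f z.1 := by
    intro z h1 h2 t ht
    have hlt : d ≤ z.2 + t - z.1 := by
      have : τ₀ + d < t := ht
      linarith [h1.2, h2.1]
    have := mul_sub_le_image_sub_of_le_deriv (f := f)
      (fun x => (h.hasDeriv x).differentiableAt) (C := m)
      (fun x => by rw [(h.hasDeriv x).deriv]; exact h.le_deriv x)
      (show z.1 ≤ z.2 + t by linarith)
    nlinarith
  refine (hasDerivAt_integral_of_dominated_loc_of_deriv_le (μ := volume.prod volume)
    (F := fun t z => Real.log (f z.1 - f (z.2 + t)) * (α z.1 * ρ z.2))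
    (F' := fun t z => f' (z.2 + t) / (f (z.2 + t) - f z.1) * (α z.1 * ρ z.2))
    (bound := fun z => C / (m * d) * (|α z.1| * |ρ z.2|))
    (Ioi_mem_nhds (show τ₀ + d < τ by rw [hd]; linarith)) ?_ ?_ ?_ ?_ ?_ ?_).2
  · refine Eventually.of_forall fun t => AEStronglyMeasurable.mul ?_ hbc
    exact (Real.measurable_log.comp (by fun_prop)).aestronglyMeasurable
  · exact h.integrable_log_mul_bump_shift_snd hα hρ τ
  · refine AEStronglyMeasurable.mul (Measurable.aestronglyMeasurable ?_) hbc
    fun_prop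
  · refine ae_of_all _ fun z t ht => ?_
    rw [norm_mul, norm_mul, Real.norm_eq_abs, Real.norm_eq_abs, Real.norm_eq_abs]
    by_cases h1 : z.1 ∈ Icc lo τ₀
    · by_cases h2 : z.2 ∈ Icc 0 hi
      · have hl := hlow z h1 h2 t ht
        have hmd : 0 < m * d := mul_pos hm hd0
        refine mul_le_mul_of_nonneg_right ?_ (by positivity)
        rw [abs_div, abs_of_pos (hmd.trans_le hl)]
        exact div_le_div₀ h.bound_pos.le (h.abs_deriv _) hmd hl
      · simp [hρ.eq_zero _ h2]
    · simp [hα.eq_zero _ h1]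
  · exact (hα.integrable.abs.mul_prod hρ.integrable.abs).const_mul _
  · refine ae_of_all _ fun z t ht => ?_
    by_cases h1 : z.1 ∈ Icc lo τ₀
    · by_cases h2 : z.2 ∈ Icc 0 hi
      · have hl := (mul_pos hm hd0).trans_le (hlow z h1 h2 t ht)
        have hne : f z.1 - f (z.2 + t) ≠ 0 := by
          intro h0; linarith
        refine ((((h.hasDeriv (z.2 + t)).comp_const_add z.2 t).const_sub (f z.1)).log hne
          |>.mul_const _).congr_deriv ?_
        rw [← neg_sub (f (z.2 + t)), neg_div_neg_eq]
      · simpa [hρ.eq_zero _ h2] using hasDerivAt_const t (0 : ℝ)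
    · simpa [hα.eq_zero _ h1] using hasDerivAt_const t (0 : ℝ)

/-- Here the logarithm is singular, but `t` moves both arguments together: its derivative is a
difference quotient, bounded by `L / m`. -/
theorem hasDerivAt_integral_log_diag (h : IsTameCoord f f' f'' m C L) {ρ : ℝ → ℝ}
    {lo hi K τ : ℝ} (hρ : IsBump ρ lo hi K) :
    HasDerivAt (fun t => ∫ z : ℝ × ℝ, Real.log (f (z.1 + t) - f (z.2 + t)) * (ρ z.1 * ρ z.2)
      ∂(volume.prod volume))
      (∫ z : ℝ × ℝ, (f' (z.1 + τ) - f' (z.2 + τ)) / (f (z.1 + τ) - f (z.2 + τ)) *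
        (ρ z.1 * ρ z.2) ∂(volume.prod volume)) τ := by
  have hf := h.continuous.measurable
  have hf' := h.continuous_deriv.measurable
  have hbc := (hρ.continuous_prod hρ).aestronglyMeasurable (μ := volume.prod volume)
  refine (hasDerivAt_integral_of_dominated_loc_of_deriv_le (μ := volume.prod volume)
    (F := fun t z => Real.log (f (z.1 + t) - f (z.2 + t)) * (ρ z.1 * ρ z.2))
    (F' := fun t z => (f' (z.1 + t) - f' (z.2 + t)) / (f (z.1 + t) - f (z.2 + t)) *
        (ρ z.1 * ρ z.2))
    (bound := fun z => L / m * (|ρ z.1| * |ρ z.2|)) (s := univ) univ_mem ?_ ?_ ?_ ?_ ?_ ?_).2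
  · refine Eventually.of_forall fun t => AEStronglyMeasurable.mul ?_ hbc
    exact (Real.measurable_log.comp (by fun_prop)).aestronglyMeasurable
  · exact (h.comp_add_right τ).integrable_log_mul_bump hρ hρ
  · refine AEStronglyMeasurable.mul (Measurable.aestronglyMeasurable ?_) hbc
    fun_prop
  · refine ae_of_all _ fun z t _ => ?_
    rw [norm_mul, norm_mul, Real.norm_eq_abs, Real.norm_eq_abs, Real.norm_eq_abs]
    exact mul_le_mul_of_nonneg_right
      (h.abs_div_sub_le h.bound2_nonneg (h.abs_deriv_sub_le _ _)) (by positivity)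
  · exact (hρ.integrable.abs.mul_prod hρ.integrable.abs).const_mul _
  · refine ae_of_all _ fun z t _ => ?_
    rcases eq_or_ne z.1 z.2 with heq | hne
    · simpa [heq] using hasDerivAt_const t (0 : ℝ)
    · exact ((((h.hasDeriv (z.1 + t)).comp_const_add z.1 t).sub
        ((h.hasDeriv (z.2 + t)).comp_const_add z.2 t)).log
          (h.sub_ne_zero fun he => hne (add_right_cancel he))).mul_const _

/-- The difference quotient of `f'` with respect to `f` tends to `f'' / f'` on the diagonal. -/
theorem tendsto_deriv_sub_div (h : IsTameCoord f f' f'' m C L) (τ : ℝ) :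
    Tendsto (fun z : ℝ × ℝ => (f' (z.1 + τ) - f' (z.2 + τ)) / (f (z.1 + τ) - f (z.2 + τ)))
      (𝓝 (0, 0) ⊓ 𝓟 {z | z.1 ≠ z.2}) (𝓝 (f'' τ / f' τ)) := by
  have key : ∀ g g' : ℝ → ℝ, (∀ x, HasDerivAt g (g' x) x) → Continuous g' →
      Tendsto (fun z : ℝ × ℝ => (g (z.1 + τ) - g (z.2 + τ)) / (z.1 - z.2))
        (𝓝 (0, 0) ⊓ 𝓟 {z | z.1 ≠ z.2}) (𝓝 (g' τ)) := by
    intro g g' hg hc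
    have hcd : ContDiff ℝ 1 g := by
      rw [contDiff_one_iff_deriv]
      refine ⟨fun b => (hg b).differentiableAt, ?_⟩
      rwa [show deriv g = g' from funext fun b => (hg b).deriv]
    have hst : HasStrictDerivAt g (g' τ) τ := by
      have := hcd.contDiffAt.hasStrictDerivAt (x := τ) one_ne_zero
      rwa [(hg τ).deriv] at this
    have ho := hst.isLittleO
    have hsh : Tendsto (fun z : ℝ × ℝ => (z.1 + τ, z.2 + τ)) (𝓝 (0, 0)) (𝓝 (τ, τ)) := by
      have : Continuous fun z : ℝ × ℝ => (z.1 + τ, z.2 + τ) := by fun_prop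
      simpa using this.tendsto (0, 0)
    have ho' := (ho.comp_tendsto hsh).mono (inf_le_left (b := 𝓟 {z : ℝ × ℝ | z.1 ≠ z.2}))
    have ho2 := ho'.tendsto_div_nhds_zero
    rw [← tendsto_sub_nhds_zero_iff]
    refine (tendsto_congr' ?_).1 ho2
    filter_upwards [mem_inf_of_right (mem_principal_self _)] with z hz
    have : z.1 - z.2 ≠ 0 := _root_.sub_ne_zero.2 hz
    simp only [Function.comp, ContinuousLinearMap.toSpanSingleton_apply, smul_eq_mul,
      add_sub_add_right_eq_sub]
    field_simp
  have h1 := key f' f'' h.hasDeriv' h.cont_deriv2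
  have h2 := key f f' h.hasDeriv h.continuous_deriv
  refine (tendsto_congr' ?_).1 (h1.div h2 (h.deriv_pos τ).ne')
  filter_upwards [mem_inf_of_right (mem_principal_self _)] with z hz
  have : z.1 - z.2 ≠ 0 := _root_.sub_ne_zero.2 hz
  simp only [Pi.div_apply]
  rw [div_div_div_cancel_right₀ this]

end IsTameCoord

/-! ### Sharp-switching limit for one null coordinate -/

/-- The contribution of one null coordinate to the transition rate, up to the factor
`-1 / (4π)`. -/
noncomputable def coordRate (E : ℝ) (f f' f'' : ℝ → ℝ) (τ₀ τ : ℝ) : ℝ :=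
  Real.pi * E + (f'' τ / f' τ - 2 * (f' τ / (f τ - f τ₀))) +
    2 * ∫ b in τ₀..τ, regularKernel E f f' τ b

namespace IsTameCoord

variable {f f' f'' : ℝ → ℝ} {m C L : ℝ}

theorem continuousAt_regularKernel (h : IsTameCoord f f' f'' m C L) (E : ℝ) {τ b : ℝ}
    (hb : τ ≠ b) : ContinuousAt (fun a => regularKernel E f f' a b) τ := by
  have h1 := h.continuous
  have h2 := h.continuous_deriv
  unfold regularKernel
  refine ContinuousAt.div (by fun_prop) (by fun_prop) (pow_ne_zero 2 (h.sub_ne_zero hb))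

theorem measurable_regularKernel_right (h : IsTameCoord f f' f'' m C L) (E a : ℝ) :
    Measurable (regularKernel E f f' a) :=
  (h.measurable_regularKernel E).comp (measurable_const.prodMk measurable_id)

/-- Dominated convergence with the uniform bound on the kernel; the single point `b = τ`, where
continuity in `a` is not available, is null. -/
theorem continuousAt_integral_regularKernel (h : IsTameCoord f f' f'' m C L) (E τ₀ τ : ℝ) :
    ContinuousAt (fun a => ∫ b in τ₀..τ, regularKernel E f f' a b) τ := by
  refine intervalIntegral.continuousAt_of_dominated_interval
    (bound := fun _ => C * (C * E ^ 2 / 2 / m) / m)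
    (Eventually.of_forall fun a => (h.measurable_regularKernel_right E a).aestronglyMeasurable)
    (Eventually.of_forall fun a => ae_of_all _ fun b _ => h.abs_regularKernel_le E a b)
    intervalIntegrable_const ?_
  filter_upwards [compl_mem_ae_iff.2 (measure_singleton τ)] with b hb _
  exact h.continuousAt_regularKernel E fun he => hb he.symm

variable {h₁ h₂ : ℝ → ℝ}

/-- The window equals `1` on `[τ₀, τ]` and otherwise lives on two collars of width `δ`. A bounded
kernel gives an error `2 Q B δ`, uniform in `a`. -/
theorem exists_abs_integral_switching_sub_le (h : IsTameCoord f f' f'' m C L) (E : ℝ)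
    (H₁ : IsSwitchProfile h₁) (H₂ : IsSwitchProfile h₂) :
    ∃ D, 0 ≤ D ∧ ∀ δ τ₀ τ a : ℝ, 0 < δ → τ₀ ≤ τ →
      |(∫ b, regularKernel E f f' a b * switching h₁ h₂ δ τ₀ τ b) -
        ∫ b in τ₀..τ, regularKernel E f f' a b| ≤ D * δ := by
  obtain ⟨B, hB0, hB⟩ := exists_switching_bound H₁ H₂
  set Q := C * (C * E ^ 2 / 2 / m) / m with hQ
  have hQ0 : 0 ≤ Q := (abs_nonneg _).trans (h.abs_regularKernel_le E 0 0)
  refine ⟨2 * (Q * B), by positivity, fun δ τ₀ τ a hδ hτ => ?_⟩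
  have hm := h.measurable_regularKernel_right E a
  have hw := isWindow_switching H₁ H₂ hδ hτ
  have i1 : Integrable (fun b => regularKernel E f f' a b * switching h₁ h₂ δ τ₀ τ b) := by
    refine (((hw.continuous.integrable_of_hasCompactSupport hw.compact).abs).const_mul Q).mono'
      (hm.aestronglyMeasurable.mul hw.continuous.aestronglyMeasurable) (ae_of_all _ fun b => ?_)
    rw [norm_mul]
    exact mul_le_mul_of_nonneg_right (h.abs_regularKernel_le E a b) (abs_nonneg _)
  have i2 : Integrable ((Ioc τ₀ τ).indicator (regularKernel E f f' a)) := by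
    rw [integrable_indicator_iff measurableSet_Ioc]
    refine Measure.integrableOn_of_bounded (M := Q) (by simp) hm.aestronglyMeasurable
      (ae_of_all _ fun b => h.abs_regularKernel_le E a b)
  have hic : ∀ x y : ℝ, Integrable ((Icc x y).indicator fun _ => Q * B) := fun x y =>
    (integrable_indicator_iff measurableSet_Icc).2 (integrableOn_const (by simp))
  have hint : ∀ x : ℝ, ∫ b, (Icc x (x + δ)).indicator (fun _ => Q * B) b = Q * B * δ := fun x => by
    rw [integral_indicator measurableSet_Icc, setIntegral_const]
    simp [measureReal_def, hδ.le, mul_comm]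
  rw [intervalIntegral.integral_of_le hτ, ← integral_indicator measurableSet_Ioc,
    ← integral_sub i1 i2]
  have hle : ∀ b, ‖regularKernel E f f' a b * switching h₁ h₂ δ τ₀ τ b -
      (Ioc τ₀ τ).indicator (regularKernel E f f' a) b‖ ≤
      (Icc (τ₀ - δ) (τ₀ - δ + δ)).indicator (fun _ => Q * B) b +
        (Icc τ (τ + δ)).indicator (fun _ => Q * B) b := by
    intro b
    have hn : ∀ s : Set ℝ, 0 ≤ s.indicator (fun _ => Q * B) b :=
      fun s => indicator_nonneg (fun _ _ => by positivity) _
    have hk : |regularKernel E f f' a b * switching h₁ h₂ δ τ₀ τ b| ≤ Q * B := by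
      rw [abs_mul]
      exact mul_le_mul (h.abs_regularKernel_le E a b) (hB _ _ _ _) (abs_nonneg _) hQ0
    by_cases hb : b ∈ Ioc τ₀ τ
    · rw [indicator_of_mem hb, switching_eq_one H₁ H₂ hδ ⟨hb.1.le, hb.2⟩, mul_one, sub_self,
        norm_zero]
      exact add_nonneg (hn _) (hn _)
    · rw [indicator_of_notMem hb, sub_zero]
      by_cases hb1 : b ∈ Icc (τ₀ - δ) (τ₀ - δ + δ)
      · rw [indicator_of_mem hb1]
        exact hk.trans (le_add_of_nonneg_right (hn _))
      · by_cases hb2 : b ∈ Icc τ (τ + δ)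
        · rw [indicator_of_mem hb2]
          exact hk.trans (le_add_of_nonneg_left (hn _))
        · rw [switching_eq_zero H₁ H₂ hδ, mul_zero, norm_zero]
          · exact add_nonneg (hn _) (hn _)
          · rintro ⟨h3, h4⟩
            rcases le_or_gt b τ₀ with h5 | h5
            · exact hb1 ⟨h3, by linarith⟩
            · exact hb2 ⟨by by_contra! h6; exact hb ⟨h5, h6.le⟩, h4⟩
  rw [← Real.norm_eq_abs]
  refine (norm_integral_le_of_norm_le ((hic _ _).add (hic _ _)) (ae_of_all _ hle)).trans ?_
  simp only [Pi.add_apply]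
  rw [integral_add (hic _ _) (hic _ _), hint, hint]
  linarith

theorem integrable_regularKernel_bump (h : IsTameCoord f f' f'' m C L) (E : ℝ) {u χ χ' : ℝ → ℝ}
    {lo hi K : ℝ} (hu : IsBump u lo hi K) (hχ : IsWindow χ χ') :
    Integrable (fun z : ℝ × ℝ => regularKernel E f f' z.1 z.2 * (u z.1 * χ z.2))
      (volume.prod volume) := by
  have h1 := hu.continuous
  have h2 := hχ.continuous
  refine integrable_smul_of_bounded (h.measurable_regularKernel E)
    (fun z => h.abs_regularKernel_le E z.1 z.2) (by fun_prop) ?_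
  refine HasCompactSupport.intro (hu.hasCompactSupport.isCompact.prod hχ.compact.isCompact)
    fun z hz => ?_
  by_cases h3 : z.1 ∈ tsupport u
  · rw [image_eq_zero_of_notMem_tsupport fun h4 => hz ⟨h3, h4⟩, mul_zero]
  · rw [image_eq_zero_of_notMem_tsupport h3, zero_mul]

/-- Symmetry of the kernel makes the two terms equal; Fubini turns each into an average over the
bump. -/
theorem integral_regularKernel_symm (h : IsTameCoord f f' f'' m C L) (E : ℝ) {u χ χ' : ℝ → ℝ}
    {lo hi K : ℝ} (hu : IsBump u lo hi K) (hχ : IsWindow χ χ') :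
    ∫ z : ℝ × ℝ, regularKernel E f f' z.1 z.2 * (u z.1 * χ z.2 + χ z.1 * u z.2)
      ∂(volume.prod volume) = 2 * ∫ a, (∫ b, regularKernel E f f' a b * χ b) * u a := by
  have i1 := h.integrable_regularKernel_bump E hu hχ
  have hsw : ∀ z : ℝ × ℝ, regularKernel E f f' z.1 z.2 * (χ z.1 * u z.2) =
      (fun z : ℝ × ℝ => regularKernel E f f' z.1 z.2 * (u z.1 * χ z.2)) z.swap := fun z => by
    simp only [Prod.fst_swap, Prod.snd_swap]
    rw [regularKernel_comm, mul_comm (χ z.1)]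
  have i2 : Integrable (fun z : ℝ × ℝ => regularKernel E f f' z.1 z.2 * (χ z.1 * u z.2))
      (volume.prod volume) := by
    simp only [hsw]; exact i1.swap
  have e : ∫ z : ℝ × ℝ, regularKernel E f f' z.1 z.2 * (χ z.1 * u z.2) ∂(volume.prod volume) =
      ∫ z : ℝ × ℝ, regularKernel E f f' z.1 z.2 * (u z.1 * χ z.2) ∂(volume.prod volume) := by
    simp only [hsw]
    exact integral_prod_swap (μ := (volume : Measure ℝ)) (ν := (volume : Measure ℝ))
      (fun z : ℝ × ℝ => regularKernel E f f' z.1 z.2 * (u z.1 * χ z.2))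
  simp only [mul_add]
  rw [integral_add i1 i2, e, ← two_mul, integral_prod _ i1]
  congr 2 with a
  rw [← integral_mul_const]
  congr 1 with b
  ring

/-- Two errors, each at most half of `e / (K + 1)`: replacing the window by the sharp interval, and
moving `a` to `τ` in the sharp integral. -/
theorem tendsto_integral_regularKernel (h : IsTameCoord f f' f'' m C L) (E : ℝ)
    (H₁ : IsSwitchProfile h₁) (H₂ : IsSwitchProfile h₂) {τ₀ τ : ℝ} (hτ : τ₀ ≤ τ) :
    Tendsto (fun δ => ∫ a, (∫ b, regularKernel E f f' a b * switching h₁ h₂ δ τ₀ τ b) *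
      offBump h₂ δ (a - τ)) (𝓝[>] 0) (𝓝 (∫ b in τ₀..τ, regularKernel E f f' τ b)) := by
  obtain ⟨D, hD0, hD⟩ := h.exists_abs_integral_switching_sub_le E H₁ H₂
  rw [Metric.tendsto_nhds]
  intro e he
  set K := ∫ x, |deriv h₂ x|
  have hK : 0 ≤ K := integral_nonneg fun _ => abs_nonneg _
  have he' : 0 < e / (K + 1) := by positivity
  obtain ⟨d, hd, hcont⟩ := Metric.continuousAt_iff.1
    (h.continuousAt_integral_regularKernel E τ₀ τ) (e / (K + 1) / 2) (by positivity)
  have hd2 : 0 < min d (e / (K + 1) / 2 / (D + 1)) := lt_min hd (by positivity)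
  filter_upwards [Ioo_mem_nhdsGT hd2] with δ hδ
  have hδ0 : 0 < δ := hδ.1
  have hw := isWindow_switching H₁ H₂ hδ0 hτ
  have hmeas : AEStronglyMeasurable
      (fun a => ∫ b, regularKernel E f f' a b * switching h₁ h₂ δ τ₀ τ b) := by
    have : StronglyMeasurable (Function.uncurry fun a b =>
        regularKernel E f f' a b * switching h₁ h₂ δ τ₀ τ b) := by
      refine Measurable.stronglyMeasurable ?_
      exact (h.measurable_regularKernel E).mul (hw.continuous.measurable.comp measurable_snd)
    exact this.integral_prod_right.aestronglyMeasurable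
  have hb := (isBump_offBump_sub H₂ hδ0 τ).abs_integral_sub_le
    (l := ∫ b in τ₀..τ, regularKernel E f f' τ b) hmeas he'.le (fun a ha => by
      have h1 := hD δ τ₀ τ a hδ0 hτ
      have h2 : dist a τ < d := by
        rw [Real.dist_eq, abs_lt]
        have := hδ.2.trans_le (min_le_left _ _)
        constructor <;> linarith [ha.1, ha.2]
      have h3 := hcont h2
      rw [Real.dist_eq] at h3
      have h4 : D * δ ≤ e / (K + 1) / 2 := by
        have := hδ.2.trans_le (min_le_right _ _)
        rw [lt_div_iff₀ (by positivity)] at this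
        nlinarith
      have := _root_.abs_sub_le (∫ b, regularKernel E f f' a b * switching h₁ h₂ δ τ₀ τ b)
        (∫ b in τ₀..τ, regularKernel E f f' a b) (∫ b in τ₀..τ, regularKernel E f f' τ b)
      linarith)
  rw [Real.dist_eq]
  refine hb.trans_lt ?_
  rw [div_mul_eq_mul_div, div_lt_iff₀ (by positivity)]
  nlinarith

/-- For a logarithmic kernel, the switch-off derivative of the response exists and has the
sharp-switching limit `coordRate`. -/
theorem exists_hasDerivAt_logResponse (h : IsTameCoord f f' f'' m C L) (E : ℝ)
    (H₁ : IsSwitchProfile h₁) (H₂ : IsSwitchProfile h₂) {τ₀ τ : ℝ} (hτ : τ₀ < τ) :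
    ∃ D : ℝ → ℝ, (∀ δ, 0 < δ → HasDerivAt (fun t => logResponse E f f'
        (switching h₁ h₂ δ τ₀ t) (fun u => onBump h₁ δ τ₀ u - offBump h₂ δ (u - t))) (D δ) τ) ∧
      Tendsto D (𝓝[>] 0) (𝓝 (coordRate E f f' f'' τ₀ τ)) := by
  -- The `1` is the derivative of `∫ χ²`. The `0` is that of the energy of the switch-on bump with
  -- itself, which does not depend on the switch-off time.
  refine ⟨fun δ => Real.pi * E * 1 + (0 - 2 * (∫ z : ℝ × ℝ, f' (z.2 + τ) / (f (z.2 + τ) - f z.1) *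
        (onBump h₁ δ τ₀ z.1 * offBump h₂ δ z.2) ∂(volume.prod volume)) +
      ∫ z : ℝ × ℝ, (f' (z.1 + τ) - f' (z.2 + τ)) / (f (z.1 + τ) - f (z.2 + τ)) *
        (offBump h₂ δ z.1 * offBump h₂ δ z.2) ∂(volume.prod volume)) +
      2 * ∫ a, (∫ b, regularKernel E f f' a b * switching h₁ h₂ δ τ₀ τ b) *
        offBump h₂ δ (a - τ), fun δ hδ => ?_, ?_⟩
  · have hα := isBump_onBump H₁ hδ τ₀
    have hρ := isBump_offBump H₂ hδ
    have hw := isWindow_switching H₁ H₂ hδ hτ.le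
    unfold logResponse
    refine HasDerivAt.add (HasDerivAt.add ?_ ?_) ?_
    · exact (hasDerivAt_integral_switching_sq H₁ H₂ hδ hτ).const_mul _
    · simp only [h.integral_log_mul_sub hα hρ]
      exact ((hasDerivAt_const τ _).sub
        ((h.hasDerivAt_integral_log_cross hα hρ hτ).const_mul 2)).add
          (h.hasDerivAt_integral_log_diag hρ)
    · rw [← h.integral_regularKernel_symm E (isBump_offBump_sub H₂ hδ τ) hw]
      exact hasDerivAt_integral_switching_mul H₁ H₂ hδ hτ (h.measurable_regularKernel E)
        (fun z => h.abs_regularKernel_le E z.1 z.2)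
  · have hf := h.continuous
    have hf' := h.continuous_deriv
    have hmf := hf.measurable
    have hmf' := hf'.measurable
    have hα : ∀ δ, 0 < δ → IsBump (onBump h₁ δ τ₀) (τ₀ - δ) (τ₀ + δ) (∫ x, |deriv h₁ x|) :=
      fun δ hδ => (isBump_onBump H₁ hδ τ₀).mono le_rfl (by linarith)
    have hρ : ∀ δ, 0 < δ → IsBump (offBump h₂ δ) (0 - δ) (0 + δ) (∫ x, |deriv h₂ x|) :=
      fun δ hδ => (isBump_offBump H₂ hδ).mono (by linarith) (by linarith)
    have t1 : Tendsto (fun δ => ∫ z : ℝ × ℝ, f' (z.2 + τ) / (f (z.2 + τ) - f z.1) *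
        (onBump h₁ δ τ₀ z.1 * offBump h₂ δ z.2) ∂(volume.prod volume)) (𝓝[>] 0)
        (𝓝 (f' τ / (f τ - f τ₀))) := by
      refine IsBump.tendsto_integral_prod hα hρ (by fun_prop) ?_
      have hca : ContinuousAt (fun z : ℝ × ℝ => f' (z.2 + τ) / (f (z.2 + τ) - f z.1)) (τ₀, 0) := by
        refine ContinuousAt.div (by fun_prop) (by fun_prop) (h.sub_ne_zero ?_)
        simpa using hτ.ne'
      have := hca.tendsto
      simp only [zero_add] at this
      exact this.mono_left inf_le_left
    have t2 := IsBump.tendsto_integral_prod hρ hρ (by fun_prop) (h.tendsto_deriv_sub_div τ)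
    have t3 := h.tendsto_integral_regularKernel E H₁ H₂ hτ.le
    have := ((tendsto_const_nhds (x := Real.pi * E * 1)).add
      (((tendsto_const_nhds (x := (0 : ℝ))).sub (t1.const_mul 2)).add t2)).add (t3.const_mul 2)
    have e : coordRate E f f' f'' τ₀ τ = Real.pi * E * 1 +
        (0 - 2 * (f' τ / (f τ - f τ₀)) + f'' τ / f' τ) +
        2 * ∫ b in τ₀..τ, regularKernel E f f' τ b := by
      unfold coordRate; ring
    rw [e]
    exact this

end IsTameCoord

/-! ### Localisation to a compact stretch of the trajectory -/

/-- A smooth increasing function on an open interval agrees on a compact subinterval with a tame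
coordinate. -/
theorem exists_isTameCoord_extension {J : Set ℝ} (hJ : IsOpen J) (hoc : J.OrdConnected)
    {f : ℝ → ℝ} (hf : ContDiffOn ℝ ∞ f J) (hpos : ∀ x ∈ J, 0 < deriv f x) {α β : ℝ} (hαβ : α < β)
    (hα : α ∈ J) (hβ : β ∈ J) :
    ∃ (g g' g'' : ℝ → ℝ) (m C L : ℝ), IsTameCoord g g' g'' m C L ∧
      (∀ x ∈ Icc α β, g x = f x) ∧ (∀ x ∈ Icc α β, g' x = deriv f x) ∧
      ∀ x ∈ Ioo α β, g'' x = deriv (deriv f) x := by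
  obtain ⟨η, hη, hηα, hηβ⟩ : ∃ η > 0, α - η ∈ J ∧ β + η ∈ J := by
    obtain ⟨d1, hd1, hb1⟩ := Metric.isOpen_iff.1 hJ α hα
    obtain ⟨d2, hd2, hb2⟩ := Metric.isOpen_iff.1 hJ β hβ
    have hmin : 0 < min d1 d2 := lt_min hd1 hd2
    refine ⟨min d1 d2 / 2, by positivity, hb1 ?_, hb2 ?_⟩
    · rw [Metric.mem_ball, Real.dist_eq, abs_lt]
      constructor <;> linarith [min_le_left d1 d2]
    · rw [Metric.mem_ball, Real.dist_eq, abs_lt]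
      constructor <;> linarith [min_le_right d1 d2]
  let κ : ContDiffBump ((α + β) / 2) := ⟨(β - α) / 2, (β - α) / 2 + η, by linarith, by linarith⟩
  set K : Set ℝ := Icc (α - η) (β + η) with hKdef
  have hKJ : K ⊆ J := hoc.out hηα hηβ
  have hKts : tsupport κ = K := by
    rw [κ.tsupport_eq, Real.closedBall_eq_Icc, hKdef]
    congr 1 <;> simp only [κ] <;> ring
  have hκ1 : ∀ x ∈ Icc α β, κ x = 1 := by
    intro x hx
    refine κ.one_of_mem_closedBall ?_
    rw [Real.closedBall_eq_Icc]
    exact ⟨by simp only [κ]; linarith [hx.1], by simp only [κ]; linarith [hx.2]⟩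
  have hκ0 : ∀ x ∉ K, κ x = 0 := fun x hx => image_eq_zero_of_notMem_tsupport (hKts ▸ hx)
  have hKc : IsCompact K := isCompact_Icc
  have hKne : K.Nonempty := ⟨α, by constructor <;> linarith⟩
  -- A convex combination of `1` and `deriv f`, hence positive on `K`. It is `1` outside the compact
  -- `K`, so global bounds follow from bounds on `K`.
  set g' : ℝ → ℝ := fun x => 1 + κ x * (deriv f x - 1) with hg'
  have hloc : ∀ x ∉ K, g' =ᶠ[𝓝 x] fun _ => 1 := by
    intro x hx
    filter_upwards [hKc.isClosed.isOpen_compl.mem_nhds hx] with y hy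
    simp [hg', hκ0 y hy]
  have hcd : ContDiff ℝ 1 g' := by
    rw [contDiff_iff_contDiffAt]
    intro x
    by_cases hx : x ∈ J
    · have h1 : ContDiffOn ℝ 1 (deriv f) J := hf.deriv_of_isOpen hJ (by
        rw [one_add_one_eq_two]; exact WithTop.coe_le_coe.2 le_top)
      exact contDiffAt_const.add (κ.contDiffAt.mul
        ((h1.contDiffAt (hJ.mem_nhds hx)).sub contDiffAt_const))
    · exact contDiffAt_const.congr_of_eventuallyEq (hloc x fun h => hx (hKJ h))
  have hg'c : Continuous g' := hcd.continuous
  have hg'd : ∀ x, HasDerivAt g' (deriv g' x) x := fun x =>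
    (hcd.differentiable one_ne_zero x).hasDerivAt
  have hg''c : Continuous (deriv g') := hcd.continuous_deriv le_rfl
  have hg'pos : ∀ x, 0 < g' x := by
    intro x
    by_cases hx : x ∈ K
    · have h1 := hpos x (hKJ hx)
      have h2 := κ.nonneg (x := x)
      have h3 := κ.le_one (x := x)
      have : g' x = (1 - κ x) + κ x * deriv f x := by simp only [hg']; ring
      rw [this]
      rcases h3.lt_or_eq with h4 | h4
      · nlinarith [mul_nonneg h2 h1.le]
      · rw [h4]; linarith
    · rw [(hloc x hx).eq_of_nhds]; exact one_pos
  have heq : ∀ x ∈ Icc α β, g' x = deriv f x := fun x hx => by simp [hg', hκ1 x hx]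
  obtain ⟨x₀, -, hx₀⟩ := hKc.exists_isMinOn hKne hg'c.continuousOn
  obtain ⟨C, hC⟩ := hKc.exists_bound_of_continuousOn hg'c.continuousOn
  obtain ⟨L, hL⟩ := hKc.exists_bound_of_continuousOn hg''c.continuousOn
  have hfd : ∀ x ∈ J, HasDerivAt f (deriv f x) x := fun x hx =>
    ((hf.differentiableOn (by simp)).differentiableAt (hJ.mem_nhds hx)).hasDerivAt
  refine ⟨fun x => f α + ∫ y in α..x, g' y, g', deriv g', min (g' x₀) 1, max C 1, max L 0,
    ⟨lt_min (hg'pos x₀) one_pos, fun x => ?_, hg'd, fun x => ?_, fun x => ?_, fun x => ?_, hg''c⟩,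
    fun x hx => ?_, heq, fun x hx => ?_⟩
  · exact ((hg'c.integral_hasStrictDerivAt α x).hasDerivAt).const_add (f α)
  · by_cases hx : x ∈ K
    · exact (min_le_left _ _).trans (hx₀ hx)
    · rw [(hloc x hx).eq_of_nhds]; exact min_le_right _ _
  · by_cases hx : x ∈ K
    · exact (le_abs_self _).trans ((hC x hx).trans (le_max_left _ _))
    · rw [(hloc x hx).eq_of_nhds]; exact le_max_right _ _
  · by_cases hx : x ∈ K
    · exact (hL x hx).trans (le_max_left _ _)
    · rw [(hloc x hx).deriv_eq, deriv_const, abs_zero]; exact le_max_right _ _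
  · have hsub : ∀ y ∈ uIcc α x, y ∈ Icc α β := by
      intro y hy
      rw [uIcc_of_le hx.1] at hy
      exact ⟨hy.1, hy.2.trans hx.2⟩
    have h1 := intervalIntegral.integral_eq_sub_of_hasDerivAt (f := f) (f' := g') (a := α) (b := x)
      (fun y hy => by
        rw [heq y (hsub y hy)]
        exact hfd y (hoc.out hα hβ (hsub y hy))) (hg'c.intervalIntegrable _ _)
    simp only [h1]
    ring
  · have : g' =ᶠ[𝓝 x] deriv f := by
      filter_upwards [Icc_mem_nhds hx.1 hx.2] with y hy using heq y hy
    exact this.deriv_eq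

theorem coordRate_congr (E : ℝ) {f f' f'' g g' g'' : ℝ → ℝ} {τ₀ τ : ℝ} (hτ : τ₀ ≤ τ)
    (h0 : ∀ x ∈ Icc τ₀ τ, g x = f x) (h1 : ∀ x ∈ Icc τ₀ τ, g' x = f' x) (h2 : g'' τ = f'' τ) :
    coordRate E g g' g'' τ₀ τ = coordRate E f f' f'' τ₀ τ := by
  have m1 : τ ∈ Icc τ₀ τ := ⟨hτ, le_rfl⟩
  have m0 : τ₀ ∈ Icc τ₀ τ := ⟨le_rfl, hτ⟩
  unfold coordRate
  rw [h0 _ m1, h0 _ m0, h1 _ m1, h2]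
  congr 2
  refine intervalIntegral.integral_congr fun b hb => ?_
  rw [uIcc_of_le hτ] at hb
  simp only [regularKernel]
  rw [h0 _ m1, h1 _ m1, h0 _ hb, h1 _ hb]

/-- The test function is supported in `S × S`, so only the values of the kernel there matter. This
allows a coordinate to be exchanged for its tame extension. -/
theorem response_congr {W W' : ℝ → ℝ → ℂ} {S : Set ℝ} (hW : ∀ a ∈ S, ∀ b ∈ S, W a b = W' a b)
    {χ χ' : ℝ → ℝ} (hχ : IsWindow χ χ') (hS : ∀ x ∉ S, χ x = 0 ∧ χ' x = 0) (E : ℝ) :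
    response W E χ = response W' E χ := by
  unfold response
  simp only [hχ.deriv_deriv_test]
  congr 1 with a
  congr 1 with b
  by_cases ha : a ∈ S
  · by_cases hb : b ∈ S
    · rw [hW a ha b hb]
    · rw [IsWindow.phaseDeriv_eq_zero E (hS b hb)]; simp
  · rw [IsWindow.phaseDeriv_eq_zero (-E) (hS a ha)]; simp

/-- Sharp-switching transition rate along a trajectory with increasing null coordinates `f`,
`g`. -/
theorem isTransitionRate_of_coords {J : Set ℝ} (hJ : IsOpen J) (hoc : J.OrdConnected)
    {f g : ℝ → ℝ} (hf : ContDiffOn ℝ ∞ f J) (hg : ContDiffOn ℝ ∞ g J)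
    (hf' : ∀ x ∈ J, 0 < deriv f x) (hg' : ∀ x ∈ J, 0 < deriv g x) (E c : ℝ) {τ₀ τ : ℝ}
    (hτ : τ₀ < τ) (h0 : τ₀ ∈ J) (h1 : τ ∈ J) :
    IsTransitionRate (fun a b => -(1 / (4 * (Real.pi : ℂ))) *
      (Complex.log (Complex.I * ((f a - f b : ℝ) : ℂ)) +
        Complex.log (Complex.I * ((g a - g b : ℝ) : ℂ))) + (c : ℂ)) E τ₀ τ
      (-(1 / (4 * Real.pi)) * (coordRate E f (deriv f) (deriv (deriv f)) τ₀ τ +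
        coordRate E g (deriv g) (deriv (deriv g)) τ₀ τ)) := by
  intro h₁ h₂ H₁ H₂
  obtain ⟨η, hη, hηα, hηβ⟩ : ∃ η > 0, τ₀ - η ∈ J ∧ τ + η ∈ J := by
    obtain ⟨d1, hd1, hb1⟩ := Metric.isOpen_iff.1 hJ τ₀ h0
    obtain ⟨d2, hd2, hb2⟩ := Metric.isOpen_iff.1 hJ τ h1
    have hmin : 0 < min d1 d2 := lt_min hd1 hd2
    refine ⟨min d1 d2 / 2, by positivity, hb1 ?_, hb2 ?_⟩
    · rw [Metric.mem_ball, Real.dist_eq, abs_lt]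
      constructor <;> linarith [min_le_left d1 d2]
    · rw [Metric.mem_ball, Real.dist_eq, abs_lt]
      constructor <;> linarith [min_le_right d1 d2]
  have hlt : τ₀ - η < τ + η := by linarith
  obtain ⟨F, F', F'', m, C, L, hF, F0, F1, F2⟩ :=
    exists_isTameCoord_extension hJ hoc hf hf' hlt hηα hηβ
  obtain ⟨G, G', G'', m', C', L', hG, G0, G1, G2⟩ :=
    exists_isTameCoord_extension hJ hoc hg hg' hlt hηα hηβ
  obtain ⟨D₁, hD₁, T₁⟩ := hF.exists_hasDerivAt_logResponse E H₁ H₂ hτ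
  obtain ⟨D₂, hD₂, T₂⟩ := hG.exists_hasDerivAt_logResponse E H₁ H₂ hτ
  have hsub : ∀ x ∈ Icc τ₀ τ, x ∈ Icc (τ₀ - η) (τ + η) := fun x hx =>
    ⟨by linarith [hx.1], by linarith [hx.2]⟩
  have hmem : τ ∈ Ioo (τ₀ - η) (τ + η) := ⟨by linarith, by linarith⟩
  rw [coordRate_congr E hτ.le (fun x hx => F0 x (hsub x hx)) (fun x hx => F1 x (hsub x hx))
    (F2 τ hmem)] at T₁
  rw [coordRate_congr E hτ.le (fun x hx => G0 x (hsub x hx)) (fun x hx => G1 x (hsub x hx))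
    (G2 τ hmem)] at T₂
  refine ⟨fun δ => ((-(1 / (4 * Real.pi)) * (D₁ δ + D₂ δ) : ℝ) : ℂ), ?_, ?_⟩
  · have hη2 : 0 < η / 2 := by positivity
    filter_upwards [Ioo_mem_nhdsGT hη2] with δ hδ
    have hd := ((hD₁ δ hδ.1).add (hD₂ δ hδ.1)).const_mul (-(1 / (4 * Real.pi)))
    refine hd.ofReal_comp.congr_of_eventuallyEq ?_
    filter_upwards [Ioo_mem_nhds hτ (show τ < τ + η / 2 by linarith)] with t ht
    have hw := isWindow_switching H₁ H₂ hδ.1 ht.1.le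
    have hr := hF.response_eq hG hw E c
    simp only [Pi.add_apply]
    rw [← hr]
    refine response_congr (S := Icc (τ₀ - η) (τ + η)) (fun a ha b hb => ?_) hw (fun x hx => ?_) E
    · rw [F0 a ha, F0 b hb, G0 a ha, G0 b hb]
    · have h2 := hδ.2
      refine ⟨switching_eq_zero H₁ H₂ hδ.1 fun hx' => hx ⟨by linarith [hx'.1],
        by linarith [hx'.2, ht.2]⟩, ?_⟩
      rw [(isBump_onBump H₁ hδ.1 τ₀).eq_zero x fun hx' => hx ⟨by linarith [hx'.1],
        by linarith [hx'.2]⟩, (isBump_offBump_sub H₂ hδ.1 t).eq_zero x fun hx' =>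
          hx ⟨by linarith [hx'.1, ht.1], by linarith [hx'.2, ht.2]⟩, sub_zero]
  · exact (Complex.continuous_ofReal.tendsto _).comp ((T₁.add T₂).const_mul _)

/-! ### The radius function -/

theorem radius_eq_of_mul_eq (M : ℝ) {p q : ℝ × ℝ} (h : p.1 * p.2 = q.1 * q.2) :
    radius M p = radius M q := by
  unfold radius; rw [h]

theorem radius_unique {M : ℝ} {p : ℝ × ℝ} (hM : 0 < M) (hp : p.1 * p.2 < 1) {r : ℝ} (hr : 0 < r)
    (h : kruskalProduct M r = p.1 * p.2) : r = radius M p :=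
  (existsUnique_radius hM hp).unique ⟨hr, h⟩ (radius_spec hM hp)

theorem hasStrictDerivAt_kruskalProduct {M : ℝ} (hM : 0 < M) (r : ℝ) :
    HasStrictDerivAt (kruskalProduct M) (-(r / (4 * M ^ 2) * Real.exp (r / (2 * M)))) r := by
  have h1 : HasStrictDerivAt (fun r : ℝ => r / (2 * M)) (1 / (2 * M)) r :=
    (hasStrictDerivAt_id r).div_const (2 * M)
  refine ((h1.const_sub 1).mul h1.exp).congr_deriv ?_
  field_simp
  ring

/-- Inverse function theorem for `kruskalProduct`, whose derivative does not vanish at `r > 0`;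
uniqueness of the positive root identifies the local inverse. The radius depends on `U V` only, so
`V = 1` is no restriction. -/
theorem hasDerivAt_radius {M x : ℝ} (hM : 0 < M) (hx : x < 1) :
    HasDerivAt (fun x => radius M (x, 1))
      (-(4 * M ^ 2 / (radius M (x, 1) * Real.exp (radius M (x, 1) / (2 * M))))) x := by
  obtain ⟨hr, hk⟩ := radius_spec hM (p := (x, 1)) (by simpa using hx)
  simp only [mul_one] at hk
  set r := radius M (x, 1) with hrdef
  have hs := hasStrictDerivAt_kruskalProduct hM r
  have hne : -(r / (4 * M ^ 2) * Real.exp (r / (2 * M))) ≠ 0 := by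
    have : 0 < r / (4 * M ^ 2) * Real.exp (r / (2 * M)) := by positivity
    linarith
  have hd := (hs.to_localInverse hne).hasDerivAt
  have hr1 := hs.eventually_right_inverse hne
  have hval : hs.localInverse _ _ _ hne (kruskalProduct M r) = r :=
    HasStrictFDerivAt.localInverse_apply_image _
  have hc := hd.continuousAt
  rw [hk] at hd hr1 hc hval
  have hpos : ∀ᶠ y in 𝓝 x, 0 < hs.localInverse _ _ _ hne y :=
    hc.eventually_const_lt (by rw [hval]; exact hr)
  have heq : (fun x => radius M (x, 1)) =ᶠ[𝓝 x] hs.localInverse _ _ _ hne := by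
    filter_upwards [hpos, hr1, Iio_mem_nhds hx] with y h1 h2 h3
    exact (radius_unique hM (p := (y, 1)) (by simpa using h3) h1 (by simpa using h2)).symm
  refine (hd.congr_of_eventuallyEq heq).congr_deriv ?_
  have he := Real.exp_pos (r / (2 * M))
  field_simp

/-- The function `∂_U log f / V = ∂_V log f / U`. -/
noncomputable def logFactorDeriv (M : ℝ) (p : ℝ × ℝ) : ℝ :=
  (1 / radius M p + 1 / (2 * M)) *
    (4 * M ^ 2 / (radius M p * Real.exp (radius M p / (2 * M))))

theorem logFactorDeriv_pos {M : ℝ} {p : ℝ × ℝ} (hM : 0 < M) (hp : p.1 * p.2 < 1) :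
    0 < logFactorDeriv M p := by
  have := (radius_spec hM hp).1
  unfold logFactorDeriv
  positivity

theorem conformalFactor_pos {M : ℝ} {p : ℝ × ℝ} (hM : 0 < M) (hp : p.1 * p.2 < 1) :
    0 < conformalFactor M p := by
  have := (radius_spec hM hp).1
  unfold conformalFactor
  positivity

theorem conformalFactor_eq_of_mul_eq (M : ℝ) {p q : ℝ × ℝ} (h : p.1 * p.2 = q.1 * q.2) :
    conformalFactor M p = conformalFactor M q := by
  unfold conformalFactor; rw [radius_eq_of_mul_eq M h]

theorem hasDerivAt_log_conformalFactor {M x : ℝ} (hM : 0 < M) (hx : x < 1) :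
    HasDerivAt (fun x => Real.log (conformalFactor M (x, 1))) (logFactorDeriv M (x, 1)) x := by
  have hp : ((x, 1) : ℝ × ℝ).1 * ((x, 1) : ℝ × ℝ).2 < 1 := by simpa using hx
  have hr := (radius_spec hM hp).1
  have hd := hasDerivAt_radius hM hx
  have h1 := (hasDerivAt_const x (32 * M ^ 3)).div hd hr.ne'
  have h2 := ((hd.div_const (2 * M)).neg).exp
  have h3 := (h1.mul h2).log (conformalFactor_pos hM hp).ne'
  refine h3.congr_deriv ?_
  unfold logFactorDeriv
  simp only [Pi.mul_apply, Pi.div_apply, Pi.neg_apply]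
  set r := radius M (x, 1)
  have he := Real.exp_pos (-(r / (2 * M)))
  have he' := Real.exp_pos (r / (2 * M))
  field_simp
  ring

/-- The conformal factor depends on `U V` only, so `∂_U` is `V` times the derivative in the product.
With `logFactorDeriv_pos`, the symbol has the sign of `V`. -/
theorem christoffelU_eq {M : ℝ} {p : ℝ × ℝ} (hM : 0 < M) (hp : p.1 * p.2 < 1) :
    christoffelU M p = logFactorDeriv M p * p.2 := by
  have h := hasDerivAt_log_conformalFactor hM hp
  have h2 := h.comp p.1 ((hasDerivAt_id p.1).mul_const p.2)
  have e : (fun u => Real.log (conformalFactor M (u, p.2))) =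
      (fun x => Real.log (conformalFactor M (x, 1))) ∘ fun u => id u * p.2 := by
    funext u
    simp only [Function.comp, id]
    rw [conformalFactor_eq_of_mul_eq M (p := (u, p.2)) (q := (u * p.2, 1)) (by simp)]
  unfold christoffelU
  rw [e, h2.deriv]
  unfold logFactorDeriv
  rw [radius_eq_of_mul_eq M (p := (p.1 * p.2, 1)) (q := p) (by simp), one_mul]

theorem christoffelV_eq {M : ℝ} {p : ℝ × ℝ} (hM : 0 < M) (hp : p.1 * p.2 < 1) :
    christoffelV M p = logFactorDeriv M p * p.1 := by
  have h := hasDerivAt_log_conformalFactor hM hp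
  have h2 := h.comp p.2 ((hasDerivAt_id p.2).const_mul p.1)
  have e : (fun v => Real.log (conformalFactor M (p.1, v))) =
      (fun x => Real.log (conformalFactor M (x, 1))) ∘ fun v => p.1 * id v := by
    funext v
    simp only [Function.comp, id]
    rw [conformalFactor_eq_of_mul_eq M (p := (p.1, v)) (q := (p.1 * v, 1)) (by simp)]
  unfold christoffelV
  rw [e]
  refine h2.deriv.trans ?_
  unfold logFactorDeriv
  rw [radius_eq_of_mul_eq M (p := (p.1 * p.2, 1)) (q := p) (by simp), mul_one]

/-! ### Infalling geodesics -/

namespace IsInfallingGeodesic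

variable {M ε τs : ℝ} {J : Set ℝ} {γ : ℝ → ℝ × ℝ}

theorem lt_end (h : IsInfallingGeodesic M ε J τs γ) {τ : ℝ} (hτ : τ ∈ J) : τ < τs := by
  refine lt_of_le_of_ne (h.isLUB.1 hτ) ?_
  rintro rfl
  obtain ⟨d, hd, hb⟩ := Metric.isOpen_iff.1 h.isOpen τ hτ
  have : τ + d / 2 ∈ J := hb (by
    rw [Metric.mem_ball, Real.dist_eq, abs_lt]; constructor <;> linarith)
  linarith [h.isLUB.1 this]

theorem Ico_subset (h : IsInfallingGeodesic M ε J τs γ) {τ : ℝ} (hτ : τ ∈ J) : Ico τ τs ⊆ J := by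
  intro t ht
  obtain ⟨j, hj, htj⟩ := (lt_isLUB_iff h.isLUB).1 ht.2
  exact h.ordConnected.out hτ hj ⟨ht.1, htj.le⟩

theorem mem_nhdsLT (h : IsInfallingGeodesic M ε J τs γ) {τ : ℝ} (hτ : τ ∈ J) :
    Ico τ τs ∈ 𝓝[<] τs := Ico_mem_nhdsLT (h.lt_end hτ)

theorem hasDerivAt (h : IsInfallingGeodesic M ε J τs γ) {τ : ℝ} (hτ : τ ∈ J) :
    HasDerivAt γ (deriv γ τ) τ :=
  ((h.smooth.differentiableOn (by simp)).differentiableAt (h.isOpen.mem_nhds hτ)).hasDerivAt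

theorem hasDerivAt_deriv (h : IsInfallingGeodesic M ε J τs γ) {τ : ℝ} (hτ : τ ∈ J) :
    HasDerivAt (deriv γ) (deriv (deriv γ) τ) τ := by
  have h1 : ContDiffOn ℝ 1 (deriv γ) J := h.smooth.deriv_of_isOpen h.isOpen (by
    rw [one_add_one_eq_two]; exact WithTop.coe_le_coe.2 le_top)
  exact ((h1.differentiableOn (by simp)).differentiableAt (h.isOpen.mem_nhds hτ)).hasDerivAt

theorem _root_.HasDerivAt.fst_curve {γ : ℝ → ℝ × ℝ} {γ' : ℝ × ℝ} {τ : ℝ}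
    (h : HasDerivAt γ γ' τ) : HasDerivAt (fun t => (γ t).1) γ'.1 τ :=
  (ContinuousLinearMap.fst ℝ ℝ ℝ).hasFDerivAt.comp_hasDerivAt τ h

theorem _root_.HasDerivAt.snd_curve {γ : ℝ → ℝ × ℝ} {γ' : ℝ × ℝ} {τ : ℝ}
    (h : HasDerivAt γ γ' τ) : HasDerivAt (fun t => (γ t).2) γ'.2 τ :=
  (ContinuousLinearMap.snd ℝ ℝ ℝ).hasFDerivAt.comp_hasDerivAt τ h

theorem radius_pos (h : IsInfallingGeodesic M ε J τs γ) (hM : 0 < M) {τ : ℝ} (hτ : τ ∈ J) :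
    0 < radius M (γ τ) := (radius_spec hM (h.mem_kruskal τ hτ)).1

theorem product_eq (h : IsInfallingGeodesic M ε J τs γ) (hM : 0 < M) {τ : ℝ} (hτ : τ ∈ J) :
    (γ τ).1 * (γ τ).2 = (1 - radius M (γ τ) / (2 * M)) * Real.exp (radius M (γ τ) / (2 * M)) :=
  (radius_spec hM (h.mem_kruskal τ hτ)).2.symm

theorem velocity_mul (h : IsInfallingGeodesic M ε J τs γ) (hM : 0 < M) {τ : ℝ} (hτ : τ ∈ J) :
    (deriv γ τ).1 * (deriv γ τ).2 =
      radius M (γ τ) * Real.exp (radius M (γ τ) / (2 * M)) / (32 * M ^ 3) := by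
  have h1 := h.unit_speed τ hτ
  have hr := h.radius_pos hM hτ
  simp only [metric, conformalFactor, Real.exp_neg] at h1
  have he := Real.exp_pos (radius M (γ τ) / (2 * M))
  generalize Real.exp (radius M (γ τ) / (2 * M)) = e at *
  generalize radius M (γ τ) = r at *
  field_simp at h1 ⊢
  linarith

theorem energy_eq (h : IsInfallingGeodesic M ε J τs γ) (hM : 0 < M) {τ : ℝ} (hτ : τ ∈ J) :
    (γ τ).2 * (deriv γ τ).1 - (γ τ).1 * (deriv γ τ).2 =
      ε * (radius M (γ τ) * Real.exp (radius M (γ τ) / (2 * M))) / (4 * M ^ 2) := by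
  have h1 := h.energy τ hτ
  have hr := h.radius_pos hM hτ
  simp only [metric, conformalFactor, killing, Real.exp_neg] at h1
  have he := Real.exp_pos (radius M (γ τ) / (2 * M))
  generalize Real.exp (radius M (γ τ) / (2 * M)) = e at *
  generalize radius M (γ τ) = r at *
  field_simp at h1 ⊢
  linarith

/-- The derivative of `U V` along the trajectory. -/
theorem hasDerivAt_product (h : IsInfallingGeodesic M ε J τs γ) {τ : ℝ} (hτ : τ ∈ J) :
    HasDerivAt (fun t => (γ t).1 * (γ t).2)
      ((deriv γ τ).1 * (γ τ).2 + (γ τ).1 * (deriv γ τ).2) τ :=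
  (h.hasDerivAt hτ).fst_curve.mul (h.hasDerivAt hτ).snd_curve

theorem hasDerivAt_radius (h : IsInfallingGeodesic M ε J τs γ) (hM : 0 < M) {τ : ℝ}
    (hτ : τ ∈ J) : HasDerivAt (fun t => radius M (γ t))
      (-(4 * M ^ 2 / (radius M (γ τ) * Real.exp (radius M (γ τ) / (2 * M)))) *
        ((deriv γ τ).1 * (γ τ).2 + (γ τ).1 * (deriv γ τ).2)) τ := by
  have h1 := (SchwarzschildDetector.hasDerivAt_radius hM (h.mem_kruskal τ hτ)).comp τ
    (h.hasDerivAt_product hτ)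
  have e : (fun t => radius M (γ t)) =
      (fun x => radius M (x, 1)) ∘ fun t => (γ t).1 * (γ t).2 := by
    funext t
    exact radius_eq_of_mul_eq M (by simp)
  rw [e]
  rwa [radius_eq_of_mul_eq M (p := ((γ τ).1 * (γ τ).2, 1)) (q := γ τ) (by simp)] at h1

/-- The radial equation `(dr/dτ)² = ε² - 1 + 2M/r`, in terms of `d(UV)/dτ`. -/
theorem radial_equation (h : IsInfallingGeodesic M ε J τs γ) (hM : 0 < M) {τ : ℝ} (hτ : τ ∈ J) :
    (4 * M ^ 2 / (radius M (γ τ) * Real.exp (radius M (γ τ) / (2 * M))) *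
        ((deriv γ τ).1 * (γ τ).2 + (γ τ).1 * (deriv γ τ).2)) ^ 2 =
      ε ^ 2 - 1 + 2 * M / radius M (γ τ) := by
  have h1 := h.product_eq hM hτ
  have h2 := h.velocity_mul hM hτ
  have h3 := h.energy_eq hM hτ
  have hr := h.radius_pos hM hτ
  have he := Real.exp_pos (radius M (γ τ) / (2 * M))
  -- `(x + y)² = (x - y)² + 4xy` expresses the square through the energy, the radius and the unit
  -- speed.
  have key : ((deriv γ τ).1 * (γ τ).2 + (γ τ).1 * (deriv γ τ).2) ^ 2 =
      ((γ τ).2 * (deriv γ τ).1 - (γ τ).1 * (deriv γ τ).2) ^ 2 +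
      4 * ((γ τ).1 * (γ τ).2) * ((deriv γ τ).1 * (deriv γ τ).2) := by ring
  rw [mul_pow, key, h1, h2, h3]
  generalize Real.exp (radius M (γ τ) / (2 * M)) = e at *
  generalize radius M (γ τ) = r at *
  field_simp
  ring

theorem tendsto_product (h : IsInfallingGeodesic M ε J τs γ) (hM : 0 < M) {τ : ℝ} (hτ : τ ∈ J) :
    Tendsto (fun t => (γ t).1 * (γ t).2) (𝓝[<] τs) (𝓝 1) := by
  have h1 : Continuous (kruskalProduct M) := by unfold kruskalProduct; fun_prop
  have h2 := (h1.tendsto 0).comp h.hits_singularity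
  have h3 : kruskalProduct M 0 = 1 := by simp [kruskalProduct]
  rw [h3] at h2
  refine (tendsto_congr' ?_).1 h2
  filter_upwards [h.mem_nhdsLT hτ] with t ht
  exact (radius_spec hM (h.mem_kruskal t (h.Ico_subset hτ ht))).2

/-- Wherever the radial velocity cannot vanish, `U V` increases. -/
theorem product_deriv_pos (h : IsInfallingGeodesic M ε J τs γ) (hM : 0 < M) {s : Set ℝ}
    (hs : s ⊆ J) (hoc : s.OrdConnected) (hup : ∀ τ ∈ s, Ico τ τs ⊆ s)
    (hpos : ∀ τ ∈ s, 0 < ε ^ 2 - 1 + 2 * M / radius M (γ τ)) {τ : ℝ} (hτ : τ ∈ s) :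
    0 < (deriv γ τ).1 * (γ τ).2 + (γ τ).1 * (deriv γ τ).2 := by
  have hne : ∀ t ∈ s, (deriv γ t).1 * (γ t).2 + (γ t).1 * (deriv γ t).2 ≠ 0 := by
    intro t ht h0
    have := h.radial_equation hM (hs ht)
    rw [h0, mul_zero, zero_pow two_ne_zero] at this
    exact (hpos t ht).ne this
  -- By Darboux a derivative without zeros has constant sign. If it were negative, `U V` would
  -- decrease to its limit `1`, against `U V < 1`.
  rcases hasDerivWithinAt_forall_lt_or_forall_gt_of_forall_ne hoc.convex
    (fun t ht => (h.hasDerivAt_product (hs ht)).hasDerivWithinAt) hne with hneg | hgt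
  · exfalso
    have hanti : AntitoneOn (fun t => (γ t).1 * (γ t).2) s := by
      refine antitoneOn_of_deriv_nonpos hoc.convex
        (fun t ht => (h.hasDerivAt_product (hs ht)).continuousAt.continuousWithinAt)
        (fun t ht => (h.hasDerivAt_product
          (hs (interior_subset ht))).differentiableAt.differentiableWithinAt) fun t ht => ?_
      rw [(h.hasDerivAt_product (hs (interior_subset ht))).deriv]
      exact (hneg t (interior_subset ht)).le
    have hle : (1 : ℝ) ≤ (γ τ).1 * (γ τ).2 := by
      refine le_of_tendsto (h.tendsto_product hM (hs hτ)) ?_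
      filter_upwards [h.mem_nhdsLT (hs hτ)] with t ht
      exact hanti hτ (hup τ hτ ht) ht.1
    exact absurd (h.mem_kruskal τ (hs hτ)) (not_lt.2 hle)
  · exact hgt τ hτ

/-- Adding `V U' - U V' ≥ 0`, the energy condition, to `V U' + U V' > 0` gives `V U' > 0`, and `U' >
0`. -/
theorem V_pos_of_product_deriv_pos (h : IsInfallingGeodesic M ε J τs γ) (hM : 0 < M)
    (hε : 0 ≤ ε) {τ : ℝ} (hτ : τ ∈ J)
    (hpos : 0 < (deriv γ τ).1 * (γ τ).2 + (γ τ).1 * (deriv γ τ).2) : 0 < (γ τ).2 := by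
  have h1 := h.energy_eq hM hτ
  have h2 := h.radius_pos hM hτ
  have h3 : 0 ≤ ε * (radius M (γ τ) * Real.exp (radius M (γ τ) / (2 * M))) / (4 * M ^ 2) := by
    positivity
  have h4 := (h.future τ hτ).1
  by_contra! h5
  nlinarith

/-- A geodesic that is not bound has always been in the region `V > 0`. -/
theorem V_pos (h : IsInfallingGeodesic M ε J τs γ) (hM : 0 < M) (hε : 1 ≤ ε) {τ : ℝ}
    (hτ : τ ∈ J) : 0 < (γ τ).2 := by
  refine h.V_pos_of_product_deriv_pos hM (by linarith) hτ
    (h.product_deriv_pos hM subset_rfl h.ordConnected (fun t ht => h.Ico_subset ht)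
      (fun t ht => ?_) hτ)
  have h1 : 0 < 2 * M / radius M (γ t) := div_pos (by linarith) (h.radius_pos hM ht)
  nlinarith

/-- Close to the singularity, the trajectory is inside the black hole and falls inwards. -/
theorem exists_late (h : IsInfallingGeodesic M ε J τs γ) (hM : 0 < M) (hε : 0 ≤ ε)
    {τ₀ : ℝ} (h0 : τ₀ ∈ J) : ∃ τ₁ ∈ J, τ₀ < τ₁ ∧ ∀ τ ∈ Ico τ₁ τs,
      radius M (γ τ) < 2 * M ∧ 0 < (γ τ).1 ∧ 0 < (γ τ).2 ∧
      0 < (deriv γ τ).1 * (γ τ).2 + (γ τ).1 * (deriv γ τ).2 := by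
  have h1 : ∀ᶠ τ in 𝓝[<] τs, radius M (γ τ) < 2 * M :=
    h.hits_singularity.eventually_lt_const (by linarith)
  obtain ⟨l, hl, hsub⟩ := (mem_nhdsLT_iff_exists_Ioo_subset' (h.lt_end h0)).1 h1
  have hmax : max τ₀ l < τs := max_lt (h.lt_end h0) hl
  obtain ⟨τ₁, hτ₁, hτ₁'⟩ := exists_between hmax
  have hmem : τ₁ ∈ J := h.Ico_subset h0 ⟨(le_max_left _ _).trans hτ₁.le, hτ₁'⟩
  refine ⟨τ₁, hmem, (le_max_left _ _).trans_lt hτ₁, fun τ hτ => ?_⟩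
  have hr : ∀ t ∈ Ico τ₁ τs, radius M (γ t) < 2 * M := fun t ht =>
    hsub ⟨(le_max_right _ _).trans_lt (hτ₁.trans_le ht.1), ht.2⟩
  have hJ := h.Ico_subset hmem
  -- For `r < 2M` the term `2M/r > 1` outweighs `-1` whatever the energy, so the radial velocity
  -- cannot vanish.
  have hp := h.product_deriv_pos hM hJ ordConnected_Ico
    (fun t ht => Ico_subset_Ico_left ht.1) (fun t ht => by
      have h2 := h.radius_pos hM (hJ ht)
      have h3 : 1 < 2 * M / radius M (γ t) := (one_lt_div h2).2 (hr t ht)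
      nlinarith) hτ
  have hV := h.V_pos_of_product_deriv_pos hM hε (hJ hτ) hp
  refine ⟨hr τ hτ, ?_, hV, hp⟩
  have hUV : 0 < (γ τ).1 * (γ τ).2 := by
    rw [h.product_eq hM (hJ hτ)]
    refine mul_pos ?_ (Real.exp_pos _)
    rw [sub_pos, div_lt_one (by linarith)]
    exact hr τ hτ
  exact (pos_iff_pos_of_mul_pos hUV).2 hV

end IsInfallingGeodesic

/-! ### Bounds on the contribution of one null coordinate -/

/-- A smooth function with positive derivative on an open interval. -/
structure IsNullCoord (J : Set ℝ) (f : ℝ → ℝ) : Prop where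
  isOpen : IsOpen J
  ordConnected : J.OrdConnected
  smooth : ContDiffOn ℝ ∞ f J
  deriv_pos : ∀ x ∈ J, 0 < deriv f x

namespace IsNullCoord

variable {J : Set ℝ} {f : ℝ → ℝ}

theorem hasDerivAt (h : IsNullCoord J f) {x : ℝ} (hx : x ∈ J) : HasDerivAt f (deriv f x) x :=
  ((h.smooth.differentiableOn (by simp)).differentiableAt (h.isOpen.mem_nhds hx)).hasDerivAt

theorem strictMonoOn (h : IsNullCoord J f) : StrictMonoOn f J := by
  refine strictMonoOn_of_deriv_pos h.ordConnected.convex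
    (fun x hx => (h.hasDerivAt hx).continuousAt.continuousWithinAt) fun x hx => ?_
  exact h.deriv_pos x (interior_subset hx)

theorem intervalIntegrable_regularKernel (h : IsNullCoord J f) (E : ℝ) {a b τ : ℝ} (ha : a ∈ J)
    (hb : b ≤ τ) (hab : a ≤ b) (hτ : τ ∈ J) :
    IntervalIntegrable (regularKernel E f (deriv f) τ) volume a b := by
  rcases (hab.trans hb).eq_or_lt with heq | hlt
  · have : a = b := le_antisymm hab (heq ▸ hb)
    rw [this]
  obtain ⟨g, g', g'', m, C, L, hg, g0, g1, -⟩ :=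
    exists_isTameCoord_extension h.isOpen h.ordConnected h.smooth h.deriv_pos hlt ha hτ
  have h1 : IntervalIntegrable (regularKernel E g g' τ) volume a b := by
    rw [intervalIntegrable_iff]
    exact Measure.integrableOn_of_bounded (M := C * (C * E ^ 2 / 2 / m) / m) (by simp)
      (hg.measurable_regularKernel_right E τ).aestronglyMeasurable
      (ae_of_all _ fun b => hg.abs_regularKernel_le E τ b)
  refine h1.congr fun b' hb' => ?_
  rw [uIoc_of_le hab] at hb'
  have m1 : b' ∈ Icc a τ := ⟨hb'.1.le, hb'.2.trans hb⟩
  have m2 : τ ∈ Icc a τ := ⟨hlt.le, le_rfl⟩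
  simp only [regularKernel]
  rw [g0 _ m1, g0 _ m2, g1 _ m1, g1 _ m2]

/-- As `cos ≤ 1`, the integral of the kernel is monotone in the switch-on time; this drives the
limit in the infinite past. -/
theorem neg_regularKernel_nonneg (h : IsNullCoord J f) (E : ℝ) {τ b : ℝ} (hτ : τ ∈ J)
    (hb : b ∈ J) : 0 ≤ -regularKernel E f (deriv f) τ b := by
  unfold regularKernel
  rw [← neg_div, ← mul_neg]
  have := Real.cos_le_one (E * (τ - b))
  exact div_nonneg (mul_nonneg (mul_pos (h.deriv_pos τ hτ) (h.deriv_pos b hb)).le (by linarith))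
    (sq_nonneg _)

/-- The double pole is the exact derivative of the simple pole; both bounds on the regular integral
rest on this. -/
theorem hasDerivAt_quot (h : IsNullCoord J f) {τ b : ℝ} (hτ : τ ∈ J) (hb : b ∈ J) (hlt : b < τ) :
    HasDerivAt (fun b => deriv f τ / (f τ - f b))
      (deriv f τ * deriv f b / (f τ - f b) ^ 2) b := by
  have hne : f τ - f b ≠ 0 := (sub_pos.2 (h.strictMonoOn hb hτ hlt)).ne'
  refine ((hasDerivAt_const b (deriv f τ)).div ((h.hasDerivAt hb).const_sub (f τ))
    hne).congr_deriv ?_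
  ring

/-- The far part of the regular integral is controlled by its end point. -/
theorem integral_far_le (h : IsNullCoord J f) (E : ℝ) {a b τ : ℝ} (ha : a ∈ J) (hab : a ≤ b)
    (hb : b < τ) (hτ : τ ∈ J) :
    ∫ x in a..b, -regularKernel E f (deriv f) τ x ≤ 2 * (deriv f τ / (f τ - f b)) := by
  have hmem : ∀ x ∈ Icc a b, x ∈ J := fun x hx => h.ordConnected.out ha hτ ⟨hx.1, hx.2.trans hb.le⟩
  have hd : ∀ x ∈ Icc a b, HasDerivAt (fun b => 2 * (deriv f τ / (f τ - f b)))
      (2 * (deriv f τ * deriv f x / (f τ - f x) ^ 2)) x := fun x hx =>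
    (h.hasDerivAt_quot hτ (hmem x hx) (hx.2.trans_lt hb)).const_mul 2
  have hi := (h.intervalIntegrable_regularKernel E ha hb.le hab hτ).neg
  rw [intervalIntegrable_iff_integrableOn_Icc_of_le hab] at hi
  -- `1 - cos ≤ 2` bounds the integrand by the derivative of twice the quotient.
  have key := intervalIntegral.integral_le_sub_of_hasDeriv_right_of_le hab
    (fun x hx => (hd x hx).continuousAt.continuousWithinAt)
    (fun x hx => (hd x (Ioo_subset_Icc_self hx)).hasDerivWithinAt) hi (fun x hx => by
      have hx' := hmem x (Ioo_subset_Icc_self hx)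
      simp only [Pi.neg_apply, regularKernel]
      rw [← neg_div, ← mul_div_assoc]
      refine div_le_div_of_nonneg_right ?_ (sq_nonneg _)
      have h1 := Real.neg_one_le_cos (E * (τ - x))
      have h2 := mul_pos (h.deriv_pos τ hτ) (h.deriv_pos x hx')
      nlinarith)
  refine key.trans (sub_le_self _ ?_)
  have h1 := h.strictMonoOn ha hτ (hab.trans_lt hb)
  exact mul_nonneg two_pos.le (div_nonneg (h.deriv_pos τ hτ).le (sub_pos.2 h1).le)

/-- Where the velocity decreases, the near part of the regular integral is bounded. -/
theorem integral_near_le (h : IsNullCoord J f) (E : ℝ) {a τ : ℝ} (ha : a ∈ J) (hτ : τ ∈ J)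
    (haτ : a ≤ τ) (hanti : AntitoneOn (deriv f) (Icc a τ)) :
    ∫ x in a..τ, -regularKernel E f (deriv f) τ x ≤ E ^ 2 * (τ - a) := by
  have hmem : ∀ x ∈ Icc a τ, x ∈ J := fun x hx => h.ordConnected.out ha hτ hx
  have hpos := h.deriv_pos τ hτ
  -- A decreasing velocity is smallest at `τ`, so the mean value inequality applies with slope
  -- `deriv f τ`.
  have hlow : ∀ x ∈ Icc a τ, deriv f τ * (τ - x) ≤ f τ - f x := by
    intro x hx
    refine (convex_Icc x τ).mul_sub_le_image_sub_of_le_deriv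
      (fun y hy => (h.hasDerivAt (hmem y ⟨hx.1.trans hy.1, hy.2⟩)).continuousAt.continuousWithinAt)
      (fun y hy => (h.hasDerivAt (hmem y ⟨hx.1.trans (interior_subset hy).1,
        (interior_subset hy).2⟩)).differentiableAt.differentiableWithinAt)
      (fun y hy => ?_) x ⟨le_rfl, hx.2⟩ τ ⟨hx.2, le_rfl⟩ hx.2
    have hy' := interior_subset hy
    exact hanti ⟨hx.1.trans hy'.1, hy'.2⟩ ⟨haτ, le_rfl⟩ hy'.2
  have hbd : ∀ x ∈ Icc a τ, 0 ≤ (τ - x) * (deriv f τ / (f τ - f x)) ∧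
      (τ - x) * (deriv f τ / (f τ - f x)) ≤ 1 := by
    intro x hx
    have h0 : 0 ≤ τ - x := sub_nonneg.2 hx.2
    have h1 := hlow x hx
    have h2 : 0 ≤ f τ - f x := (mul_nonneg hpos.le h0).trans h1
    refine ⟨mul_nonneg h0 (div_nonneg hpos.le h2), ?_⟩
    rw [← mul_div_assoc, mul_comm]
    exact div_le_one_of_le₀ h1 h2
  -- Let `q = f'(τ) / (f τ - f x)`. The integrand is at most `(E²/2) (τ-x)² q'`, since `1 - cos y ≤
  -- y²/2`. The derivative of `g` exceeds this bound by `E² (1 - (τ-x) q)`, which is nonnegative by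
  -- `hbd`.
  set g : ℝ → ℝ := fun x => E ^ 2 / 2 * ((τ - x) ^ 2 * (deriv f τ / (f τ - f x)) + 2 * x) with hg
  have hd : ∀ x ∈ Ico a τ, HasDerivAt g (E ^ 2 / 2 * (2 * (τ - x) * (-1) *
      (deriv f τ / (f τ - f x)) + (τ - x) ^ 2 * (deriv f τ * deriv f x / (f τ - f x) ^ 2) + 2)) x := by
    intro x hx
    have h1 := h.hasDerivAt_quot hτ (hmem x ⟨hx.1, hx.2.le⟩) hx.2
    have h2 : HasDerivAt (fun x : ℝ => (τ - x) ^ 2) (2 * (τ - x) * (-1)) x :=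
      (((hasDerivAt_id x).const_sub τ).pow 2).congr_deriv (by simp)
    exact (((h2.mul h1).add ((hasDerivAt_id x).const_mul 2)).const_mul (E ^ 2 / 2)).congr_deriv
      (by simp)
  have hcont : ContinuousOn g (Icc a τ) := by
    intro x hx
    rcases hx.2.eq_or_lt with heq | hlt
    · subst heq
      refine ContinuousWithinAt.mul continuousWithinAt_const (ContinuousWithinAt.add ?_
        (by fun_prop))
      have hb : ∀ y ∈ Icc a x, ‖(x - y) ^ 2 * (deriv f x / (f x - f y))‖ ≤ x - y := by
        intro y hy
        have h0 : 0 ≤ x - y := sub_nonneg.2 hy.2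
        obtain ⟨h1, h2⟩ := hbd y hy
        rw [sq, mul_assoc, Real.norm_eq_abs, abs_of_nonneg (mul_nonneg h0 h1)]
        nlinarith
      have hlim : Tendsto (fun y => x - y) (𝓝[Icc a x] x) (𝓝 0) := by
        have : Continuous fun y : ℝ => x - y := by fun_prop
        have := this.tendsto x
        rw [sub_self] at this
        exact this.mono_left nhdsWithin_le_nhds
      have := squeeze_zero_norm' (eventually_nhdsWithin_of_forall hb) hlim
      simpa [ContinuousWithinAt] using this
    · exact (hd x ⟨hx.1, hlt⟩).continuousAt.continuousWithinAt
  have hi := (h.intervalIntegrable_regularKernel E ha le_rfl haτ hτ).neg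
  rw [intervalIntegrable_iff_integrableOn_Icc_of_le haτ] at hi
  have key := intervalIntegral.integral_le_sub_of_hasDeriv_right_of_le haτ hcont
    (fun x hx => (hd x ⟨hx.1.le, hx.2⟩).hasDerivWithinAt) hi (fun x hx => by
      have hx' := hmem x (Ioo_subset_Icc_self hx)
      have h1 := abs_le.1 (abs_cos_sub_one_le_sq (E * (τ - x)))
      have h2 := mul_pos hpos (h.deriv_pos x hx')
      have h3 : 0 < f τ - f x := sub_pos.2 (h.strictMonoOn hx' hτ hx.2)
      obtain ⟨-, h4⟩ := hbd x (Ioo_subset_Icc_self hx)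
      have h5 : -regularKernel E f (deriv f) τ x ≤
          E ^ 2 / 2 * ((τ - x) ^ 2 * (deriv f τ * deriv f x / (f τ - f x) ^ 2)) := by
        simp only [regularKernel]
        rw [← neg_div, ← mul_div_assoc, ← mul_div_assoc]
        refine div_le_div_of_nonneg_right ?_ (sq_nonneg _)
        nlinarith
      refine h5.trans (mul_le_mul_of_nonneg_left ?_ (by positivity))
      nlinarith)
  refine key.trans ?_
  have h6 : 0 ≤ (τ - a) ^ 2 * (deriv f τ / (f τ - f a)) := by
    rw [sq, mul_assoc]
    exact mul_nonneg (sub_nonneg.2 haτ) (hbd a ⟨le_rfl, haτ⟩).1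
  simp only [hg, sub_self, zero_pow two_ne_zero, zero_mul]
  nlinarith [mul_nonneg (sq_nonneg E) h6]

/-- Uniformly in the switch-on time, the contribution of a null coordinate with eventually
decreasing velocity to the transition rate is `f'' / f'` up to a bounded term. -/
theorem exists_coordRate_bound (h : IsNullCoord J f) (E : ℝ) {τ₁ τs : ℝ} (h1 : τ₁ ∈ J)
    (hs : τ₁ < τs) (hJ : Ico τ₁ τs ⊆ J) (hanti : AntitoneOn (deriv f) (Ico τ₁ τs)) :
    ∃ K, ∀ᶠ τ in 𝓝[<] τs, ∀ τ₀ ∈ J, τ₀ ≤ τ₁ →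
      |coordRate E f (deriv f) (deriv (deriv f)) τ₀ τ - deriv (deriv f) τ / deriv f τ| ≤ K := by
  -- For `τ > τ₂` the denominator `f τ - f τ₁` stays above the fixed positive `f τ₂ - f τ₁`, and the
  -- decreasing velocity stays below `f'(τ₁)`; hence the bound `Q`.
  obtain ⟨τ₂, h12, h2s⟩ := exists_between hs
  have h2 : τ₂ ∈ J := hJ ⟨h12.le, h2s⟩
  set Q := deriv f τ₁ / (f τ₂ - f τ₁) with hQ
  have hf12 : 0 < f τ₂ - f τ₁ := sub_pos.2 (h.strictMonoOn h1 h2 h12)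
  -- The pieces are the `πE` term, the switch-on quotient, and the regular integral split at `τ₁`
  -- into a far part `2 Q` and a near part `E² (τs - τ₁)`.
  refine ⟨|Real.pi * E| + 2 * Q + 2 * (2 * Q + E ^ 2 * (τs - τ₁)), ?_⟩
  filter_upwards [Ioo_mem_nhdsLT h2s] with τ hτ τ₀ h0 h01
  have hτ1 : τ₁ < τ := h12.trans hτ.1
  have hτJ : τ ∈ J := hJ ⟨hτ1.le, hτ.2⟩
  have hp := h.deriv_pos τ hτJ
  have hq1 : deriv f τ / (f τ - f τ₁) ≤ Q := by
    refine div_le_div₀ (h.deriv_pos τ₁ h1).le (hanti ⟨le_rfl, hs⟩ ⟨hτ1.le, hτ.2⟩ hτ1.le) hf12 ?_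
    linarith [h.strictMonoOn h2 hτJ hτ.1]
  have hf1 : 0 < f τ - f τ₁ := sub_pos.2 (h.strictMonoOn h1 hτJ hτ1)
  have hf0 : f τ - f τ₁ ≤ f τ - f τ₀ := by
    linarith [h.strictMonoOn.monotoneOn h0 h1 h01]
  have hq0 : deriv f τ / (f τ - f τ₀) ≤ Q :=
    (div_le_div_of_nonneg_left hp.le hf1 hf0).trans hq1
  have hq0' : 0 ≤ deriv f τ / (f τ - f τ₀) := div_nonneg hp.le (hf1.le.trans hf0)
  have e1 := h.integral_far_le E h0 h01 hτ1 hτJ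
  have e2 := h.integral_near_le E h1 hτJ hτ1.le
    (hanti.mono fun x hx => ⟨hx.1, hx.2.trans_lt hτ.2⟩)
  have e3 := intervalIntegral.integral_add_adjacent_intervals
    (h.intervalIntegrable_regularKernel E h0 hτ1.le h01 hτJ)
    (h.intervalIntegrable_regularKernel E h1 le_rfl hτ1.le hτJ)
  have e4 : 0 ≤ ∫ x in τ₀..τ, -regularKernel E f (deriv f) τ x :=
    intervalIntegral.integral_nonneg (h01.trans hτ1.le) fun x hx =>
      h.neg_regularKernel_nonneg E hτJ (h.ordConnected.out h0 hτJ hx)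
  rw [intervalIntegral.integral_neg] at e1 e2 e4
  have e5 : E ^ 2 * (τ - τ₁) ≤ E ^ 2 * (τs - τ₁) :=
    mul_le_mul_of_nonneg_left (by linarith [hτ.2]) (sq_nonneg E)
  unfold coordRate
  have hpe := abs_le.1 (le_refl |Real.pi * E|)
  rw [abs_le]
  constructor <;> linarith

/-- The contribution of a null coordinate converges when the switch-on is moved to the infinite
past. -/
theorem exists_tendsto_coordRate (h : IsNullCoord J f) (E : ℝ) {τ : ℝ} (hτ : τ ∈ J)
    (hJ : Iic τ ⊆ J) : ∃ l, Tendsto (fun τ₀ => coordRate E f (deriv f) (deriv (deriv f)) τ₀ τ)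
      atBot (𝓝 l) := by
  have hp := h.deriv_pos τ hτ
  -- Truncation at `τ - 1` keeps clear of the pole and gives functions monotone on the whole line,
  -- equal to the original ones near `-∞`.
  have hm : ∀ x, min x (τ - 1) < τ := fun x => (min_le_right _ _).trans_lt (by linarith)
  have hmJ : ∀ x, min x (τ - 1) ∈ J := fun x => hJ (hm x).le
  have hmono : Monotone fun x : ℝ => min x (τ - 1) := fun x y hxy => min_le_min_right _ hxy
  have hev : ∀ᶠ x : ℝ in atBot, min x (τ - 1) = x := by
    filter_upwards [Iic_mem_atBot (τ - 1)] with x hx using min_eq_left hx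
  have hfpos : ∀ x, 0 < f τ - f (min x (τ - 1)) := fun x =>
    sub_pos.2 (h.strictMonoOn (hmJ x) hτ (hm x))
  have q1 : ∃ l, Tendsto (fun x => deriv f τ / (f τ - f x)) atBot (𝓝 l) := by
    have hmo : Monotone fun x => deriv f τ / (f τ - f (min x (τ - 1))) := by
      intro x y hxy
      refine div_le_div_of_nonneg_left hp.le (hfpos y) ?_
      linarith [h.strictMonoOn.monotoneOn (hmJ x) (hmJ y) (hmono hxy)]
    have hb : BddBelow (range fun x => deriv f τ / (f τ - f (min x (τ - 1)))) :=
      ⟨0, by rintro _ ⟨x, rfl⟩; exact div_nonneg hp.le (hfpos x).le⟩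
    refine ⟨_, (tendsto_congr' ?_).1 (tendsto_atBot_ciInf hmo hb)⟩
    filter_upwards [hev] with x hx
    rw [hx]
  have q2 : ∃ l, Tendsto (fun x => ∫ b in x..τ, -regularKernel E f (deriv f) τ b) atBot
      (𝓝 l) := by
    have hii : ∀ a b, a ≤ b → b ≤ τ →
        IntervalIntegrable (fun b => -regularKernel E f (deriv f) τ b) volume a b :=
      fun a b hab hb => (h.intervalIntegrable_regularKernel E (hJ (hab.trans hb)) hb hab hτ).neg
    have han : Antitone fun x => ∫ b in (min x (τ - 1))..τ, -regularKernel E f (deriv f) τ b := by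
      intro x y hxy
      have h1 := intervalIntegral.integral_add_adjacent_intervals
        (hii _ _ (hmono hxy) (hm y).le) (hii _ _ (hm y).le le_rfl)
      have h2 : 0 ≤ ∫ b in (min x (τ - 1))..(min y (τ - 1)), -regularKernel E f (deriv f) τ b :=
        intervalIntegral.integral_nonneg (hmono hxy) fun b hb =>
          h.neg_regularKernel_nonneg E hτ (hJ (hb.2.trans (hm y).le))
      simp only
      linarith
    have hb : BddAbove
        (range fun x => ∫ b in (min x (τ - 1))..τ, -regularKernel E f (deriv f) τ b) := by
      -- The part before `τ - 1` is bounded by `integral_far_le`, independently of `x`; the part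
      -- after it is fixed.
      refine ⟨2 * (deriv f τ / (f τ - f (τ - 1))) +
        ∫ b in (τ - 1)..τ, -regularKernel E f (deriv f) τ b, ?_⟩
      rintro _ ⟨x, rfl⟩
      have h1 := intervalIntegral.integral_add_adjacent_intervals
        (hii _ _ (min_le_right x (τ - 1)) (by linarith)) (hii (τ - 1) τ (by linarith) le_rfl)
      have h2 := h.integral_far_le E (hmJ x) (min_le_right x (τ - 1)) (by linarith) hτ
      simp only
      linarith
    refine ⟨_, (tendsto_congr' ?_).1 (tendsto_atBot_ciSup han hb)⟩
    filter_upwards [hev] with x hx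
    rw [hx]
  obtain ⟨l1, hl1⟩ := q1
  obtain ⟨l2, hl2⟩ := q2
  refine ⟨Real.pi * E + (deriv (deriv f) τ / deriv f τ - 2 * l1) + 2 * -l2, ?_⟩
  have := (tendsto_const_nhds (x := Real.pi * E)).add
    ((tendsto_const_nhds (x := deriv (deriv f) τ / deriv f τ)).sub (hl1.const_mul 2))
    |>.add (hl2.neg.const_mul 2)
  refine this.congr fun x => ?_
  rw [intervalIntegral.integral_neg, neg_neg]
  rfl

end IsNullCoord

/-! ### Asymptotics near the singularity -/

theorem rpow_three_halves {y : ℝ} (hy : 0 < y) : y ^ (3 / 2 : ℝ) = y * √y := by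
  rw [Real.sqrt_eq_rpow, show (3 / 2 : ℝ) = 1 + 1 / 2 by norm_num, Real.rpow_add hy,
    Real.rpow_one]

/-- Two-term expansion for large `y`. With `a = √y` and `b = √(y+e)`, substituting `e = (b - a)(b +
a)` extracts a factor `1/(a+b)`, at most `1` since `y ≥ 1`. -/
theorem abs_sqrt_add_mul_sub_le {y e : ℝ} (hy : 1 ≤ y) (hye : 0 ≤ y + e) :
    |√(y + e) * (y + 1) - (y * √y + (e / 2 + 1) * √y)| ≤ |e| * (|e| + 2) / 2 := by
  have ha : 1 ≤ √y := Real.one_le_sqrt.2 hy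
  have hb : 0 ≤ √(y + e) := Real.sqrt_nonneg _
  have ha2 : √y ^ 2 = y := Real.sq_sqrt (by linarith)
  have hb2 : √(y + e) ^ 2 = y + e := Real.sq_sqrt hye
  generalize √y = a at *
  generalize √(y + e) = b at *
  have hs : 0 < a + b := by linarith
  have key : b * (y + 1) - (y * a + (e / 2 + 1) * a) =
      e * (2 - e * (a / (a + b))) / 2 * (1 / (a + b)) := by
    have he : e = (b - a) * (a + b) := by nlinarith
    rw [← ha2, he]
    field_simp
    ring
  have h1 : |a / (a + b)| ≤ 1 := by
    rw [abs_of_nonneg (by positivity), div_le_one hs]; linarith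
  have h2 : |1 / (a + b)| ≤ 1 := by
    rw [abs_of_nonneg (by positivity), div_le_one hs]; linarith
  have h3 : |2 - e * (a / (a + b))| ≤ |e| + 2 := by
    refine (abs_sub _ _).trans ?_
    rw [abs_mul, abs_two]
    nlinarith [abs_nonneg e]
  rw [key, abs_mul, abs_div, abs_mul, abs_two]
  have h4 : |e| * |2 - e * (a / (a + b))| / 2 ≤ |e| * (|e| + 2) / 2 := by
    have := mul_le_mul_of_nonneg_left h3 (abs_nonneg e)
    linarith
  refine le_trans ?_ h4
  exact mul_le_of_le_one_right (by positivity) h2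

/-- The leading behaviour of the transition rate at the singularity. -/
noncomputable def singularRate (M ε r : ℝ) : ℝ :=
  1 / (8 * Real.pi * M) *
    ((2 * M / r) ^ (3 / 2 : ℝ) + (1 + ε ^ 2) / 2 * (2 * M / r) ^ (1 / 2 : ℝ))

/-- With `y = 2M/r` and `e = ε² - 1` the expression is `(y + 1) √(y + e) / (8πM)`, and `e/2 + 1 = (1
+ ε²)/2`. -/
theorem exists_abs_sub_singularRate_le {M : ℝ} (hM : 0 < M) (ε : ℝ) :
    ∃ K, ∀ r, 0 < r → r < 2 * M →
      |1 / (4 * Real.pi) * ((1 / r + 1 / (2 * M)) * √(ε ^ 2 - 1 + 2 * M / r)) -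
        singularRate M ε r| ≤ K := by
  refine ⟨|1 / (8 * Real.pi * M)| * (|ε ^ 2 - 1| * (|ε ^ 2 - 1| + 2) / 2), fun r hr hr2 => ?_⟩
  have hy : 1 < 2 * M / r := (one_lt_div hr).2 hr2
  have hy0 : 0 < 2 * M / r := by linarith
  have key := abs_sqrt_add_mul_sub_le (e := ε ^ 2 - 1) hy.le (by nlinarith)
  have e1 : 1 / (4 * Real.pi) * ((1 / r + 1 / (2 * M)) * √(ε ^ 2 - 1 + 2 * M / r)) -
        singularRate M ε r = 1 / (8 * Real.pi * M) * (√(2 * M / r + (ε ^ 2 - 1)) *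
          (2 * M / r + 1) - (2 * M / r * √(2 * M / r) +
          ((ε ^ 2 - 1) / 2 + 1) * √(2 * M / r))) := by
    unfold singularRate
    rw [rpow_three_halves hy0, ← Real.sqrt_eq_rpow, add_comm (ε ^ 2 - 1)]
    generalize √(2 * M / r + (ε ^ 2 - 1)) = b
    generalize √(2 * M / r) = a
    have := Real.pi_pos
    field_simp
    ring
  rw [e1, abs_mul]
  exact mul_le_mul_of_nonneg_left key (abs_nonneg _)

namespace IsInfallingGeodesic

variable {M ε τs : ℝ} {J : Set ℝ} {γ : ℝ → ℝ × ℝ}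

theorem infall_speed_eq (h : IsInfallingGeodesic M ε J τs γ) (hM : 0 < M) {τ : ℝ} (hτ : τ ∈ J)
    (hp : 0 < (deriv γ τ).1 * (γ τ).2 + (γ τ).1 * (deriv γ τ).2) :
    4 * M ^ 2 / (radius M (γ τ) * Real.exp (radius M (γ τ) / (2 * M))) *
        ((deriv γ τ).1 * (γ τ).2 + (γ τ).1 * (deriv γ τ).2) =
      √(ε ^ 2 - 1 + 2 * M / radius M (γ τ)) := by
  have hr := h.radius_pos hM hτ
  rw [← h.radial_equation hM hτ, Real.sqrt_sq (by positivity)]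

theorem hasDerivAt_radius_of_infall (h : IsInfallingGeodesic M ε J τs γ) (hM : 0 < M) {τ : ℝ}
    (hτ : τ ∈ J) (hp : 0 < (deriv γ τ).1 * (γ τ).2 + (γ τ).1 * (deriv γ τ).2) :
    HasDerivAt (fun t => radius M (γ t)) (-√(ε ^ 2 - 1 + 2 * M / radius M (γ τ))) τ := by
  refine (h.hasDerivAt_radius hM hτ).congr_deriv ?_
  rw [← h.infall_speed_eq hM hτ hp, neg_mul]

/-- The sum of the logarithmic derivatives of the Kruskal velocities. -/
theorem acceleration_sum (h : IsInfallingGeodesic M ε J τs γ) (hM : 0 < M) {τ : ℝ} (hτ : τ ∈ J)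
    (hp : 0 < (deriv γ τ).1 * (γ τ).2 + (γ τ).1 * (deriv γ τ).2) :
    (deriv (deriv γ) τ).1 / (deriv γ τ).1 + (deriv (deriv γ) τ).2 / (deriv γ τ).2 =
      -((1 / radius M (γ τ) + 1 / (2 * M)) * √(ε ^ 2 - 1 + 2 * M / radius M (γ τ))) := by
  have hU := h.geodesic_U τ hτ
  have hV := h.geodesic_V τ hτ
  obtain ⟨h1, h2⟩ := h.future τ hτ
  rw [christoffelU_eq hM (h.mem_kruskal τ hτ)] at hU
  rw [christoffelV_eq hM (h.mem_kruskal τ hτ)] at hV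
  rw [← h.infall_speed_eq hM hτ hp, ← mul_assoc]
  -- With `L = logFactorDeriv`, the geodesic equations read `U''/U' = -L V U'` and `V''/V' = -L U
  -- V'`, whose sum is `-L (U V)'`.
  change _ = -(logFactorDeriv M (γ τ) * _)
  rw [eq_neg_of_add_eq_zero_left hU, eq_neg_of_add_eq_zero_left hV]
  field_simp
  ring

/-- The radius vanishes like the power `2/3` of the remaining proper time. -/
theorem tendsto_radius_mul_sqrt_div (h : IsInfallingGeodesic M ε J τs γ) (hM : 0 < M)
    (hε : 0 ≤ ε) {τ₀ : ℝ} (h0 : τ₀ ∈ J) :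
    Tendsto (fun τ => radius M (γ τ) * √(radius M (γ τ)) / (τs - τ)) (𝓝[<] τs)
      (𝓝 (3 / 2 * √(2 * M))) := by
  obtain ⟨τ₁, h1, -, hl⟩ := h.exists_late hM hε h0
  have hev := h.mem_nhdsLT h1
  have hlim : Tendsto (fun τ => -(3 / 2 * √((ε ^ 2 - 1) * radius M (γ τ) + 2 * M)) / -1)
      (𝓝[<] τs) (𝓝 (3 / 2 * √(2 * M))) := by
    have hc : Continuous fun r : ℝ => -(3 / 2 * √((ε ^ 2 - 1) * r + 2 * M)) / -1 := by fun_prop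
    have := (hc.tendsto 0).comp h.hits_singularity
    simpa [Function.comp_def] using this
  -- The `r` in `r' = -√(ε² - 1 + 2M/r)` cancels the growth: `(r^(3/2))' = -(3/2) √((ε² - 1) r +
  -- 2M)`, which has a finite limit.
  refine HasDerivAt.lhopital_zero_nhdsLT (f' := fun τ =>
    -(3 / 2 * √((ε ^ 2 - 1) * radius M (γ τ) + 2 * M))) (g' := fun _ => -1) ?_ ?_ ?_ ?_ ?_ hlim
  · filter_upwards [hev] with τ hτ
    have hJ := h.Ico_subset h1 hτ
    have hr := h.radius_pos hM hJ
    have hd := h.hasDerivAt_radius_of_infall hM hJ (hl τ hτ).2.2.2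
    refine (hd.mul (hd.sqrt hr.ne')).congr_deriv ?_
    have hs := Real.sqrt_pos.2 hr
    have e1 : (ε ^ 2 - 1) * radius M (γ τ) + 2 * M =
        radius M (γ τ) * (ε ^ 2 - 1 + 2 * M / radius M (γ τ)) := by field_simp
    rw [e1, Real.sqrt_mul hr.le]
    have hs2 : √(radius M (γ τ)) ^ 2 = radius M (γ τ) := Real.sq_sqrt hr.le
    generalize √(ε ^ 2 - 1 + 2 * M / radius M (γ τ)) = w at *
    generalize radius M (γ τ) = r at *
    generalize √r = q at *
    subst hs2
    field_simp
    ring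
  · exact Eventually.of_forall fun τ => (hasDerivAt_id τ).const_sub τs
  · exact Eventually.of_forall fun τ => by norm_num
  · have hc : Continuous fun r : ℝ => r * √r := by fun_prop
    have := (hc.tendsto 0).comp h.hits_singularity
    simpa [Function.comp_def] using this
  · have hc : Continuous fun τ : ℝ => τs - τ := by fun_prop
    have := hc.tendsto τs
    rw [sub_self] at this
    exact this.mono_left nhdsWithin_le_nhds

/-- The product equals `(3/2) √(2M) · (τs - τ)/r^(3/2) · (1 + (1 + ε²) r/(4M))`; the power law for
`r` makes the first two factors tend to `1`. -/
theorem tendsto_singularRate_mul (h : IsInfallingGeodesic M ε J τs γ) (hM : 0 < M)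
    (hε : 0 ≤ ε) {τ₀ : ℝ} (h0 : τ₀ ∈ J) :
    Tendsto (fun τ => singularRate M ε (radius M (γ τ)) * (6 * Real.pi * (τs - τ))) (𝓝[<] τs)
      (𝓝 1) := by
  have hsM : 0 < √(2 * M) := Real.sqrt_pos.2 (by linarith)
  have h1 := (h.tendsto_radius_mul_sqrt_div hM hε h0).inv₀ (by positivity)
  have h2 := (h1.mul ((h.hits_singularity.const_mul ((1 + ε ^ 2) / (4 * M))).const_add 1)).const_mul
    (3 / 4 * (2 * √(2 * M)))
  have e1 : 3 / 4 * (2 * √(2 * M)) * ((3 / 2 * √(2 * M))⁻¹ *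
      (1 + (1 + ε ^ 2) / (4 * M) * 0)) = 1 := by
    field_simp
    ring
  rw [e1] at h2
  refine h2.congr' ?_
  filter_upwards [h.mem_nhdsLT h0] with τ hτ
  have hr := h.radius_pos hM (h.Ico_subset h0 hτ)
  have hy0 : 0 < 2 * M / radius M (γ τ) := by positivity
  have ht : 0 < τs - τ := sub_pos.2 hτ.2
  have hs := Real.sqrt_pos.2 hr
  unfold singularRate
  rw [rpow_three_halves hy0, ← Real.sqrt_eq_rpow, Real.sqrt_div (by linarith)]
  have := Real.pi_pos
  generalize radius M (γ τ) = r at *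
  field_simp
  ring

/-- A function that differs from the singular rate by a bounded amount obeys the near-singularity
law. -/
theorem nearSingularityLaw (h : IsInfallingGeodesic M ε J τs γ) (hM : 0 < M) (hε : 0 ≤ ε)
    {τ₀ : ℝ} (h0 : τ₀ ∈ J) {R : ℝ → ℝ} {K : ℝ}
    (hR : ∀ᶠ τ in 𝓝[<] τs, |R τ - singularRate M ε (radius M (γ τ))| ≤ K) :
    NearSingularityLaw M ε τs (fun τ => radius M (γ τ)) R := by
  have hO : (fun τ => R τ - singularRate M ε (radius M (γ τ))) =O[𝓝[<] τs]
      (fun _ => (1 : ℝ)) :=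
    IsBigO.of_bound K (hR.mono fun τ hτ => by simpa using hτ)
  refine ⟨hO, ?_⟩
  have hne : ∀ᶠ τ in 𝓝[<] τs, 1 / (6 * Real.pi * (τs - τ)) ≠ 0 := by
    filter_upwards [h.mem_nhdsLT h0] with τ hτ
    have := Real.pi_pos
    have ht : 0 < τs - τ := sub_pos.2 hτ.2
    positivity
  rw [isEquivalent_iff_tendsto_one hne]
  have hlim : Tendsto (fun τ => 6 * Real.pi * (τs - τ)) (𝓝[<] τs) (𝓝 0) := by
    have hc : Continuous fun τ : ℝ => 6 * Real.pi * (τs - τ) := by fun_prop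
    have := hc.tendsto τs
    rw [sub_self, mul_zero] at this
    exact this.mono_left nhdsWithin_le_nhds
  have hz : Tendsto (fun τ => (R τ - singularRate M ε (radius M (γ τ))) *
      (6 * Real.pi * (τs - τ))) (𝓝[<] τs) (𝓝 0) := by
    have := hO.mul_isLittleO ((isLittleO_one_iff ℝ).2 hlim)
    simpa using (isLittleO_one_iff ℝ).1 (by simpa using this)
  have := hz.add (h.tendsto_singularRate_mul hM hε h0)
  rw [zero_add] at this
  refine this.congr fun τ => ?_
  simp only [Pi.div_apply, div_div_eq_mul_div, div_one]
  ring

/-! ### The null coordinates of the two vacua along the geodesic -/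

/-- The proper times at which the trajectory is in the region where the state is defined. -/
def stateTimes (s : Vacuum) (J : Set ℝ) (γ : ℝ → ℝ × ℝ) : Set ℝ := {t ∈ J | γ t ∈ s.region}

theorem mem_stateTimes_unruh (h : IsInfallingGeodesic M ε J τs γ) {t : ℝ} :
    t ∈ stateTimes .unruh J γ ↔ t ∈ J ∧ 0 < (γ t).2 :=
  ⟨fun ht => ⟨ht.1, ht.2.2⟩, fun ht => ⟨ht.1, h.mem_kruskal t ht.1, ht.2⟩⟩

theorem stateTimes_hhi (h : IsInfallingGeodesic M ε J τs γ) : stateTimes .hhi J γ = J :=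
  Subset.antisymm (fun _ ht => ht.1) fun t ht => ⟨ht, h.mem_kruskal t ht⟩

theorem deriv_fst (h : IsInfallingGeodesic M ε J τs γ) {t : ℝ} (ht : t ∈ J) :
    deriv (fun t => (γ t).1) t = (deriv γ t).1 := (h.hasDerivAt ht).fst_curve.deriv

theorem deriv_snd (h : IsInfallingGeodesic M ε J τs γ) {t : ℝ} (ht : t ∈ J) :
    deriv (fun t => (γ t).2) t = (deriv γ t).2 := (h.hasDerivAt ht).snd_curve.deriv

theorem isNullCoord_fst (h : IsInfallingGeodesic M ε J τs γ) :
    IsNullCoord J (fun t => (γ t).1) where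
  isOpen := h.isOpen
  ordConnected := h.ordConnected
  smooth := h.smooth.fst
  deriv_pos t ht := by rw [h.deriv_fst ht]; exact (h.future t ht).1

theorem isNullCoord_snd (h : IsInfallingGeodesic M ε J τs γ) :
    IsNullCoord J (fun t => (γ t).2) where
  isOpen := h.isOpen
  ordConnected := h.ordConnected
  smooth := h.smooth.snd
  deriv_pos t ht := by rw [h.deriv_snd ht]; exact (h.future t ht).2

/-- `V` increases along the trajectory, so the region `V > 0` is never left once entered. -/
theorem mem_stateTimes_of_le (h : IsInfallingGeodesic M ε J τs γ) {s : Vacuum} {t u : ℝ}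
    (ht : t ∈ stateTimes s J γ) (hu : u ∈ J) (htu : t ≤ u) : u ∈ stateTimes s J γ := by
  cases s with
  | hhi => rwa [h.stateTimes_hhi]
  | unruh =>
    rw [h.mem_stateTimes_unruh] at ht ⊢
    exact ⟨hu, ht.2.trans_le (h.isNullCoord_snd.strictMonoOn.monotoneOn ht.1 hu htu)⟩

theorem isOpen_stateTimes (h : IsInfallingGeodesic M ε J τs γ) (s : Vacuum) :
    IsOpen (stateTimes s J γ) := by
  cases s with
  | hhi => rw [h.stateTimes_hhi]; exact h.isOpen
  | unruh =>
    have : stateTimes .unruh J γ = J ∩ (fun t => (γ t).2) ⁻¹' Ioi 0 := by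
      ext t; exact h.mem_stateTimes_unruh
    rw [this]
    exact h.smooth.snd.continuousOn.isOpen_inter_preimage h.isOpen isOpen_Ioi

theorem ordConnected_stateTimes (h : IsInfallingGeodesic M ε J τs γ) (s : Vacuum) :
    (stateTimes s J γ).OrdConnected :=
  ⟨fun _ hx _ hy _ hz => h.mem_stateTimes_of_le hx (h.ordConnected.out hx.1 hy.1 hz) hz.1⟩

theorem isNullCoord_stateTimes_fst (h : IsInfallingGeodesic M ε J τs γ) (s : Vacuum) :
    IsNullCoord (stateTimes s J γ) (fun t => (γ t).1) where
  isOpen := h.isOpen_stateTimes s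
  ordConnected := h.ordConnected_stateTimes s
  smooth := h.smooth.fst.mono fun _ ht => ht.1
  deriv_pos t ht := h.isNullCoord_fst.deriv_pos t ht.1

theorem hasDerivAt_unruh_leftCoord (h : IsInfallingGeodesic M ε J τs γ) {t : ℝ} (ht : t ∈ J)
    (hV : 0 < (γ t).2) : HasDerivAt (fun t => Vacuum.unruh.leftCoord M (γ t))
      (4 * M * ((deriv γ t).2 / (γ t).2)) t :=
  (((h.hasDerivAt ht).snd_curve).log hV.ne').const_mul (4 * M)

theorem isNullCoord_leftCoord (h : IsInfallingGeodesic M ε J τs γ) (hM : 0 < M) (s : Vacuum) :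
    IsNullCoord (stateTimes s J γ) (fun t => s.leftCoord M (γ t)) where
  isOpen := h.isOpen_stateTimes s
  ordConnected := h.ordConnected_stateTimes s
  smooth := by
    cases s with
    | hhi => exact h.smooth.snd.mono fun _ ht => ht.1
    | unruh =>
      exact contDiffOn_const.mul ((h.smooth.snd.mono fun _ ht => ht.1).log
        fun t ht => (h.mem_stateTimes_unruh.1 ht).2.ne')
  deriv_pos t ht := by
    cases s with
    | hhi => exact h.isNullCoord_snd.deriv_pos t ht.1
    | unruh =>
      obtain ⟨hJ, hV⟩ := h.mem_stateTimes_unruh.1 ht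
      rw [(h.hasDerivAt_unruh_leftCoord hJ hV).deriv]
      have := (h.future t hJ).2
      positivity

theorem deriv_deriv_fst (h : IsInfallingGeodesic M ε J τs γ) {t : ℝ} (ht : t ∈ J) :
    deriv (deriv fun t => (γ t).1) t = (deriv (deriv γ) t).1 := by
  have e : deriv (fun t => (γ t).1) =ᶠ[𝓝 t] fun t => (deriv γ t).1 := by
    filter_upwards [h.isOpen.mem_nhds ht] with u hu using h.deriv_fst hu
  rw [e.deriv_eq]
  exact (h.hasDerivAt_deriv ht).fst_curve.deriv

theorem deriv_deriv_snd (h : IsInfallingGeodesic M ε J τs γ) {t : ℝ} (ht : t ∈ J) :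
    deriv (deriv fun t => (γ t).2) t = (deriv (deriv γ) t).2 := by
  have e : deriv (fun t => (γ t).2) =ᶠ[𝓝 t] fun t => (deriv γ t).2 := by
    filter_upwards [h.isOpen.mem_nhds ht] with u hu using h.deriv_snd hu
  rw [e.deriv_eq]
  exact (h.hasDerivAt_deriv ht).snd_curve.deriv

theorem deriv_deriv_unruh_leftCoord (h : IsInfallingGeodesic M ε J τs γ) {t : ℝ} (ht : t ∈ J)
    (hV : 0 < (γ t).2) : deriv (deriv fun t => Vacuum.unruh.leftCoord M (γ t)) t =
      4 * M * (((deriv (deriv γ) t).2 * (γ t).2 - (deriv γ t).2 * (deriv γ t).2) /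
        (γ t).2 ^ 2) := by
  have e : deriv (fun t => Vacuum.unruh.leftCoord M (γ t)) =ᶠ[𝓝 t]
      fun t => 4 * M * ((deriv γ t).2 / (γ t).2) := by
    have hmem := h.mem_stateTimes_unruh.2 ⟨ht, hV⟩
    filter_upwards [(h.isOpen_stateTimes .unruh).mem_nhds hmem] with u hu
    obtain ⟨hJ, hV⟩ := h.mem_stateTimes_unruh.1 hu
    exact (h.hasDerivAt_unruh_leftCoord hJ hV).deriv
  rw [e.deriv_eq]
  exact (((h.hasDerivAt_deriv ht).snd_curve.div (h.hasDerivAt ht).snd_curve hV.ne').const_mul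
    (4 * M)).deriv

/-- `U'' = -Γ^U_UU U'²`, and the symbol has the sign of `V`. -/
theorem antitoneOn_velocity_fst (h : IsInfallingGeodesic M ε J τs γ) (hM : 0 < M) {τ₁ : ℝ}
    (h1 : τ₁ ∈ J) (hV : ∀ τ ∈ Ico τ₁ τs, 0 < (γ τ).2) :
    AntitoneOn (fun t => (deriv γ t).1) (Ico τ₁ τs) := by
  have hd : ∀ t ∈ Ico τ₁ τs, HasDerivAt (fun t => (deriv γ t).1) (deriv (deriv γ) t).1 t :=
    fun t ht => (h.hasDerivAt_deriv (h.Ico_subset h1 ht)).fst_curve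
  refine antitoneOn_of_deriv_nonpos (convex_Ico _ _)
    (fun t ht => (hd t ht).continuousAt.continuousWithinAt)
    (fun t ht => (hd t (interior_subset ht)).differentiableAt.differentiableWithinAt)
    fun t ht => ?_
  have ht' := interior_subset ht
  have hK := h.mem_kruskal t (h.Ico_subset h1 ht')
  rw [(hd t ht').deriv, eq_neg_of_add_eq_zero_left (h.geodesic_U t (h.Ico_subset h1 ht')),
    christoffelU_eq hM hK]
  have := mul_nonneg (mul_pos (logFactorDeriv_pos hM hK) (hV t ht')).le
    (sq_nonneg (deriv γ t).1)
  linarith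

theorem antitoneOn_velocity_snd (h : IsInfallingGeodesic M ε J τs γ) (hM : 0 < M) {τ₁ : ℝ}
    (h1 : τ₁ ∈ J) (hU : ∀ τ ∈ Ico τ₁ τs, 0 < (γ τ).1) :
    AntitoneOn (fun t => (deriv γ t).2) (Ico τ₁ τs) := by
  have hd : ∀ t ∈ Ico τ₁ τs, HasDerivAt (fun t => (deriv γ t).2) (deriv (deriv γ) t).2 t :=
    fun t ht => (h.hasDerivAt_deriv (h.Ico_subset h1 ht)).snd_curve
  refine antitoneOn_of_deriv_nonpos (convex_Ico _ _)
    (fun t ht => (hd t ht).continuousAt.continuousWithinAt)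
    (fun t ht => (hd t (interior_subset ht)).differentiableAt.differentiableWithinAt)
    fun t ht => ?_
  have ht' := interior_subset ht
  have hK := h.mem_kruskal t (h.Ico_subset h1 ht')
  rw [(hd t ht').deriv, eq_neg_of_add_eq_zero_left (h.geodesic_V t (h.Ico_subset h1 ht')),
    christoffelV_eq hM hK]
  have := mul_nonneg (mul_pos (logFactorDeriv_pos hM hK) (hU t ht')).le
    (sq_nonneg (deriv γ t).2)
  linarith

theorem antitoneOn_velocity_div (h : IsInfallingGeodesic M ε J τs γ) (hM : 0 < M) {τ₁ : ℝ}
    (h1 : τ₁ ∈ J) (hU : ∀ τ ∈ Ico τ₁ τs, 0 < (γ τ).1) (hV : ∀ τ ∈ Ico τ₁ τs, 0 < (γ τ).2) :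
    AntitoneOn (fun t => (deriv γ t).2 / (γ t).2) (Ico τ₁ τs) := fun x hx _ hy hxy =>
  div_le_div₀ (h.future x (h.Ico_subset h1 hx)).2.le (h.antitoneOn_velocity_snd hM h1 hU hx hy hxy)
    (hV x hx) (h.isNullCoord_snd.strictMonoOn.monotoneOn (h.Ico_subset h1 hx)
      (h.Ico_subset h1 hy) hxy)

theorem antitoneOn_deriv_leftCoord (h : IsInfallingGeodesic M ε J τs γ) (hM : 0 < M) (s : Vacuum)
    {τ₁ : ℝ} (h1 : τ₁ ∈ J) (hU : ∀ τ ∈ Ico τ₁ τs, 0 < (γ τ).1)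
    (hV : ∀ τ ∈ Ico τ₁ τs, 0 < (γ τ).2) :
    AntitoneOn (deriv fun t => s.leftCoord M (γ t)) (Ico τ₁ τs) := by
  cases s with
  | hhi =>
    exact (h.antitoneOn_velocity_snd hM h1 hU).congr fun t ht =>
      (h.deriv_snd (h.Ico_subset h1 ht)).symm
  | unruh =>
    have hanti := h.antitoneOn_velocity_div hM h1 hU hV
    intro x hx y hy hxy
    rw [(h.hasDerivAt_unruh_leftCoord (h.Ico_subset h1 hx) (hV x hx)).deriv,
      (h.hasDerivAt_unruh_leftCoord (h.Ico_subset h1 hy) (hV y hy)).deriv]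
    exact mul_le_mul_of_nonneg_left (hanti hx hy hxy) (by linarith)

/-- For `v = 4M log V` one has `v''/v' = V''/V' - V'/V`, and the decreasing `V'/V` is at most its
value at `τ₁`. The Unruh vacuum thus differs by a bounded term. -/
theorem exists_leftCoord_acceleration_bound (h : IsInfallingGeodesic M ε J τs γ) (hM : 0 < M)
    (s : Vacuum) {τ₁ : ℝ} (h1 : τ₁ ∈ J) (hU : ∀ τ ∈ Ico τ₁ τs, 0 < (γ τ).1)
    (hV : ∀ τ ∈ Ico τ₁ τs, 0 < (γ τ).2) :
    ∃ K, ∀ τ ∈ Ico τ₁ τs, |deriv (deriv fun t => s.leftCoord M (γ t)) τ /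
      deriv (fun t => s.leftCoord M (γ t)) τ - (deriv (deriv γ) τ).2 / (deriv γ τ).2| ≤ K := by
  cases s with
  | hhi =>
    refine ⟨0, fun τ hτ => ?_⟩
    simp only [Vacuum.leftCoord]
    rw [h.deriv_snd (h.Ico_subset h1 hτ), h.deriv_deriv_snd (h.Ico_subset h1 hτ), sub_self,
      abs_zero]
  | unruh =>
    refine ⟨(deriv γ τ₁).2 / (γ τ₁).2, fun τ hτ => ?_⟩
    have hJ := h.Ico_subset h1 hτ
    have hV' := hV τ hτ
    have hp := (h.future τ hJ).2
    rw [(h.hasDerivAt_unruh_leftCoord hJ hV').deriv, h.deriv_deriv_unruh_leftCoord hJ hV']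
    have e : 4 * M * (((deriv (deriv γ) τ).2 * (γ τ).2 - (deriv γ τ).2 * (deriv γ τ).2) /
        (γ τ).2 ^ 2) / (4 * M * ((deriv γ τ).2 / (γ τ).2)) -
        (deriv (deriv γ) τ).2 / (deriv γ τ).2 = -((deriv γ τ).2 / (γ τ).2) := by
      field_simp
      ring
    rw [e, abs_neg, abs_of_pos (div_pos hp hV')]
    exact h.antitoneOn_velocity_div hM h1 hU hV ⟨le_rfl, h.lt_end h1⟩ hτ hτ.1

/-! ### The transition rate and its limit in the infinite past -/

/-- The transition rate of a detector on the trajectory. -/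
noncomputable def transitionRate (M E : ℝ) (s : Vacuum) (γ : ℝ → ℝ × ℝ) (τ₀ τ : ℝ) : ℝ :=
  -(1 / (4 * Real.pi)) *
    (coordRate E (fun t => (γ t).1) (deriv fun t => (γ t).1) (deriv (deriv fun t => (γ t).1)) τ₀ τ +
      coordRate E (fun t => s.leftCoord M (γ t)) (deriv fun t => s.leftCoord M (γ t))
        (deriv (deriv fun t => s.leftCoord M (γ t))) τ₀ τ)

theorem isTransitionRate (h : IsInfallingGeodesic M ε J τs γ) (hM : 0 < M) (E : ℝ) (s : Vacuum)
    (c : ℝ) {τ₀ τ : ℝ} (h0 : τ₀ ∈ stateTimes s J γ) (hτ : τ ∈ Ioo τ₀ τs) :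
    IsTransitionRate (fun a b => wightman M s c (γ a) (γ b)) E τ₀ τ
      (transitionRate M E s γ τ₀ τ) := by
  have hU := h.isNullCoord_stateTimes_fst s
  have hL := h.isNullCoord_leftCoord hM s
  exact isTransitionRate_of_coords hU.isOpen hU.ordConnected hU.smooth hL.smooth hU.deriv_pos
    hL.deriv_pos E c hτ.1 h0
    (h.mem_stateTimes_of_le h0 (h.Ico_subset h0.1 ⟨hτ.1.le, hτ.2⟩) hτ.1.le)

/-- Uniformly in the switch-on time, the transition rate differs from the singular rate by a
bounded amount. -/
theorem exists_transitionRate_bound (h : IsInfallingGeodesic M ε J τs γ) (hM : 0 < M)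
    (hε : 0 ≤ ε) (E : ℝ) (s : Vacuum) {τ₀ : ℝ} (h0 : τ₀ ∈ stateTimes s J γ) :
    ∃ τ₁, τ₀ < τ₁ ∧ ∃ K, ∀ᶠ τ in 𝓝[<] τs, ∀ t ∈ stateTimes s J γ, t ≤ τ₁ →
      |transitionRate M E s γ t τ - singularRate M ε (radius M (γ τ))| ≤ K := by
  obtain ⟨τ₁, h1, h01, hl⟩ := h.exists_late hM hε h0.1
  have hs := h.lt_end h1
  have hJ := h.Ico_subset h1
  have h1s := h.mem_stateTimes_of_le h0 h1 h01.le
  have hJs : Ico τ₁ τs ⊆ stateTimes s J γ := fun t ht =>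
    h.mem_stateTimes_of_le h1s (hJ ht) ht.1
  have hV := fun τ hτ => (hl τ hτ).2.2.1
  have hUp := fun τ hτ => (hl τ hτ).2.1
  obtain ⟨K₁, hK₁⟩ := (h.isNullCoord_stateTimes_fst s).exists_coordRate_bound E h1s hs hJs
    ((h.antitoneOn_velocity_fst hM h1 hV).congr fun t ht => (h.deriv_fst (hJ ht)).symm)
  obtain ⟨K₂, hK₂⟩ := (h.isNullCoord_leftCoord hM s).exists_coordRate_bound E h1s hs hJs
    (h.antitoneOn_deriv_leftCoord hM s h1 hUp hV)
  obtain ⟨K₃, hK₃⟩ := h.exists_leftCoord_acceleration_bound hM s h1 hUp hV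
  obtain ⟨K₄, hK₄⟩ := exists_abs_sub_singularRate_le hM ε
  -- `K₁` and `K₂` come from the two null coordinates, `K₃` from exchanging the left coordinate for
  -- `V`, and `K₄` from the expansion in `2M/r`.
  refine ⟨τ₁, h01, 1 / (4 * Real.pi) * (K₁ + K₂ + K₃) + K₄, ?_⟩
  filter_upwards [hK₁, hK₂, h.mem_nhdsLT h1] with τ b₁ b₂ hτ t ht ht1
  have b₁ := b₁ t ht ht1
  have b₂ := b₂ t ht ht1
  have b₃ := hK₃ τ hτ
  have b₄ := hK₄ _ (h.radius_pos hM (hJ hτ)) (hl τ hτ).1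
  have hsum := h.acceleration_sum hM (hJ hτ) (hl τ hτ).2.2.2
  rw [h.deriv_fst (hJ hτ), h.deriv_deriv_fst (hJ hτ)] at b₁
  unfold transitionRate
  have hpi : 0 < 1 / (4 * Real.pi) := by have := Real.pi_pos; positivity
  generalize coordRate E (fun t => (γ t).1) _ _ t τ = A at *
  generalize coordRate E (fun t => s.leftCoord M (γ t)) _ _ t τ = B at *
  generalize 1 / (4 * Real.pi) = q at *
  rw [← neg_eq_iff_eq_neg] at hsum
  rw [← hsum] at b₄
  rw [abs_le] at *
  have c1 : q * (A + B - ((deriv (deriv γ) τ).1 / (deriv γ τ).1 +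
      (deriv (deriv γ) τ).2 / (deriv γ τ).2)) ≤ q * (K₁ + K₂ + K₃) :=
    mul_le_mul_of_nonneg_left (by linarith) hpi.le
  have c2 : q * -(K₁ + K₂ + K₃) ≤ q * (A + B - ((deriv (deriv γ) τ).1 / (deriv γ τ).1 +
      (deriv (deriv γ) τ).2 / (deriv γ τ).2)) :=
    mul_le_mul_of_nonneg_left (by linarith) hpi.le
  constructor <;> linarith

theorem nearSingularityLaw_transitionRate (h : IsInfallingGeodesic M ε J τs γ) (hM : 0 < M)
    (hε : 0 ≤ ε) (E : ℝ) (s : Vacuum) {τ₀ : ℝ} (h0 : τ₀ ∈ stateTimes s J γ) :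
    NearSingularityLaw M ε τs (fun τ => radius M (γ τ)) (transitionRate M E s γ τ₀) := by
  obtain ⟨τ₁, h01, K, hK⟩ := h.exists_transitionRate_bound hM hε E s h0
  exact h.nearSingularityLaw hM hε h0.1 (hK.mono fun τ hτ => hτ τ₀ h0 h01.le)

theorem mem_stateTimes_of_one_le (h : IsInfallingGeodesic M ε J τs γ) (hM : 0 < M)
    (hε : 1 ≤ ε) (s : Vacuum) {τ : ℝ} (hτ : τ ∈ J) : τ ∈ stateTimes s J γ := by
  cases s with
  | hhi => rwa [h.stateTimes_hhi]
  | unruh => exact h.mem_stateTimes_unruh.2 ⟨hτ, h.V_pos hM hε hτ⟩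

/-- A detector that falls in from infinity can be switched on in the infinite past. -/
theorem exists_past_transitionRate (h : IsInfallingGeodesic M ε J τs γ) (hM : 0 < M)
    (hε : 1 ≤ ε) (hJ : J = Iio τs) (E : ℝ) (s : Vacuum) :
    ∃ R : ℝ → ℝ, (∀ τ ∈ J, Tendsto (fun τ₀ => transitionRate M E s γ τ₀ τ) atBot (𝓝 (R τ))) ∧
      NearSingularityLaw M ε τs (fun τ => radius M (γ τ)) R := by
  have hall : ∀ τ ∈ J, τ ∈ stateTimes s J γ := fun τ => h.mem_stateTimes_of_one_le hM hε s
  have hlim : ∀ τ, ∃ l, τ ∈ J →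
      Tendsto (fun τ₀ => transitionRate M E s γ τ₀ τ) atBot (𝓝 l) := by
    intro τ
    by_cases hτ : τ ∈ J
    · have hI : Iic τ ⊆ stateTimes s J γ := fun t ht => hall t (by
        rw [hJ] at hτ ⊢; exact lt_of_le_of_lt (mem_Iic.1 ht) (mem_Iio.1 hτ))
      obtain ⟨l₁, hl₁⟩ := (h.isNullCoord_stateTimes_fst s).exists_tendsto_coordRate E
        (hall τ hτ) hI
      obtain ⟨l₂, hl₂⟩ := (h.isNullCoord_leftCoord hM s).exists_tendsto_coordRate E
        (hall τ hτ) hI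
      exact ⟨_, fun _ => (hl₁.add hl₂).const_mul _⟩
    · exact ⟨0, fun hτ' => absurd hτ' hτ⟩
  choose R hR using hlim
  refine ⟨R, hR, ?_⟩
  have h0 : τs - 1 ∈ J := by rw [hJ]; exact sub_one_lt τs
  obtain ⟨τ₁, h01, K, hK⟩ := h.exists_transitionRate_bound hM (by linarith) E s (hall _ h0)
  refine h.nearSingularityLaw hM (by linarith) h0 (K := K) ?_
  filter_upwards [hK, h.mem_nhdsLT h0] with τ hτ hτ'
  -- The bound `K` does not depend on the switch-on time, so it survives the limit.
  refine le_of_tendsto ((hR τ (h.Ico_subset h0 hτ')).sub_const _).abs ?_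
  filter_upwards [eventually_le_atBot (τs - 1)] with t ht
  refine hτ t (hall t ?_) (ht.trans h01.le)
  rw [hJ]
  exact ht.trans_lt (sub_one_lt τs)

end IsInfallingGeodesic

end SchwarzschildDetector

open SchwarzschildDetector in
theorem mainTheorem9 (M ε E : ℝ) (hM : 0 < M) (hε : 0 ≤ ε)
    (J : Set ℝ) (τs : ℝ) (γ : ℝ → ℝ × ℝ) (hγ : IsInfallingGeodesic M ε J τs γ)
    (s : Vacuum) (c : ℝ) :
    ∃ R : ℝ → ℝ → ℝ,
      -- sharp switch-on at any finite proper time at which the state is defined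
      (∀ τ₀ ∈ J, γ τ₀ ∈ s.region →
        (∀ τ ∈ Set.Ioo τ₀ τs,
          IsTransitionRate (fun a b => wightman M s c (γ a) (γ b)) E τ₀ τ (R τ₀ τ)) ∧
        NearSingularityLaw M ε τs (fun τ => radius M (γ τ)) (R τ₀)) ∧
      -- switch-on in the asymptotic past, for trajectories that fall in from infinity
      (1 ≤ ε → J = Set.Iio τs →
        (∀ τ₀ ∈ J, γ τ₀ ∈ s.region) ∧
        ∃ Rpast : ℝ → ℝ,
          (∀ τ ∈ J, Tendsto (fun τ₀ => R τ₀ τ) atBot (𝓝 (Rpast τ))) ∧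
          NearSingularityLaw M ε τs (fun τ => radius M (γ τ)) Rpast) := by
  refine ⟨IsInfallingGeodesic.transitionRate M E s γ, fun τ₀ h0 hs => ⟨fun τ hτ =>
    hγ.isTransitionRate hM E s c ⟨h0, hs⟩ hτ,
    hγ.nearSingularityLaw_transitionRate hM hε E s ⟨h0, hs⟩⟩, fun h1 hJ =>
    ⟨fun τ hτ => (hγ.mem_stateTimes_of_one_le hM h1 s hτ).2,
      hγ.exists_past_transitionRate hM h1 hJ E s⟩⟩
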